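/- Let $N\ge 1$, let $B_N$ be the open unit ball of $\mathbb C^N$, and let $\mathcal H$ be either the Hardy space $H^2(B_N)$ of holomorphic $f$ on $B_N$ with $\|f\|^2=\sup_{0<r<1}\int_{\partial B_N}|f(r\zeta)|^2\,d\sigma(\zeta)<\infty$ ($\sigma$ the normalized surface measure), or, for some $s>-1$, the weighted Bergman space $A^2_s(B_N)$ of holomorphic $f$ on $B_N$ with $\|f\|^2=\int_{B_N}|f(z)|^2\frac{\Gamma(N+s+1)}{\Gamma(N+1)\Gamma(s+1)}(1-|z|^2)^s\,d\nu(z)<\infty$ ($\nu$ the normalized volume measure). For an analytic map $\varphi:B_N\to B_N$, let $C_\varphi f=f\circ\varphi$. For $\zeta\in\partial B_N$ write $\varphi(\zeta)=\lim_{r\to1^-}\varphi(r\zeta)$ when this radial limit exists, and $$d_\varphi(\zeta)=\liminf_{z\to\zeta,\ z\in B_N}\frac{1-|\varphi(z)|}{1-|z|}\in[0,\infty].$$ A function $f:B_N\to\mathbb C$ has restricted limit $L\in\mathbb C$ at $\zeta$ if $f(\Gamma(t))\to L$ as $t\to1^-$ for every curve $\Gamma:[0,1)\to B_N$ with $\Gamma(t)\to\zeta$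 as $t\to 1^-$ which, with $\gamma(t)=\langle\Gamma(t),\zeta\rangle\zeta$, satisfies $|\Gamma(t)-\gamma(t)|^2/(1-|\gamma(t)|^2)\to0$ as $t\to1^-$ and $\sup_{0\le t<1}|\gamma(t)-\zeta|/(1-|\gamma(t)|)<\infty$. The map $\varphi$ has finite angular derivative at $\zeta$ if for some $\eta\in\partial B_N$ the quotient $\langle\eta-\varphi(z),\eta\rangle/\langle\zeta-z,\zeta\rangle$ has a (finite) restricted limit at $\zeta$. Let $\varphi_1,\dots,\varphi_m:B_N\to B_N$ be analytic maps such that $C_{\varphi_1},\dots,C_{\varphi_m}$ are bounded on $\mathcal H$, and let $c_1,\dots,c_m\in\mathbb C$ be such that $c_1C_{\varphi_1}+\cdots+c_mC_{\varphi_m}$ is compact on $\mathcal H$. Then for every $\zeta\in\partial B_N$ and every $j$ such that $\varphi_j$ has finite angular derivative at $\zeta$, $$\sum_{\substack{1\le l\le m\\ \varphi_l(\zeta)=\varphi_j(\zeta),\ d_{\varphi_l}(\zeta)=d_{\varphi_j}(\zeta)}}c_l=0,$$ where the condition $\varphi_l(\zeta)=\varphi_j(\zeta)$ means that both radial limits exist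 and are equal. -/

import Mathlib

open MeasureTheory Filter Topology
open scoped ENNReal

namespace UnitBall

/-- `ℂ^N` with the Euclidean norm. -/
abbrev CN (N : ℕ) : Type := EuclideanSpace ℂ (Fin N)

/-- The open unit ball `B_N`. -/
abbrev Ball (N : ℕ) : Type := Metric.ball (0 : CN N) 1

/-- The unit sphere `∂B_N`. -/
abbrev Sph (N : ℕ) : Type := Metric.sphere (0 : CN N) 1

/-- Holomorphy of a function (scalar or vector valued) defined on the open ball. -/
def IsHolo {N : ℕ} {V : Type*} [NormedAddCommGroup V] [NormedSpace ℂ V] (f : Ball N → V) : Prop :=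
  ∃ F : CN N → V, DifferentiableOn ℂ F (Metric.ball 0 1) ∧ ∀ z : Ball N, F z = f z

/-- An analytic map from `B_N` into `B_N`. -/
def IsHoloSelfMap {N : ℕ} (φ : Ball N → Ball N) : Prop :=
  IsHolo fun z => (φ z : CN N)

/-- The point `r ζ` of the ball, for `0 < r < 1` and `ζ` on the sphere. -/
noncomputable def dil {N : ℕ} (r : Set.Ioo (0 : ℝ) 1) (ζ : Sph N) : Ball N :=
  ⟨(r : ℝ) • (ζ : CN N), by
    have h : ‖(ζ : CN N)‖ = 1 := norm_eq_of_mem_sphere ζ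
    rw [mem_ball_zero_iff, norm_smul, h, mul_one, Real.norm_of_nonneg r.2.1.le]
    exact r.2.2⟩

/-! ### The function spaces -/

/-- Normalized Lebesgue (surface) measure on the sphere. -/
noncomputable def sphereMeasure (N : ℕ) : Measure (Sph N) :=
  ((volume : Measure (CN N)).toSphere Set.univ)⁻¹ • (volume : Measure (CN N)).toSphere

/-- Normalized Lebesgue volume measure on the ball. -/
noncomputable def ballMeasure (N : ℕ) : Measure (Ball N) :=
  ((volume : Measure (CN N)) (Metric.ball 0 1))⁻¹ •
    (volume : Measure (CN N)).comap (Subtype.val : Ball N → CN N)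

/-- The weight `w_s`. -/
noncomputable def weight (N : ℕ) (s : ℝ) (z : Ball N) : ℝ :=
  Real.Gamma (N + s + 1) / (Real.Gamma (N + 1) * Real.Gamma (s + 1)) * (1 - ‖(z : CN N)‖ ^ 2) ^ s

/-- Squared Hardy norm `sup_{0<r<1} ∫ |f(rζ)|² dσ(ζ)`, as an extended nonnegative number. -/
noncomputable def hardySq {N : ℕ} (f : Ball N → ℂ) : ℝ≥0∞ :=
  ⨆ r : Set.Ioo (0 : ℝ) 1, ∫⁻ ζ, ‖f (dil r ζ)‖ₑ ^ 2 ∂(sphereMeasure N)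

/-- Squared weighted Bergman norm `∫ |f(z)|² w_s(z) dν(z)`, as an extended nonnegative number. -/
noncomputable def bergmanSq {N : ℕ} (s : ℝ) (f : Ball N → ℂ) : ℝ≥0∞ :=
  ∫⁻ z, ‖f z‖ₑ ^ 2 * ENNReal.ofReal (weight N s z) ∂(ballMeasure N)

/-- The squared norm of `A²_s` for `s ≥ -1`, with the convention `A²_{-1} = H²`. -/
noncomputable def normSq {N : ℕ} (s : ℝ) (f : Ball N → ℂ) : ℝ≥0∞ :=
  if s = -1 then hardySq f else bergmanSq s f

theorem IsHolo.continuous {N : ℕ} {V : Type*} [NormedAddCommGroup V] [NormedSpace ℂ V]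
    {f : Ball N → V} (hf : IsHolo f) : Continuous f := by
  obtain ⟨F, hF, h⟩ := hf
  have := continuousOn_iff_continuous_domRestrict.1 hF.continuousOn
  exact this.congr h

theorem continuous_dil {N : ℕ} (r : Set.Ioo (0 : ℝ) 1) :
    Continuous (dil r : Sph N → Ball N) := by
  unfold dil
  fun_prop

theorem measurable_weight (N : ℕ) (s : ℝ) : Measurable (weight N s) := by
  unfold weight
  fun_prop

theorem weight_pos {N : ℕ} {s : ℝ} (hs : -1 < s) (z : Ball N) : 0 < weight N s z := by
  have h0 : ‖(z : CN N)‖ < 1 := mem_ball_zero_iff.1 z.2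
  have h1 : (0 : ℝ) < 1 - ‖(z : CN N)‖ ^ 2 := by nlinarith [norm_nonneg (z : CN N)]
  have hN : (0 : ℝ) ≤ N := N.cast_nonneg
  have := Real.Gamma_pos_of_pos (show (0 : ℝ) < N + s + 1 by linarith)
  have := Real.Gamma_pos_of_pos (show (0 : ℝ) < N + 1 by linarith)
  have := Real.Gamma_pos_of_pos (show (0 : ℝ) < s + 1 by linarith)
  unfold weight
  have := Real.rpow_pos_of_pos h1 s
  positivity

theorem lintegral_sq_eq {α : Type*} [MeasurableSpace α] (μ : Measure α) (f : α → ℂ) :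
    ∫⁻ x, ‖f x‖ₑ ^ 2 ∂μ = eLpNorm f 2 μ ^ 2 := by
  have := eLpNorm_nnreal_pow_eq_lintegral (f := f) (μ := μ) (p := 2) (by norm_num)
  simpa using this.symm

theorem hardySq_eq {N : ℕ} (f : Ball N → ℂ) :
    hardySq f = (⨆ r : Set.Ioo (0 : ℝ) 1, eLpNorm (fun ζ => f (dil r ζ)) 2 (sphereMeasure N)) ^ 2 := by
  simp only [hardySq, lintegral_sq_eq]
  have : Nonempty (Set.Ioo (0 : ℝ) 1) := ⟨⟨1 / 2, by norm_num, by norm_num⟩⟩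
  rw [ENNReal.iSup_pow]

theorem bergmanSq_eq {N : ℕ} (s : ℝ) {f : Ball N → ℂ} (hf : Continuous f) :
    bergmanSq s f =
      eLpNorm f 2 ((ballMeasure N).withDensity fun z => ENNReal.ofReal (weight N s z)) ^ 2 := by
  rw [← lintegral_sq_eq, lintegral_withDensity_eq_lintegral_mul _
    (measurable_weight N s).ennreal_ofReal (by have := hf.measurable; fun_prop)]
  simp [bergmanSq, mul_comm]

/-- The square root of `normSq` is subadditive, homogeneous. -/
theorem normSq_eq {N : ℕ} (s : ℝ) : ∃ p : (Ball N → ℂ) → ℝ≥0∞,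
    (∀ f, Continuous f → normSq s f = p f ^ 2) ∧
    (∀ f g, Continuous f → Continuous g → p (f + g) ≤ p f + p g) ∧
    (∀ (c : ℂ) f, p (c • f) = ‖c‖ₑ * p f) := by
  by_cases h : s = -1
  · refine ⟨fun f => ⨆ r : Set.Ioo (0 : ℝ) 1,
      eLpNorm (fun ζ => f (dil r ζ)) 2 (sphereMeasure N), ?_, ?_, ?_⟩
    · intro f _
      simp only [normSq, if_pos h]
      exact hardySq_eq f
    · intro f g hf hg
      refine iSup_le fun r => ?_
      refine (eLpNorm_add_le (f := fun ζ => f (dil r ζ)) (g := fun ζ => g (dil r ζ))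
        (hf.comp (continuous_dil r)).aestronglyMeasurable
        (hg.comp (continuous_dil r)).aestronglyMeasurable (by norm_num)).trans ?_
      exact add_le_add (le_iSup (fun r : Set.Ioo (0 : ℝ) 1 =>
          eLpNorm (fun ζ => f (dil r ζ)) 2 (sphereMeasure N)) r)
        (le_iSup (fun r : Set.Ioo (0 : ℝ) 1 =>
          eLpNorm (fun ζ => g (dil r ζ)) 2 (sphereMeasure N)) r)
    · intro c f
      simp only [ENNReal.mul_iSup]
      refine iSup_congr fun r => ?_
      exact eLpNorm_const_smul c (fun ζ => f (dil r ζ)) 2 (sphereMeasure N)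
  · refine ⟨fun f => eLpNorm f 2
      ((ballMeasure N).withDensity fun z => ENNReal.ofReal (weight N s z)), ?_, ?_, ?_⟩
    · intro f hf
      simp only [normSq, if_neg h]
      exact bergmanSq_eq s hf
    · intro f g hf hg
      exact eLpNorm_add_le hf.aestronglyMeasurable hg.aestronglyMeasurable (by norm_num)
    · intro c f
      exact eLpNorm_const_smul c f 2 _

/-- The holomorphic functions `f` on `B_N` with `normSq s f < ∞`, as a linear subspace of all
functions on the ball. -/
noncomputable def A2Submodule (N : ℕ) (s : ℝ) : Submodule ℂ (Ball N → ℂ) where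
  carrier := {f | IsHolo f ∧ normSq s f < ∞}
  zero_mem' := by
    have h0 : IsHolo (0 : Ball N → ℂ) := ⟨0, by fun_prop, fun _ => rfl⟩
    refine ⟨h0, ?_⟩
    obtain ⟨p, hp, -, hs⟩ := normSq_eq (N := N) s
    have := hs 0 0
    simp only [zero_smul, enorm_zero, zero_mul] at this
    rw [hp _ h0.continuous, this]
    simp
  add_mem' := by
    rintro f g ⟨hf, hf'⟩ ⟨hg, hg'⟩
    have hfg : IsHolo (f + g) := by
      obtain ⟨F, hF, hFf⟩ := hf
      obtain ⟨G, hG, hGg⟩ := hg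
      exact ⟨F + G, hF.add hG, fun z => by simp [hFf, hGg]⟩
    refine ⟨hfg, ?_⟩
    obtain ⟨p, hp, ha, -⟩ := normSq_eq (N := N) s
    rw [hp _ hf.continuous] at hf'
    rw [hp _ hg.continuous] at hg'
    rw [hp _ hfg.continuous]
    simp only [ENNReal.pow_lt_top_iff, OfNat.ofNat_ne_zero, or_false] at *
    exact (ha f g hf.continuous hg.continuous).trans_lt (ENNReal.add_lt_top.2 ⟨hf', hg'⟩)
  smul_mem' := by
    rintro c f ⟨hf, hf'⟩
    have hcf : IsHolo (c • f) := by
      obtain ⟨F, hF, hFf⟩ := hf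
      exact ⟨c • F, hF.const_smul c, fun z => by simp [hFf]⟩
    refine ⟨hcf, ?_⟩
    obtain ⟨p, hp, -, hs⟩ := normSq_eq (N := N) s
    rw [hp _ hf.continuous] at hf'
    rw [hp _ hcf.continuous, hs]
    simp only [ENNReal.pow_lt_top_iff, OfNat.ofNat_ne_zero, or_false] at *
    exact ENNReal.mul_lt_top enorm_lt_top hf'

/-- The Hardy space `H²(B_N)` (for `s = -1`) and the weighted Bergman space `A²_s(B_N)`
(for `s > -1`). This is a type of its own, so that it carries the norm topology and not the
topology of pointwise convergence. -/
def A2 (N : ℕ) (s : Set.Ici (-1 : ℝ)) : Type := A2Submodule N s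

noncomputable instance (N : ℕ) (s : Set.Ici (-1 : ℝ)) : AddCommGroup (A2 N s) :=
  inferInstanceAs (AddCommGroup (A2Submodule N s))

noncomputable instance (N : ℕ) (s : Set.Ici (-1 : ℝ)) : Module ℂ (A2 N s) :=
  inferInstanceAs (Module ℂ (A2Submodule N s))

instance (N : ℕ) (s : Set.Ici (-1 : ℝ)) : CoeFun (A2 N s) fun _ => Ball N → ℂ :=
  ⟨fun f => f.1⟩

/-- A holomorphic function of finite norm, as an element of the space. -/
def A2.mk {N : ℕ} {s : Set.Ici (-1 : ℝ)} (f : Ball N → ℂ) (hf : f ∈ A2Submodule N s) : A2 N s :=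
  ⟨f, hf⟩

/-- The norm `‖f‖ = (normSq s f)^{1/2}`. -/
noncomputable instance (N : ℕ) (s : Set.Ici (-1 : ℝ)) : Norm (A2 N s) :=
  ⟨fun f => √(normSq (s : ℝ) (f : Ball N → ℂ)).toReal⟩

theorem A2.norm_def {N : ℕ} {s : Set.Ici (-1 : ℝ)} (f : A2 N s) :
    ‖f‖ = √(normSq (s : ℝ) (f : Ball N → ℂ)).toReal := rfl

instance isOpenPosMeasure_ballMeasure (N : ℕ) : (ballMeasure N).IsOpenPosMeasure := by
  have hc : (volume : Measure (CN N)) (Metric.ball 0 1) ≠ ∞ := measure_ball_lt_top.ne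
  refine ⟨fun U hU hne => ?_⟩
  have hU' : IsOpen (Subtype.val '' U : Set (CN N)) :=
    Metric.isOpen_ball.isOpenMap_subtype_val U hU
  have hpos := hU'.measure_ne_zero (volume : Measure (CN N)) (hne.image _)
  rw [ballMeasure, Measure.smul_apply,
    (MeasurableEmbedding.subtype_coe Metric.isOpen_ball.measurableSet).comap_apply]
  simp only [smul_eq_mul, ne_eq, mul_eq_zero, ENNReal.inv_eq_zero, not_or]
  exact ⟨hc, hpos⟩

instance isOpenPosMeasure_sphereMeasure (N : ℕ) : (sphereMeasure N).IsOpenPosMeasure := by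
  refine ⟨fun U hU hne => ?_⟩
  have hpos := hU.measure_ne_zero (volume : Measure (CN N)).toSphere hne
  have hc := measure_ne_top (volume : Measure (CN N)).toSphere Set.univ
  rw [sphereMeasure, Measure.smul_apply]
  simp only [smul_eq_mul, ne_eq, mul_eq_zero, ENNReal.inv_eq_zero, not_or]
  exact ⟨hc, hpos⟩

theorem eq_zero_of_normSq {N : ℕ} [NeZero N] {s : ℝ} (hs : -1 ≤ s) {f : Ball N → ℂ}
    (hf : Continuous f) (h : normSq s f = 0) : f = 0 := by
  rcases hs.eq_or_lt with rfl | hs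
  · simp only [normSq, if_true, hardySq, ENNReal.iSup_eq_zero] at h
    have key : ∀ (r : Set.Ioo (0 : ℝ) 1) (ζ : Sph N), f (dil r ζ) = 0 := by
      intro r
      have hcont : Continuous fun ζ : Sph N => f (dil r ζ) := hf.comp (continuous_dil r)
      have h1 := (lintegral_eq_zero_iff (hcont.measurable.enorm.pow_const 2)).1 (h r)
      have h2 : (fun ζ : Sph N => f (dil r ζ)) =ᵐ[sphereMeasure N] fun _ => 0 := by
        filter_upwards [h1] with ζ hζ
        simpa using hζ
      have h3 := (Continuous.ae_eq_iff_eq (sphereMeasure N) hcont continuous_const).1 h2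
      exact fun ζ => congrFun h3 ζ
    have hne : ∀ z : Ball N, (z : CN N) ≠ 0 → f z = 0 := by
      intro z hz
      have hz1 : ‖(z : CN N)‖ < 1 := mem_ball_zero_iff.1 z.2
      have hz0 : 0 < ‖(z : CN N)‖ := norm_pos_iff.2 hz
      have := key ⟨‖(z : CN N)‖, hz0, hz1⟩ ⟨‖(z : CN N)‖⁻¹ • (z : CN N), by
        simp [norm_smul, hz0.ne']⟩
      convert this using 2
      ext1
      simp [dil, smul_smul, hz0.ne']
    funext z
    by_cases hz : (z : CN N) = 0
    · let e : Sph N := ⟨EuclideanSpace.single 0 1, by simp⟩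
      have ht : Tendsto (fun n : ℕ => (dil ⟨1 / ((n : ℝ) + 2), by positivity, by
          rw [div_lt_one (by positivity)]; have := n.cast_nonneg (α := ℝ); linarith⟩ e : Ball N))
          atTop (𝓝 z) := by
        rw [tendsto_subtype_rng]
        simp only [dil, hz]
        have h1 : Tendsto (fun n : ℕ => 1 / ((n : ℝ) + 2)) atTop (𝓝 0) := by
          have := (tendsto_one_div_add_atTop_nhds_zero_nat (𝕜 := ℝ)).comp (tendsto_add_atTop_nat 1)
          refine this.congr fun n => ?_
          simp only [Function.comp_apply]
          push_cast
          ring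
        have := h1.smul_const (e : CN N)
        rwa [zero_smul] at this
      have h2 := (hf.tendsto z).comp ht
      refine tendsto_nhds_unique h2 ?_
      refine tendsto_const_nhds.congr fun n => ?_
      simp [key]
    · exact hne z hz
  · have hne : s ≠ -1 := hs.ne'
    simp only [normSq, if_neg hne, bergmanSq] at h
    have h1 := (lintegral_eq_zero_iff (by
      have := hf.measurable
      have := measurable_weight N s
      fun_prop)).1 h
    have h2 : f =ᵐ[ballMeasure N] fun _ => 0 := by
      filter_upwards [h1] with z hz
      have := weight_pos hs z
      simpa [this.not_ge] using hz
    exact (Continuous.ae_eq_iff_eq (ballMeasure N) hf continuous_const).1 h2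

theorem A2.norm_eq {N : ℕ} (s : Set.Ici (-1 : ℝ)) : ∃ p : (Ball N → ℂ) → ℝ≥0∞,
    (∀ f : A2 N s, ‖f‖ = (p f).toReal ∧ p f ≠ ∞) ∧
    (∀ f g : A2 N s, p (f + g : A2 N s) ≤ p f + p g) ∧
    (∀ (c : ℂ) (f : A2 N s), p (c • f : A2 N s) = ‖c‖ₑ * p f) := by
  obtain ⟨p, hp, ha, hs⟩ := normSq_eq (N := N) (s : ℝ)
  refine ⟨p, fun f => ⟨?_, ?_⟩,
    fun f g => ha f.1 g.1 f.2.1.continuous g.2.1.continuous, fun c f => hs c f.1⟩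
  · rw [A2.norm_def, hp _ f.2.1.continuous, ENNReal.toReal_pow, Real.sqrt_sq ENNReal.toReal_nonneg]
  · have := f.2.2
    rw [hp _ f.2.1.continuous] at this
    simp only [ENNReal.pow_lt_top_iff, OfNat.ofNat_ne_zero, or_false] at this
    exact this.ne

theorem A2.normedCore (N : ℕ) [NeZero N] (s : Set.Ici (-1 : ℝ)) :
    NormedSpace.Core ℂ (A2 N s) where
  norm_nonneg f := Real.sqrt_nonneg _
  norm_smul c f := by
    obtain ⟨p, hp, -, hs⟩ := A2.norm_eq (N := N) s
    rw [(hp _).1, hs, (hp f).1, ENNReal.toReal_mul, toReal_enorm]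
  norm_triangle f g := by
    obtain ⟨p, hp, ha, -⟩ := A2.norm_eq (N := N) s
    rw [(hp _).1, (hp f).1, (hp g).1, ← ENNReal.toReal_add (hp f).2 (hp g).2]
    exact ENNReal.toReal_mono (ENNReal.add_ne_top.2 ⟨(hp f).2, (hp g).2⟩) (ha f g)
  norm_eq_zero_iff f := by
    constructor
    · intro h
      rw [A2.norm_def, Real.sqrt_eq_zero ENNReal.toReal_nonneg, ENNReal.toReal_eq_zero_iff] at h
      have h0 : normSq (s : ℝ) f.1 = 0 := h.resolve_right f.2.2.ne
      exact Subtype.ext (eq_zero_of_normSq s.2 f.2.1.continuous h0)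
    · rintro rfl
      obtain ⟨p, hp, -, hs⟩ := A2.norm_eq (N := N) s
      have := hs 0 0
      simp only [zero_smul, enorm_zero, zero_mul] at this
      rw [(hp _).1, this, ENNReal.toReal_zero]

noncomputable instance (N : ℕ) [NeZero N] (s : Set.Ici (-1 : ℝ)) : NormedAddCommGroup (A2 N s) :=
  NormedAddCommGroup.ofCore (A2.normedCore N s)

noncomputable instance (N : ℕ) [NeZero N] (s : Set.Ici (-1 : ℝ)) : NormedSpace ℂ (A2 N s) :=
  NormedSpace.ofCore (A2.normedCore N s)

/-! ### Composition operators -/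

/-- `C_φ` is a bounded operator on `A²_s(B_N)`: it maps the space into itself, and
`‖f ∘ φ‖ ≤ K ‖f‖` with a constant `K`. -/
def IsCompBounded {N : ℕ} (s : Set.Ici (-1 : ℝ)) (φ : Ball N → Ball N) : Prop :=
  ∃ h : ∀ f : A2 N s, (f : Ball N → ℂ) ∘ φ ∈ A2Submodule N s,
    ∃ K : ℝ, ∀ f : A2 N s, ‖A2.mk ((f : Ball N → ℂ) ∘ φ) (h f)‖ ≤ K * ‖f‖

/-- The bounded composition operator `C_φ f = f ∘ φ` on `A²_s(B_N)`. -/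
noncomputable def compOp {N : ℕ} [NeZero N] (s : Set.Ici (-1 : ℝ)) (φ : Ball N → Ball N)
    (hφ : IsCompBounded s φ) : A2 N s →L[ℂ] A2 N s :=
  LinearMap.mkContinuousOfExistsBound
    { toFun := fun f => A2.mk ((f : Ball N → ℂ) ∘ φ) (hφ.1 f)
      map_add' := fun _ _ => rfl
      map_smul' := fun _ _ => rfl } (Exists.elim hφ fun _ h => h)

theorem compOp_apply {N : ℕ} [NeZero N] (s : Set.Ici (-1 : ℝ)) (φ : Ball N → Ball N)
    (hφ : IsCompBounded s φ) (f : A2 N s) (z : Ball N) : compOp s φ hφ f z = f (φ z) := rfl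

/-! ### Boundary behaviour -/

/-- A restricted `ζ`-curve: a curve `Γ : [0,1) → B_N` tending to `ζ`, such that, with
`γ(t) = ⟨Γ(t), ζ⟩ ζ` its projection onto the complex line through `ζ`,
`|Γ(t) - γ(t)|² / (1 - |γ(t)|²) → 0` and `|γ(t) - ζ| / (1 - |γ(t)|)` is bounded.
(Mathlib's inner product is linear in its second argument.) -/
def IsRestrictedCurve {N : ℕ} (ζ : Sph N) (Γ : ℝ → Ball N) : Prop :=
  let γ : ℝ → CN N := fun t => inner ℂ (ζ : CN N) (Γ t : CN N) • (ζ : CN N)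
  ContinuousOn Γ (Set.Ico 0 1) ∧
  Tendsto (fun t => (Γ t : CN N)) (𝓝[<] 1) (𝓝 (ζ : CN N)) ∧
  Tendsto (fun t => ‖(Γ t : CN N) - γ t‖ ^ 2 / (1 - ‖γ t‖ ^ 2)) (𝓝[<] 1) (𝓝 0) ∧
  ∃ M : ℝ, ∀ t ∈ Set.Ico (0 : ℝ) 1, ‖γ t - (ζ : CN N)‖ / (1 - ‖γ t‖) ≤ M

/-- `f` has restricted limit `L` at `ζ`. -/
def HasRestrictedLimit {N : ℕ} (f : Ball N → ℂ) (ζ : Sph N) (L : ℂ) : Prop :=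
  ∀ Γ : ℝ → Ball N, IsRestrictedCurve ζ Γ → Tendsto (fun t => f (Γ t)) (𝓝[<] 1) (𝓝 L)

/-- `φ` has finite angular derivative at `ζ`: for some `η ∈ ∂B_N` the quotient
`⟨η - φ(z), η⟩ / ⟨ζ - z, ζ⟩` has a (finite) restricted limit at `ζ`. -/
def HasFiniteAngularDeriv {N : ℕ} (φ : Ball N → Ball N) (ζ : Sph N) : Prop :=
  ∃ (η : Sph N) (L : ℂ), HasRestrictedLimit
    (fun z => inner ℂ (η : CN N) ((η : CN N) - (φ z : CN N)) /
      inner ℂ (ζ : CN N) ((ζ : CN N) - (z : CN N))) ζ L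

/-- `d_φ(ζ) = liminf_{z → ζ} (1 - |φ(z)|) / (1 - |z|)`, a number in `[0, ∞]`; here `z` tends to
`ζ` unrestrictedly in the ball. -/
noncomputable def angDeriv {N : ℕ} (φ : Ball N → Ball N) (ζ : Sph N) : ℝ≥0∞ :=
  liminf (fun z : Ball N => ENNReal.ofReal ((1 - ‖(φ z : CN N)‖) / (1 - ‖(z : CN N)‖)))
    (comap (Subtype.val : Ball N → CN N) (𝓝 (ζ : CN N)))

/-- `φ` has radial limit `η` at `ζ`, that is, `φ(ζ) = lim_{r → 1} φ(rζ)` exists and equals `η`. -/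
def HasRadialLimit {N : ℕ} (φ : Ball N → Ball N) (ζ : Sph N) (η : CN N) : Prop :=
  Tendsto (fun r : Set.Ioo (0 : ℝ) 1 => (φ (dil r ζ) : CN N))
    (comap (Subtype.val : Set.Ioo (0 : ℝ) 1 → ℝ) (𝓝 1)) (𝓝 η)

/-- `φ(ζ) = ψ(ζ)` (as radial limits, which have to exist) and `d_φ(ζ) = d_ψ(ζ)`. -/
def SameBoundaryData {N : ℕ} (φ ψ : Ball N → Ball N) (ζ : Sph N) : Prop :=
  (∃ η : CN N, HasRadialLimit φ ζ η ∧ HasRadialLimit ψ ζ η) ∧ angDeriv φ ζ = angDeriv ψ ζ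

open Classical in
/-- The set of indices `l` with `φ_l(ζ) = φ_j(ζ)` and `d_{φ_l}(ζ) = d_{φ_j}(ζ)`. -/
noncomputable def sameDataIndices {N m : ℕ} (φ : Fin m → Ball N → Ball N) (ζ : Sph N)
    (j : Fin m) : Finset (Fin m) :=
  {l | SameBoundaryData (φ l) (φ j) ζ}

end UnitBall

namespace UnitBall

/-! Write `κ = N + s + 1`; the Hardy space is the case `s = -1`. The proof tests the operator on
powers `(1 - ⟨z, b⟩)^(-t)` of the Szegő kernel, `t` a natural number with `2t > κ`, rather than on
reproducing kernels and the adjoint. Two estimates suffice: such a power has norm `O((1 - |b|)^(κ/2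
- t))`, and point evaluation at `w` has norm `O((1 - |w|)^(-κ/2))`.

Let `w` tend to the sphere while `1 - |w| ≤ const · (1 - |b|)`. Multiplied by `(1 - |w|)^(t - κ/2)`,
the kernel powers stay bounded, and their images tend to `0` pointwise. Compactness improves this to
convergence in norm, and evaluation at `w` gives `(1 - |w|)^t ∑ c_l (1 - ⟨φ_l(w), b⟩)^(-t) → 0`
(`tendsto_sum_kernelPow_of_isCompactOperator`).

Take `w = (1 - (1 + iM)x) ζ` with `x → 0+`, and let `b` be the projection of `φ_j(w)` onto the
complex line of `η = φ_j(ζ)`. By the Julia-Carathéodory theorem (`julia_caratheodory`), `1 -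
⟨φ_l(w), η⟩ ~ d_l (1 + iM) x` whenever `d_l` is finite and `φ_l(ζ) = η`. As `b` enters through a
conjugate, `(1 - |w|) / (1 - ⟨φ_l(w), b⟩)` tends to `1 / (d_l + d_j + i(d_l - d_j)M)`; for all other
`l` it tends to `0`. So for every real `M` the sum of `c_l (d_l + d_j + i(d_l - d_j)M)^(-t)`
vanishes (`sum_mul_inv_pow_eq_zero`). Letting `M → ∞` kills every term with `d_l ≠ d_j`, and the
survivors share the nonzero factor `(2 d_j)^(-t)`.

The Julia-Carathéodory theorem is proved from Schwarz-Pick: `exists_juliaIneq` gives Julia's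
inequality with the optimal constant, and `tendsto_one_sub_mul_of_re_nonneg` turns optimality into a
non-tangential limit. -/

section Estimates

open Measure Set Module

/-! ### Volumes of non-isotropic boxes and caps -/

theorem finrank_CN (N : ℕ) : finrank ℝ (CN N) = 2 * N := by
  rw [← finrank_mul_finrank ℝ ℂ (CN N)]; simp

theorem measurePreserving_repr {N : ℕ} (b : OrthonormalBasis (Fin N) ℂ (CN N)) :
    MeasurePreserving b.repr volume volume :=
  LinearIsometryEquiv.measurePreserving
    ({ b.repr.toLinearEquiv.restrictScalars ℝ with norm_map' := b.repr.norm_map } :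
      CN N ≃ₗᵢ[ℝ] CN N)

theorem measurePreserving_unit_smul {N : ℕ} {u : ℂ} (hu : ‖u‖ = 1) :
    MeasurePreserving (fun z : CN N => u • z) volume volume := by
  have hu0 : u ≠ 0 := by
    rintro rfl
    simp at hu
  exact LinearIsometryEquiv.measurePreserving
    ({ (LinearEquiv.smulOfUnit (Units.mk0 u hu0) : CN N ≃ₗ[ℂ] CN N).restrictScalars ℝ with
        norm_map' := fun z => by
          change ‖u • z‖ = ‖z‖
          rw [norm_smul, hu, one_mul] } : CN N ≃ₗᵢ[ℝ] CN N)

theorem exists_onb {N : ℕ} [NeZero N] {e : CN N} (he : ‖e‖ = 1) :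
    ∃ b : OrthonormalBasis (Fin N) ℂ (CN N), b 0 = e := by
  obtain ⟨b, hb⟩ := Orthonormal.exists_orthonormalBasis_extension_of_card_eq (𝕜 := ℂ)
    (E := CN N) (ι := Fin N) (by simp) (v := fun _ => e) (s := {0}) (by
      refine ⟨fun i => by simpa using he, ?_⟩
      rintro ⟨i, hi⟩ ⟨j, hj⟩ hij
      simp only [mem_singleton_iff] at hi hj
      subst hi hj
      simp at hij)
  exact ⟨b, hb 0 rfl⟩

/-- Euclidean and product volume are both Haar measures, hence proportional. The proportionality
constant is never computed; what matters is that it does not depend on the basis, because unitary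
maps preserve volume. -/
theorem exists_volume_polydisc (N : ℕ) : ∃ K : ℝ≥0∞, K ≠ 0 ∧ K ≠ ∞ ∧
    ∀ (b : OrthonormalBasis (Fin N) ℂ (CN N)) (c : Fin N → ℂ) (ρ : Fin N → ℝ),
      volume {v : CN N | ∀ i, ‖b.repr v i - c i‖ < ρ i} = K * ∏ i, ENNReal.ofReal (ρ i) ^ 2 := by
  let L : CN N ≃L[ℝ] (Fin N → ℂ) := PiLp.continuousLinearEquiv 2 ℝ (fun _ : Fin N => ℂ)
  have : IsAddHaarMeasure ((volume : Measure (CN N)).map L) := L.isAddHaarMeasure_map _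
  set k := addHaarScalarFactor ((volume : Measure (CN N)).map L) volume with hk
  have h := isAddLeftInvariant_eq_smul ((volume : Measure (CN N)).map L) (volume : Measure (Fin N → ℂ))
  have hk0 : k ≠ 0 := (addHaarScalarFactor_pos_of_isAddHaarMeasure _ _).ne'
  refine ⟨k * NNReal.pi ^ N, ?_, ?_, fun b c ρ => ?_⟩
  · simp [hk0, NNReal.pi_ne_zero]
  · exact ENNReal.mul_ne_top ENNReal.coe_ne_top (ENNReal.pow_ne_top ENNReal.coe_ne_top)
  have hset : {v : CN N | ∀ i, ‖b.repr v i - c i‖ < ρ i} =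
      b.repr ⁻¹' (L ⁻¹' (univ.pi fun i => Metric.ball (c i) (ρ i))) := by
    ext v
    simp [L, dist_eq_norm]
  have hm : MeasurableSet (univ.pi fun i => Metric.ball (c i) (ρ i)) :=
    MeasurableSet.univ_pi fun i => Metric.isOpen_ball.measurableSet
  rw [hset, (measurePreserving_repr b).measure_preimage
    (L.continuous.measurable hm).nullMeasurableSet, ← map_apply L.continuous.measurable hm, h,
    Measure.smul_apply, volume_pi_pi]
  simp only [Complex.volume_ball, Finset.prod_mul_distrib]
  simp only [← hk, ENNReal.smul_def, smul_eq_mul, Finset.prod_const, Finset.card_univ,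
    Fintype.card_fin]
  ring

theorem prod_ite_zero {N : ℕ} [NeZero N] {M : Type*} [CommMonoid M] (a b : M) :
    ∏ i : Fin N, (if i = 0 then a else b) = a * b ^ (N - 1) := by
  rw [← Finset.mul_prod_erase _ _ (Finset.mem_univ 0), if_pos rfl]
  congr 1
  rw [Finset.prod_congr rfl (g := fun _ => b) fun i hi => if_neg (Finset.ne_of_mem_erase hi)]
  simp

theorem norm_sq_eq_sum_repr {N : ℕ} (b : OrthonormalBasis (Fin N) ℂ (CN N)) (v : CN N) :
    ‖v‖ ^ 2 = ∑ i, ‖b.repr v i‖ ^ 2 := by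
  rw [← b.repr.norm_map, EuclideanSpace.norm_sq_eq]

/-- In a basis starting with `e`, the first coordinate lies in a disc of radius `u`, and `|z_i|² < 1
- |z_0|² < 2u` bounds the others. So the volume is at most of order `u² · u^(N-1)`. -/
theorem exists_volume_box_le (N : ℕ) [NeZero N] : ∃ K : ℝ≥0∞, K ≠ ∞ ∧
    ∀ (e : CN N), ‖e‖ = 1 → ∀ u : ℝ, 0 < u →
      volume {z : CN N | ‖z‖ < 1 ∧ ‖1 - inner ℂ e z‖ < u} ≤ K * ENNReal.ofReal (u ^ (N + 1)) := by
  obtain ⟨K, hK0, hK, h⟩ := exists_volume_polydisc N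
  refine ⟨K * 2 ^ (N - 1), ENNReal.mul_ne_top hK (by finiteness), fun e he u hu => ?_⟩
  obtain ⟨b, hb⟩ := exists_onb he
  calc volume {z : CN N | ‖z‖ < 1 ∧ ‖1 - inner ℂ e z‖ < u}
      ≤ volume {v : CN N | ∀ i, ‖b.repr v i - (if i = 0 then 1 else 0)‖ <
          if i = 0 then u else √(2 * u)} := by
        refine measure_mono ?_
        rintro z ⟨hz, hzu⟩ i
        rw [← hb, ← b.repr_apply_apply] at hzu
        split_ifs with hi
        · rw [hi, norm_sub_rev]
          exact hzu
        · rw [sub_zero]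
          refine Real.lt_sqrt_of_sq_lt ?_
          have h1 := norm_sq_eq_sum_repr b z
          have h2 : ‖b.repr z 0‖ ^ 2 + ‖b.repr z i‖ ^ 2 ≤ ∑ i, ‖b.repr z i‖ ^ 2 :=
            Finset.add_le_sum (f := fun i => ‖b.repr z i‖ ^ 2) (fun _ _ => sq_nonneg _)
              (Finset.mem_univ _) (Finset.mem_univ _) (Ne.symm hi)
          have h3 : 1 - ‖b.repr z 0‖ ≤ ‖1 - b.repr z 0‖ := by
            simpa using norm_sub_norm_le (1 : ℂ) (b.repr z 0)
          nlinarith [norm_nonneg z, sq_nonneg (1 - ‖b.repr z 0‖)]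
    _ = K * (ENNReal.ofReal u ^ 2 * ENNReal.ofReal (2 * u) ^ (N - 1)) := by
        rw [h, ← prod_ite_zero]
        congr 1
        refine Finset.prod_congr rfl fun i _ => ?_
        split_ifs
        · rfl
        · rw [← ENNReal.ofReal_pow (Real.sqrt_nonneg _), Real.sq_sqrt (by positivity)]
    _ = K * 2 ^ (N - 1) * ENNReal.ofReal (u ^ (N + 1)) := by
        obtain ⟨n, rfl⟩ : ∃ n, N = n + 1 := Nat.exists_eq_succ_of_ne_zero (NeZero.ne N)
        rw [ENNReal.ofReal_mul (by norm_num), ENNReal.ofReal_pow hu.le]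
        simp only [ENNReal.ofReal_ofNat, add_tsub_cancel_right]
        ring

theorem lintegral_polar {N : ℕ} [NeZero N] {G : CN N → ℝ≥0∞} (hG : Measurable G) :
    ∫⁻ z, G z = ∫⁻ r in Ioi (0 : ℝ), ENNReal.ofReal (r ^ (2 * N - 1)) *
      ∫⁻ ζ : Sph N, G (r • (ζ : CN N)) ∂(volume : Measure (CN N)).toSphere := by
  have hmp := (volume : Measure (CN N)).measurePreserving_homeomorphUnitSphereProd
  have hmeas : Measurable fun p : Sph N × Ioi (0 : ℝ) => G ((p.2 : ℝ) • (p.1 : CN N)) :=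
    hG.comp (by fun_prop)
  calc ∫⁻ z, G z = ∫⁻ z in ({0}ᶜ : Set (CN N)), G z := by
        rw [restrict_compl_singleton]
    _ = ∫⁻ z : ({0}ᶜ : Set (CN N)), G z ∂(volume.comap Subtype.val) :=
        (lintegral_subtype_comap (measurableSet_singleton _).compl _).symm
    _ = ∫⁻ z : ({0}ᶜ : Set (CN N)), (fun p : Sph N × Ioi (0 : ℝ) => G ((p.2 : ℝ) • (p.1 : CN N)))
          (homeomorphUnitSphereProd (CN N) z) ∂(volume.comap Subtype.val) := by
        refine lintegral_congr fun z => ?_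
        simp only
        rw [← homeomorphUnitSphereProd_symm_apply_coe, Homeomorph.symm_apply_apply]
    _ = ∫⁻ p, G ((p.2 : ℝ) • (p.1 : CN N))
          ∂((volume : Measure (CN N)).toSphere.prod (volumeIoiPow (finrank ℝ (CN N) - 1))) :=
        hmp.lintegral_comp hmeas
    _ = _ := by
        rw [lintegral_prod_symm _ hmeas.aemeasurable, finrank_CN, volumeIoiPow,
          lintegral_withDensity_eq_lintegral_mul _ (by fun_prop)
            (hmeas.lintegral_prod_left'),
          ← lintegral_subtype_comap measurableSet_Ioi]
        rfl

theorem norm_one_sub_inner_smul_le {N : ℕ} {e z : CN N} (he : ‖e‖ = 1) (hz : ‖z‖ ≤ 1) {r : ℝ}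
    (hr : r ≤ 1) : ‖1 - inner ℂ e (r • z)‖ ≤ ‖1 - inner ℂ e z‖ + (1 - r) ∧
      ‖1 - inner ℂ e z‖ ≤ ‖1 - inner ℂ e (r • z)‖ + (1 - r) := by
  have h : inner ℂ e (r • z) = (r : ℂ) * inner ℂ e z := by
    rw [← Complex.coe_smul, inner_smul_right]
  have h1 : ‖(1 - (r : ℂ)) * inner ℂ e z‖ ≤ 1 - r := by
    rw [norm_mul, ← Complex.ofReal_one, ← Complex.ofReal_sub, Complex.norm_real,
      Real.norm_of_nonneg (by linarith)]
    have := norm_inner_le_norm (𝕜 := ℂ) e z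
    rw [he, one_mul] at this
    have := this.trans hz
    nlinarith
  rw [h]
  constructor
  · calc ‖1 - r * inner ℂ e z‖ = ‖(1 - inner ℂ e z) + (1 - (r : ℂ)) * inner ℂ e z‖ := by ring_nf
      _ ≤ _ := (norm_add_le _ _).trans (by linarith)
  · calc ‖1 - inner ℂ e z‖ = ‖(1 - r * inner ℂ e z) - (1 - (r : ℂ)) * inner ℂ e z‖ := by ring_nf
      _ ≤ _ := (norm_sub_le _ _).trans (by linarith)

theorem norm_sph {N : ℕ} (ζ : Sph N) : ‖(ζ : CN N)‖ = 1 := norm_eq_of_mem_sphere ζ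

/-- Thickening the cap radially over `1 - u < r < 1` puts it into a box of width `2u` and volume
`O(u^(N+1))`; polar coordinates then allow division by the thickness `u`. -/
theorem exists_toSphere_cap_le (N : ℕ) [NeZero N] : ∃ K : ℝ≥0∞, K ≠ ∞ ∧
    ∀ (e : CN N), ‖e‖ = 1 → ∀ u : ℝ, 0 < u →
      (volume : Measure (CN N)).toSphere {ζ | ‖1 - inner ℂ e (ζ : CN N)‖ < u} ≤
        K * ENNReal.ofReal (u ^ N) := by
  obtain ⟨K, hK, h⟩ := exists_volume_box_le N
  set τ := (volume : Measure (CN N)).toSphere with hτ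
  refine ⟨τ univ * 2 ^ N + 2 ^ (2 * N - 1) * K * 2 ^ (N + 1), ?_, fun e he u hu => ?_⟩
  · have := measure_ne_top τ univ
    finiteness
  -- The radial density `r^(2N-1)` is bounded below only away from `0`; for `u ≥ 1/2` the total mass
  -- is already an adequate bound.
  rcases le_or_gt (1 / 2) u with hu2 | hu2
  · calc τ {ζ | ‖1 - inner ℂ e (ζ : CN N)‖ < u} ≤ τ univ * 1 := by
          rw [mul_one]; exact measure_mono (subset_univ _)
      _ ≤ τ univ * (2 ^ N * ENNReal.ofReal (u ^ N)) := by
          gcongr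
          rw [← ENNReal.ofReal_ofNat, ← ENNReal.ofReal_pow (by norm_num),
            ← ENNReal.ofReal_mul (by positivity), ← mul_pow]
          exact ENNReal.one_le_ofReal.2 (one_le_pow₀ (by linarith))
      _ ≤ _ := by
          rw [add_mul, mul_assoc]
          exact le_self_add
  · set A := {ζ : Sph N | ‖1 - inner ℂ e (ζ : CN N)‖ < u} with hA
    set B := {z : CN N | ‖z‖ < 1 ∧ ‖1 - inner ℂ e z‖ < 2 * u} with hB
    have hAm : MeasurableSet A := (isOpen_lt (by fun_prop) (by fun_prop)).measurableSet
    have hB1 : MeasurableSet {z : CN N | ‖z‖ < 1} := measurableSet_lt (by fun_prop) (by fun_prop)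
    have hB2 : MeasurableSet {z : CN N | ‖1 - inner ℂ e z‖ < 2 * u} :=
      measurableSet_lt (by fun_prop) (by fun_prop)
    have hBm : MeasurableSet B := hB1.inter hB2
    have key : ENNReal.ofReal u * (ENNReal.ofReal ((1 / 2) ^ (2 * N - 1)) * τ A) ≤
        ENNReal.ofReal u * (K * 2 ^ (N + 1) * ENNReal.ofReal (u ^ N)) := by
      calc ENNReal.ofReal u * (ENNReal.ofReal ((1 / 2) ^ (2 * N - 1)) * τ A)
          = ∫⁻ r in Ioo (1 - u) 1, ENNReal.ofReal ((1 / 2) ^ (2 * N - 1)) * τ A := by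
            rw [setLIntegral_const, Real.volume_Ioo, mul_comm]
            simp
        _ ≤ ∫⁻ r in Ioo (1 - u) 1, ENNReal.ofReal (r ^ (2 * N - 1)) *
              ∫⁻ ζ : Sph N, B.indicator 1 (r • (ζ : CN N)) ∂τ := by
            refine setLIntegral_mono' measurableSet_Ioo fun r hr => ?_
            have hr0 : 1 / 2 ≤ r := by linarith [hr.1]
            gcongr
            rw [← lintegral_indicator_one hAm]
            refine lintegral_mono fun ζ => ?_
            by_cases hζ : ζ ∈ A
            · have hmem : r • (ζ : CN N) ∈ B := by
                constructor
                · rw [norm_smul, norm_sph, Real.norm_of_nonneg (by linarith)]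
                  linarith [hr.2]
                · have := (norm_one_sub_inner_smul_le he (norm_sph ζ).le hr.2.le).1
                  have h2 : ‖1 - inner ℂ e (ζ : CN N)‖ < u := hζ
                  linarith [hr.1]
              rw [indicator_of_mem hζ, indicator_of_mem hmem]
              exact le_rfl
            · rw [indicator_of_notMem hζ]
              exact zero_le
        _ ≤ ∫⁻ r in Ioi (0 : ℝ), ENNReal.ofReal (r ^ (2 * N - 1)) *
              ∫⁻ ζ : Sph N, B.indicator 1 (r • (ζ : CN N)) ∂τ :=
            lintegral_mono_set fun r hr => by
              simp only [mem_Ioi]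
              linarith [hr.1]
        _ = volume B := by
            rw [← lintegral_polar (measurable_one.indicator hBm), lintegral_indicator_one hBm]
        _ ≤ K * ENNReal.ofReal ((2 * u) ^ (N + 1)) := h e he _ (by positivity)
        _ = _ := by
            rw [show (2 * u) ^ (N + 1) = u * (2 ^ (N + 1) * u ^ N) by ring,
              ENNReal.ofReal_mul hu.le, ENNReal.ofReal_mul (by positivity),
              ENNReal.ofReal_pow (p := 2) (by norm_num), ENNReal.ofReal_ofNat]
            ring
    rw [ENNReal.mul_le_mul_iff_right (by simpa using hu) (by finiteness)] at key
    calc τ A = 2 ^ (2 * N - 1) * (ENNReal.ofReal ((1 / 2) ^ (2 * N - 1)) * τ A) := by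
          have h2 : (2 : ℝ≥0∞) ^ (2 * N - 1) = ENNReal.ofReal (2 ^ (2 * N - 1)) := by
            rw [ENNReal.ofReal_pow (by norm_num), ENNReal.ofReal_ofNat]
          rw [← mul_assoc, h2, ← ENNReal.ofReal_mul (by positivity), ← mul_pow]
          norm_num
      _ ≤ 2 ^ (2 * N - 1) * (K * 2 ^ (N + 1) * ENNReal.ofReal (u ^ N)) := by gcongr
      _ ≤ _ := by
          rw [add_mul]
          refine le_add_left (le_of_eq (by ring))

theorem lintegral_Ioo_one_sub_rpow {s : ℝ} (hs : -1 < s) {u : ℝ} (hu : 0 < u) :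
    ∫⁻ r in Ioo (1 - u) 1, ENNReal.ofReal ((1 - r) ^ s) = ENNReal.ofReal (u ^ (s + 1) / (s + 1)) := by
  have hi : IntervalIntegrable (fun r : ℝ => (1 - r) ^ s) volume (1 - u) 1 := by
    have := (intervalIntegral.intervalIntegrable_rpow' (a := u) (b := 0) hs).comp_sub_left 1
    simpa using this
  rw [restrict_Ioo_eq_restrict_Ioc, ← ofReal_integral_eq_lintegral_ofReal
      ((intervalIntegrable_iff_integrableOn_Ioc_of_le (by linarith)).1 hi),
    ← intervalIntegral.integral_of_le (by linarith),
    intervalIntegral.integral_comp_sub_left fun r => r ^ s, integral_rpow (.inl hs)]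
  · simp [Real.zero_rpow (show s + 1 ≠ 0 by linarith)]
  · filter_upwards [ae_restrict_mem measurableSet_Ioc] with r hr
    exact Real.rpow_nonneg (by linarith [hr.2]) _

/-- Summation over the layers `2^n δ ≤ X < 2^(n+1) δ` gives a geometric series of ratio `2^(q-p) <
1`. The constant is fixed before the measure and `X`, which makes the kernel estimates uniform in
the pole. -/
theorem exists_lintegral_rpow_neg_le {q p : ℝ} (hp : 0 ≤ p) (hqp : q < p) :
    ∃ C : ℝ≥0∞, C ≠ ∞ ∧ ∀ {α : Type} [MeasurableSpace α] (μ : Measure α) (X : α → ℝ),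
      Measurable X → ∀ K : ℝ≥0∞, (∀ u : ℝ, 0 < u → μ {a | X a < u} ≤ K * ENNReal.ofReal (u ^ q)) →
      ∀ δ : ℝ, 0 < δ → (∀ a, δ ≤ X a) →
      ∫⁻ a, ENNReal.ofReal (X a ^ (-p)) ∂μ ≤ K * C * ENNReal.ofReal (δ ^ (q - p)) := by
  have hgeo : (2 : ℝ) ^ (q - p) < 1 := Real.rpow_lt_one_of_one_lt_of_neg (by norm_num) (by linarith)
  refine ⟨∑' n : ℕ, ENNReal.ofReal (2 ^ q * ((2 : ℝ) ^ (q - p)) ^ n), ?_,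
    fun μ X hX K hK δ hδ hδX => ?_⟩
  · exact ((summable_geometric_of_lt_one (by positivity) hgeo).mul_left _).tsum_ofReal_ne_top
  calc ∫⁻ a, ENNReal.ofReal (X a ^ (-p)) ∂μ
      ≤ ∫⁻ a, ∑' n : ℕ, ENNReal.ofReal ((2 ^ n * δ) ^ (-p)) *
          {a | X a < 2 ^ (n + 1) * δ}.indicator 1 a ∂μ := by
        refine lintegral_mono fun a => ?_
        obtain ⟨n, hn1, hn2⟩ := exists_nat_pow_near (x := X a / δ) (y := 2)
          ((one_le_div hδ).2 (hδX a)) (by norm_num)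
        rw [le_div_iff₀ hδ] at hn1
        rw [div_lt_iff₀ hδ] at hn2
        refine le_trans ?_ (ENNReal.le_tsum n)
        rw [indicator_of_mem (by exact hn2), Pi.one_apply, mul_one]
        exact ENNReal.ofReal_le_ofReal
          (Real.rpow_le_rpow_of_nonpos (by positivity) hn1 (by linarith))
    _ = ∑' n : ℕ, ENNReal.ofReal ((2 ^ n * δ) ^ (-p)) * μ {a | X a < 2 ^ (n + 1) * δ} := by
        have hm : ∀ n : ℕ, MeasurableSet {a | X a < 2 ^ (n + 1) * δ} := fun n =>
          measurableSet_lt hX measurable_const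
        rw [lintegral_tsum fun n =>
          ((measurable_one.indicator (hm n)).const_mul _).aemeasurable]
        refine tsum_congr fun n => ?_
        rw [lintegral_const_mul _ (measurable_one.indicator (hm n)), lintegral_indicator_one (hm n)]
    _ ≤ ∑' n : ℕ, K * ENNReal.ofReal (δ ^ (q - p)) *
          ENNReal.ofReal (2 ^ q * ((2 : ℝ) ^ (q - p)) ^ n) := by
        refine ENNReal.tsum_le_tsum fun n => ?_
        calc ENNReal.ofReal ((2 ^ n * δ) ^ (-p)) * μ {a | X a < 2 ^ (n + 1) * δ}
            ≤ ENNReal.ofReal ((2 ^ n * δ) ^ (-p)) *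
                (K * ENNReal.ofReal ((2 ^ (n + 1) * δ) ^ q)) := by
              gcongr
              exact hK _ (by positivity)
          _ = K * ENNReal.ofReal ((2 ^ n * δ) ^ (-p) * (2 ^ (n + 1) * δ) ^ q) := by
              rw [ENNReal.ofReal_mul (by positivity)]
              ring
          _ = _ := by
              rw [mul_assoc, ← ENNReal.ofReal_mul (by positivity)]
              congr 2
              have h2 : (0 : ℝ) < 2 ^ n := by positivity
              rw [pow_succ, mul_right_comm, Real.mul_rpow (x := 2 ^ n * δ) (by positivity) (by norm_num),
                ← mul_assoc, ← Real.rpow_add (by positivity), Real.mul_rpow h2.le hδ.le,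
                ← Real.rpow_natCast_mul (by norm_num), ← Real.rpow_mul_natCast (by norm_num)]
              ring_nf
    _ = _ := by
        rw [ENNReal.tsum_mul_left]
        ring

theorem norm_ball_lt {N : ℕ} (z : Ball N) : ‖(z : CN N)‖ < 1 := mem_ball_zero_iff.1 z.2

theorem lintegral_ballMeasure {N : ℕ} (G : CN N → ℝ≥0∞) :
    ∫⁻ z : Ball N, G z ∂(ballMeasure N) =
      ((volume : Measure (CN N)) (Metric.ball 0 1))⁻¹ * ∫⁻ z in Metric.ball 0 1, G z := by
  rw [ballMeasure, lintegral_smul_measure, lintegral_subtype_comap Metric.isOpen_ball.measurableSet,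
    smul_eq_mul]

theorem inv_volume_ball_ne_top (N : ℕ) : ((volume : Measure (CN N)) (Metric.ball 0 1))⁻¹ ≠ ∞ :=
  ENNReal.inv_ne_top.2 (Metric.measure_ball_pos _ _ one_pos).ne'

theorem inv_toSphere_univ_ne_top (N : ℕ) [NeZero N] :
    ((volume : Measure (CN N)).toSphere univ)⁻¹ ≠ ∞ := by
  refine ENNReal.inv_ne_top.2 ?_
  rw [ne_eq, measure_univ_eq_zero]
  exact toSphere_ne_zero _

/-- In polar coordinates the box meets only radii with `1 - r < u`, each in a cap of width at most
`2u`. The caps contribute `u^N` and the weight integrates to a multiple of `u^(s+1)`. -/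
theorem exists_lintegral_weight_box_le (N : ℕ) [NeZero N] {s : ℝ} (hs : -1 < s) :
    ∃ K : ℝ≥0∞, K ≠ ∞ ∧ ∀ (e : CN N), ‖e‖ = 1 → ∀ u : ℝ, 0 < u →
      ∫⁻ z in {z : CN N | ‖z‖ < 1 ∧ ‖1 - inner ℂ e z‖ < u}, ENNReal.ofReal ((1 - ‖z‖ ^ 2) ^ s) ≤
        K * ENNReal.ofReal (u ^ (N + s + 1)) := by
  obtain ⟨K, hK, h⟩ := exists_toSphere_cap_le N
  set τ := (volume : Measure (CN N)).toSphere with hτ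
  -- `M` bounds `(1 + r)^s` for `0 < r < 1`, whatever the sign of `s`.
  set M : ℝ := max 1 (2 ^ s) with hM
  have hM0 : 0 < M := by positivity
  refine ⟨ENNReal.ofReal (M / (s + 1)) * K * ENNReal.ofReal (2 ^ N), by finiteness,
    fun e he u hu => ?_⟩
  set A := {ζ : Sph N | ‖1 - inner ℂ e (ζ : CN N)‖ < 2 * u} with hA
  set B := {z : CN N | ‖z‖ < 1 ∧ ‖1 - inner ℂ e z‖ < u} with hB
  have hAm : MeasurableSet A := (isOpen_lt (by fun_prop) (by fun_prop)).measurableSet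
  have hB1 : MeasurableSet {z : CN N | ‖z‖ < 1} := measurableSet_lt (by fun_prop) (by fun_prop)
  have hB2 : MeasurableSet {z : CN N | ‖1 - inner ℂ e z‖ < u} :=
    measurableSet_lt (by fun_prop) (by fun_prop)
  have hBm : MeasurableSet B := hB1.inter hB2
  have hpt : ∀ r ∈ Ioi (0 : ℝ), ∀ ζ : Sph N,
      B.indicator (fun z => ENNReal.ofReal ((1 - ‖z‖ ^ 2) ^ s)) (r • (ζ : CN N)) ≤
        (Ioo (1 - u) 1).indicator (fun r => ENNReal.ofReal M * ENNReal.ofReal ((1 - r) ^ s)) r *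
          A.indicator 1 ζ := by
    intro r hr ζ
    have hr : 0 < r := hr
    by_cases hz : r • (ζ : CN N) ∈ B
    · have hn : ‖r • (ζ : CN N)‖ = r := by
        rw [norm_smul, norm_sph, Real.norm_of_nonneg hr.le, mul_one]
      have hr1 : r < 1 := hn ▸ hz.1
      have hz2 : ‖1 - inner ℂ e (r • (ζ : CN N))‖ < u := hz.2
      have h1 : 1 - r ≤ ‖1 - inner ℂ e (r • (ζ : CN N))‖ := by
        have h2 := norm_inner_le_norm (𝕜 := ℂ) e (r • (ζ : CN N))
        rw [he, hn, one_mul] at h2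
        have h3 := norm_sub_norm_le (1 : ℂ) (inner ℂ e (r • (ζ : CN N)))
        rw [norm_one] at h3
        linarith
      have hru : 1 - u < r := by linarith
      have hζ : ζ ∈ A := by
        have := (norm_one_sub_inner_smul_le he (norm_sph ζ).le hr1.le).2
        change ‖1 - inner ℂ e (ζ : CN N)‖ < 2 * u
        linarith
      rw [indicator_of_mem hz, indicator_of_mem (show r ∈ Ioo (1 - u) 1 from ⟨hru, hr1⟩),
        indicator_of_mem hζ, hn, Pi.one_apply, mul_one, ← ENNReal.ofReal_mul hM0.le]
      refine ENNReal.ofReal_le_ofReal ?_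
      rw [show 1 - r ^ 2 = (1 + r) * (1 - r) by ring, Real.mul_rpow (by linarith) (by linarith)]
      refine mul_le_mul_of_nonneg_right ?_ (Real.rpow_nonneg (by linarith) _)
      rcases le_or_gt 0 s with h0 | h0
      · exact (Real.rpow_le_rpow (by linarith) (by linarith) h0).trans (le_max_right _ _)
      · exact (Real.rpow_le_one_of_one_le_of_nonpos (by linarith) h0.le).trans (le_max_left _ _)
    · rw [indicator_of_notMem hz]
      exact zero_le
  calc ∫⁻ z in B, ENNReal.ofReal ((1 - ‖z‖ ^ 2) ^ s)
      = ∫⁻ r in Ioi (0 : ℝ), ENNReal.ofReal (r ^ (2 * N - 1)) *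
          ∫⁻ ζ : Sph N, B.indicator (fun z => ENNReal.ofReal ((1 - ‖z‖ ^ 2) ^ s))
            (r • (ζ : CN N)) ∂τ := by
        rw [← lintegral_indicator hBm, lintegral_polar ((by fun_prop : Measurable _).indicator hBm)]
    _ ≤ ∫⁻ r in Ioi (0 : ℝ), (Ioo (1 - u) 1).indicator
          (fun r => ENNReal.ofReal M * ENNReal.ofReal ((1 - r) ^ s)) r * τ A := by
        refine setLIntegral_mono' measurableSet_Ioi fun r hr => ?_
        calc _ ≤ ENNReal.ofReal (r ^ (2 * N - 1)) * ((Ioo (1 - u) 1).indicator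
                (fun r => ENNReal.ofReal M * ENNReal.ofReal ((1 - r) ^ s)) r * τ A) := by
              gcongr
              rw [← lintegral_indicator_one hAm, ← lintegral_const_mul _
                (measurable_one.indicator hAm)]
              exact lintegral_mono (hpt r hr)
          _ ≤ _ := by
              by_cases hr1 : r ∈ Ioo (1 - u) 1
              · refine mul_le_of_le_one_left zero_le ?_
                exact ENNReal.ofReal_le_one.2 (pow_le_one₀ (le_of_lt hr) hr1.2.le)
              · simp [indicator_of_notMem hr1]
    _ ≤ ∫⁻ r, (Ioo (1 - u) 1).indicator
          (fun r => ENNReal.ofReal M * ENNReal.ofReal ((1 - r) ^ s)) r * τ A :=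
        setLIntegral_le_lintegral _ _
    _ = ENNReal.ofReal M * ENNReal.ofReal (u ^ (s + 1) / (s + 1)) * τ A := by
        rw [lintegral_mul_const _ ((by fun_prop : Measurable _).indicator measurableSet_Ioo),
          lintegral_indicator measurableSet_Ioo, lintegral_const_mul _ (by fun_prop),
          lintegral_Ioo_one_sub_rpow hs hu]
    _ ≤ ENNReal.ofReal M * ENNReal.ofReal (u ^ (s + 1) / (s + 1)) *
          (K * ENNReal.ofReal ((2 * u) ^ N)) := by
        gcongr
        exact h e he _ (by positivity)
    _ = _ := by
        have hs1 : 0 < s + 1 := by linarith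
        calc _ = K * ENNReal.ofReal (M * (u ^ (s + 1) / (s + 1)) * (2 * u) ^ N) := by
              rw [ENNReal.ofReal_mul (by positivity), ENNReal.ofReal_mul (by positivity)]
              ring
          _ = K * ENNReal.ofReal (M / (s + 1) * 2 ^ N * u ^ (N + s + 1)) := by
              rw [add_assoc (N : ℝ), Real.rpow_add hu N, Real.rpow_natCast, mul_pow]
              ring_nf
          _ = _ := by
              rw [ENNReal.ofReal_mul (by positivity), ENNReal.ofReal_mul (by positivity)]
              ring

/-! ### Norms of powers of the Szegő kernel -/

theorem exists_unit_smul {N : ℕ} [NeZero N] (b : CN N) : ∃ e : CN N, ‖e‖ = 1 ∧ b = ‖b‖ • e := by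
  rcases eq_or_ne b 0 with rfl | hb
  · exact ⟨EuclideanSpace.single 0 1, by simp, by simp⟩
  · exact ⟨‖b‖⁻¹ • b, by rw [norm_smul, norm_inv, norm_norm, inv_mul_cancel₀ (norm_ne_zero_iff.2 hb)],
      by rw [smul_smul, mul_inv_cancel₀ (norm_ne_zero_iff.2 hb), one_smul]⟩

theorem one_sub_norm_le_norm_one_sub_inner {N : ℕ} (b : CN N) {z : CN N} (hz : ‖z‖ ≤ 1) :
    1 - ‖b‖ ≤ ‖1 - inner ℂ b z‖ := by
  have h2 := norm_inner_le_norm (𝕜 := ℂ) b z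
  have h3 := norm_sub_norm_le (1 : ℂ) (inner ℂ b z)
  rw [norm_one] at h3
  nlinarith [norm_nonneg b]

/-- Moving the pole from `r e` to the boundary changes the quantity by at most `1 - r`, which it
already dominates. Sublevel sets for an interior pole thus lie in boxes and caps centred on the
sphere. -/
theorem norm_one_sub_inner_le_two_mul {N : ℕ} {e z : CN N} (he : ‖e‖ = 1) (hz : ‖z‖ ≤ 1) {r : ℝ}
    (hr0 : 0 ≤ r) (hr : r ≤ 1) : ‖1 - inner ℂ e z‖ ≤ 2 * ‖1 - inner ℂ (r • e) z‖ := by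
  have h1 := (norm_one_sub_inner_smul_le he hz hr).2
  have h2 := one_sub_norm_le_norm_one_sub_inner (r • e) hz
  have h3 : inner ℂ e (r • z) = inner ℂ (r • e) z := by
    rw [← Complex.coe_smul, ← Complex.coe_smul, inner_smul_right, inner_smul_left, Complex.conj_ofReal]
  rw [norm_smul, he, mul_one, Real.norm_of_nonneg hr0] at h2
  rw [h3] at h1
  linarith

theorem enorm_inv_pow_sq (x : ℂ) (t : ℕ) :
    ‖x⁻¹ ^ t‖ₑ ^ 2 = ENNReal.ofReal (‖x‖ ^ (-(2 * t : ℝ))) := by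
  rw [← ofReal_norm, ← ENNReal.ofReal_pow (norm_nonneg _), norm_pow, norm_inv,
    Real.rpow_neg (norm_nonneg _), ← pow_mul, inv_pow, mul_comm t]
  congr 2
  exact_mod_cast (Real.rpow_natCast _ _).symm

/-- The powers of the Szegő type kernel `(1 - ⟨z, b⟩)⁻¹`. -/
noncomputable def kernelPow {N : ℕ} (t : ℕ) (b : Ball N) (z : Ball N) : ℂ :=
  (1 - inner ℂ (b : CN N) (z : CN N))⁻¹ ^ t

theorem one_sub_inner_ne_zero {N : ℕ} (b : Ball N) {z : CN N} (hz : ‖z‖ ≤ 1) :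
    1 - inner ℂ (b : CN N) z ≠ 0 := by
  have h1 := one_sub_norm_le_norm_one_sub_inner (b : CN N) hz
  have h2 := norm_ball_lt b
  exact norm_pos_iff.1 (by linarith)

theorem isHolo_kernelPow {N : ℕ} (t : ℕ) (b : Ball N) : IsHolo (kernelPow t b) := by
  refine ⟨fun z => (1 - inner ℂ (b : CN N) z)⁻¹ ^ t, ?_, fun _ => rfl⟩
  have h : Differentiable ℂ fun z : CN N => 1 - inner ℂ (b : CN N) z :=
    (innerSL ℂ (b : CN N)).differentiable.const_sub 1
  exact (h.differentiableOn.inv fun z hz =>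
    one_sub_inner_ne_zero b (mem_ball_zero_iff.1 hz).le).pow t

/-- Restricting the kernel to the sphere of radius `r` amounts to moving its pole to `r b`. Its
distance to the sphere is at least `1 - |b|`, so the layer estimate with `δ = 1 - |b|` serves all
`r` at once. -/
theorem exists_hardySq_kernelPow_le (N : ℕ) [NeZero N] {t : ℕ} (ht : (N : ℝ) < 2 * t) :
    ∃ C : ℝ≥0∞, C ≠ ∞ ∧ ∀ b : Ball N, hardySq (kernelPow t b) ≤
      C * ENNReal.ofReal ((1 - ‖(b : CN N)‖) ^ ((N : ℝ) - 2 * t)) := by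
  obtain ⟨K, hK, h⟩ := exists_toSphere_cap_le N
  obtain ⟨C, hC, hd⟩ := exists_lintegral_rpow_neg_le (q := N) (p := 2 * t) (by positivity) ht
  set τ := (volume : Measure (CN N)).toSphere with hτ
  have hτ' := inv_toSphere_univ_ne_top N
  refine ⟨(τ univ)⁻¹ * (K * 2 ^ N * C), by finiteness, fun b => iSup_le fun r => ?_⟩
  obtain ⟨e, he, hbe⟩ := exists_unit_smul (b : CN N)
  have hb := norm_ball_lt b
  have hinner : ∀ ζ : Sph N, inner ℂ (b : CN N) (dil r ζ : CN N) =
      inner ℂ ((r * ‖(b : CN N)‖) • e) (ζ : CN N) := by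
    intro ζ
    rw [mul_smul, ← hbe]
    simp only [dil]
    rw [← Complex.coe_smul, ← Complex.coe_smul, inner_smul_right, inner_smul_left, Complex.conj_ofReal]
  have hrb : (r : ℝ) * ‖(b : CN N)‖ ≤ ‖(b : CN N)‖ :=
    mul_le_of_le_one_left (norm_nonneg _) r.2.2.le
  have hrb0 : 0 ≤ (r : ℝ) * ‖(b : CN N)‖ := mul_nonneg r.2.1.le (norm_nonneg _)
  calc ∫⁻ ζ, ‖kernelPow t b (dil r ζ)‖ₑ ^ 2 ∂(sphereMeasure N)
      = (τ univ)⁻¹ * ∫⁻ ζ, ENNReal.ofReal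
          (‖1 - inner ℂ ((r * ‖(b : CN N)‖) • e) (ζ : CN N)‖ ^ (-(2 * t : ℝ))) ∂τ := by
        rw [sphereMeasure, lintegral_smul_measure, smul_eq_mul]
        congr 1
        refine lintegral_congr fun ζ => ?_
        rw [kernelPow, enorm_inv_pow_sq, hinner]
    _ ≤ (τ univ)⁻¹ * (K * 2 ^ N * C *
          ENNReal.ofReal ((1 - ‖(b : CN N)‖) ^ ((N : ℝ) - 2 * t))) := by
        gcongr
        refine hd τ (fun ζ => ‖1 - inner ℂ ((r * ‖(b : CN N)‖) • e) (ζ : CN N)‖) (by fun_prop) _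
          (fun u hu => ?_) _ (by linarith) (fun ζ => ?_)
        · calc _ ≤ τ {ζ | ‖1 - inner ℂ e (ζ : CN N)‖ < 2 * u} := by
                refine measure_mono fun ζ hζ => ?_
                have := norm_one_sub_inner_le_two_mul he (norm_sph ζ).le hrb0 (by linarith)
                simp only [mem_ofPred_eq] at hζ ⊢
                linarith
            _ ≤ K * ENNReal.ofReal ((2 * u) ^ N) := h e he _ (by positivity)
            _ = _ := by
                rw [mul_pow, ENNReal.ofReal_mul (by positivity), ENNReal.ofReal_pow (by norm_num),
                  Real.rpow_natCast, ENNReal.ofReal_ofNat, mul_assoc]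
        · have := one_sub_norm_le_norm_one_sub_inner ((r * ‖(b : CN N)‖) • e) (norm_sph ζ).le
          rw [norm_smul, he, mul_one, Real.norm_of_nonneg hrb0] at this
          linarith
    _ = _ := by ring

theorem exists_bergmanSq_kernelPow_le (N : ℕ) [NeZero N] {s : ℝ} (hs : -1 < s) {t : ℕ}
    (ht : (N : ℝ) + s + 1 < 2 * t) :
    ∃ C : ℝ≥0∞, C ≠ ∞ ∧ ∀ b : Ball N, bergmanSq s (kernelPow t b) ≤
      C * ENNReal.ofReal ((1 - ‖(b : CN N)‖) ^ ((N : ℝ) + s + 1 - 2 * t)) := by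
  obtain ⟨K, hK, h⟩ := exists_lintegral_weight_box_le N hs
  obtain ⟨C, hC, hd⟩ := exists_lintegral_rpow_neg_le (q := N + s + 1) (p := 2 * t)
    (by positivity) ht
  set V := ((volume : Measure (CN N)) (Metric.ball 0 1))⁻¹ with hV
  have hV' : V ≠ ∞ := inv_volume_ball_ne_top N
  set c : ℝ := Real.Gamma (N + s + 1) / (Real.Gamma (N + 1) * Real.Gamma (s + 1)) with hc
  set μ := (ballMeasure N).withDensity fun z => ENNReal.ofReal (weight N s z) with hμ
  refine ⟨V * (ENNReal.ofReal c * K) * ENNReal.ofReal (2 ^ (N + s + 1)) * C, by finiteness,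
    fun b => ?_⟩
  obtain ⟨e, he, hbe⟩ := exists_unit_smul (b : CN N)
  have hb := norm_ball_lt b
  calc bergmanSq s (kernelPow t b)
      = ∫⁻ z, ENNReal.ofReal (‖1 - inner ℂ (b : CN N) (z : CN N)‖ ^ (-(2 * t : ℝ))) ∂μ := by
        have hm := measurable_weight N s
        rw [bergmanSq, hμ, lintegral_withDensity_eq_lintegral_mul _ (by fun_prop) (by fun_prop)]
        refine lintegral_congr fun z => ?_
        rw [kernelPow, enorm_inv_pow_sq, mul_comm]
        rfl
    _ ≤ _ := by
        refine hd μ (fun z => ‖1 - inner ℂ (b : CN N) (z : CN N)‖) (by fun_prop) _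
          (fun u hu => ?_) _ (by linarith)
          (fun z => one_sub_norm_le_norm_one_sub_inner _ (norm_ball_lt z).le)
        set B := {z : CN N | ‖z‖ < 1 ∧ ‖1 - inner ℂ e z‖ < 2 * u} with hB
        have hB1 : MeasurableSet {z : CN N | ‖z‖ < 1} :=
          measurableSet_lt (by fun_prop) (by fun_prop)
        have hB2 : MeasurableSet {z : CN N | ‖1 - inner ℂ e z‖ < 2 * u} :=
          measurableSet_lt (by fun_prop) (by fun_prop)
        have hBm : MeasurableSet B := hB1.inter hB2
        have hsub : {z : Ball N | ‖1 - inner ℂ (b : CN N) (z : CN N)‖ < u} ⊆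
            Subtype.val ⁻¹' B := by
          intro z hz
          refine ⟨norm_ball_lt z, ?_⟩
          have := norm_one_sub_inner_le_two_mul he (norm_ball_lt z).le (norm_nonneg _) hb.le
          rw [← hbe] at this
          simp only [mem_ofPred_eq] at hz ⊢
          linarith
        calc _ ≤ μ (Subtype.val ⁻¹' B) := measure_mono hsub
          _ = ∫⁻ z : Ball N, B.indicator
                (fun z => ENNReal.ofReal (c * (1 - ‖z‖ ^ 2) ^ s)) (z : CN N) ∂(ballMeasure N) := by
              rw [hμ, withDensity_apply _ (measurable_subtype_coe hBm),
                ← lintegral_indicator (measurable_subtype_coe hBm)]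
              rfl
          _ = V * ∫⁻ z in B, ENNReal.ofReal (c * (1 - ‖z‖ ^ 2) ^ s) := by
              rw [lintegral_ballMeasure, lintegral_indicator hBm, restrict_restrict hBm,
                inter_eq_left.2 fun z hz => mem_ball_zero_iff.2 hz.1]
          _ = V * (ENNReal.ofReal c * ∫⁻ z in B, ENNReal.ofReal ((1 - ‖z‖ ^ 2) ^ s)) := by
              rw [← lintegral_const_mul (ENNReal.ofReal c) (by fun_prop)]
              congr 1
              refine lintegral_congr fun z => ENNReal.ofReal_mul ?_
              have h0 : (0 : ℝ) ≤ N := N.cast_nonneg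
              have h1 := Real.Gamma_pos_of_pos (show 0 < N + s + 1 by linarith)
              have h2 := Real.Gamma_pos_of_pos (show (0 : ℝ) < N + 1 by linarith)
              have h3 := Real.Gamma_pos_of_pos (show 0 < s + 1 by linarith)
              positivity
          _ ≤ V * (ENNReal.ofReal c * (K * ENNReal.ofReal ((2 * u) ^ (N + s + 1)))) := by
              gcongr
              exact h e he _ (by positivity)
          _ = _ := by
              rw [Real.mul_rpow (by norm_num) hu.le, ENNReal.ofReal_mul (by positivity)]
              ring

/-! ### Bounds for point evaluations -/

/-- The mean value property on the unit circle for the holomorphic function `τ ↦ F(w + τ v)²`. -/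
theorem enorm_sq_le_lintegral_circle {N : ℕ} {F : CN N → ℂ}
    (hF : DifferentiableOn ℂ F (Metric.ball 0 1)) {w v : CN N}
    (hv : ∀ τ : ℂ, ‖τ‖ ≤ 1 → w + τ • v ∈ Metric.ball (0 : CN N) 1) :
    ENNReal.ofReal (2 * Real.pi) * ‖F w‖ₑ ^ 2 ≤
      ∫⁻ θ in Ioc 0 (2 * Real.pi), ‖F (w + circleMap 0 1 θ • v)‖ₑ ^ 2 := by
  have hd : DiffContOnCl ℂ (fun τ : ℂ => F (w + τ • v) ^ 2) (Metric.ball 0 |1|) := by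
    rw [abs_one]
    refine DifferentiableOn.diffContOnCl ?_
    rw [closure_ball _ one_ne_zero]
    refine DifferentiableOn.pow (DifferentiableOn.comp hF (by fun_prop) fun τ hτ => hv τ ?_) 2
    simpa using hτ
  have h := hd.circleAverage
  simp only [zero_smul, add_zero] at h
  have hpi : 0 < 2 * Real.pi := Real.two_pi_pos
  rw [Real.circleAverage_def, inv_smul_eq_iff₀ hpi.ne',
    intervalIntegral.integral_of_le hpi.le] at h
  calc ENNReal.ofReal (2 * Real.pi) * ‖F w‖ₑ ^ 2 = ‖(2 * Real.pi) • F w ^ 2‖ₑ := by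
        rw [enorm_smul, enorm_pow, Real.enorm_of_nonneg hpi.le]
    _ ≤ _ := by
        rw [← h]
        refine (enorm_integral_le_lintegral_enorm _).trans (le_of_eq ?_)
        simp only [enorm_pow]

/-- The circle inequality is integrated over `v ∈ P`. A balanced `P` is invariant under `v ↦ e^{iθ}
v`, which preserves volume, so after Tonelli every angle contributes the same integral. -/
theorem enorm_sq_mul_volume_le {N : ℕ} {F : CN N → ℂ}
    (hF : DifferentiableOn ℂ F (Metric.ball 0 1)) (hFm : Measurable F) {w : CN N} {P : Set (CN N)}
    (hP : MeasurableSet P) (hbal : ∀ v ∈ P, ∀ τ : ℂ, ‖τ‖ ≤ 1 → τ • v ∈ P)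
    (hsub : ∀ v ∈ P, w + v ∈ Metric.ball (0 : CN N) 1) :
    ‖F w‖ₑ ^ 2 * volume P ≤ ∫⁻ v in P, ‖F (w + v)‖ₑ ^ 2 := by
  have hpi : 0 < 2 * Real.pi := Real.two_pi_pos
  have hc : ∀ θ : ℝ, ‖circleMap 0 1 θ‖ = 1 := fun θ => by simp
  have hrot : ∀ θ : ℝ, ∫⁻ v in P, ‖F (w + circleMap 0 1 θ • v)‖ₑ ^ 2 =
      ∫⁻ v in P, ‖F (w + v)‖ₑ ^ 2 := by
    intro θ
    have hpre : (fun v : CN N => circleMap 0 1 θ • v) ⁻¹' P = P := by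
      ext v
      refine ⟨fun h => ?_, fun h => hbal v h _ (hc θ).le⟩
      have h1 := hbal _ h (circleMap 0 1 θ)⁻¹ (by rw [norm_inv, hc, inv_one])
      rwa [smul_smul, inv_mul_cancel₀ (norm_pos_iff.1 (by rw [hc]; exact one_pos)), one_smul] at h1
    have h1 := (measurePreserving_unit_smul (N := N) (hc θ)).setLIntegral_comp_preimage hP
      (f := fun v => ‖F (w + v)‖ₑ ^ 2) (by fun_prop)
    rwa [hpre] at h1
  have key : ENNReal.ofReal (2 * Real.pi) * (‖F w‖ₑ ^ 2 * volume P) ≤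
      ENNReal.ofReal (2 * Real.pi) * ∫⁻ v in P, ‖F (w + v)‖ₑ ^ 2 := by
    calc ENNReal.ofReal (2 * Real.pi) * (‖F w‖ₑ ^ 2 * volume P)
        = ∫⁻ v in P, ENNReal.ofReal (2 * Real.pi) * ‖F w‖ₑ ^ 2 := by
          rw [setLIntegral_const, mul_assoc]
      _ ≤ ∫⁻ v in P, ∫⁻ θ in Ioc 0 (2 * Real.pi), ‖F (w + circleMap 0 1 θ • v)‖ₑ ^ 2 :=
          setLIntegral_mono' hP fun v hv =>
            enorm_sq_le_lintegral_circle hF fun τ hτ => hsub _ (hbal v hv τ hτ)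
      _ = ∫⁻ θ in Ioc 0 (2 * Real.pi), ∫⁻ v in P, ‖F (w + circleMap 0 1 θ • v)‖ₑ ^ 2 := by
          refine lintegral_lintegral_swap (Measurable.aemeasurable ?_)
          have : Measurable fun p : CN N × ℝ => w + circleMap 0 1 p.2 • p.1 := by
            have := (continuous_circleMap 0 1)
            fun_prop
          exact (hFm.comp this).enorm.pow_const 2
      _ = _ := by
          simp only [hrot]
          rw [setLIntegral_const, Real.volume_Ioc, sub_zero, mul_comm]
  rwa [ENNReal.mul_le_mul_iff_right (by simpa using Real.pi_pos) (by finiteness)] at key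

/-- Around `w` fits a polydisc of radius about `δ` in the direction of `w` and about `√δ` in the
orthogonal ones. Its volume is comparable to `δ^(N+1)`, and on it the distance to the sphere stays
comparable to `δ`. -/
theorem exists_enorm_sq_mul_le_lintegral (N : ℕ) [NeZero N] : ∃ K : ℝ≥0∞, K ≠ 0 ∧ K ≠ ∞ ∧
    ∀ F : CN N → ℂ, DifferentiableOn ℂ F (Metric.ball 0 1) → Measurable F →
      ∀ w : CN N, ∀ δ : ℝ, 0 < δ → ‖w‖ = 1 - δ →
        ‖F w‖ₑ ^ 2 * (K * ENNReal.ofReal (δ ^ (N + 1))) ≤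
          ∫⁻ z in {z | δ / 2 ≤ 1 - ‖z‖ ^ 2 ∧ 1 - ‖z‖ ≤ 2 * δ}, ‖F z‖ₑ ^ 2 := by
  obtain ⟨K, hK0, hK, h⟩ := exists_volume_polydisc N
  have hN : (0 : ℝ) < N := by exact_mod_cast (NeZero.pos N)
  set k : ℝ := (1 / 4) ^ 2 * (1 / (16 * N)) ^ (N - 1) with hk
  have hk0 : 0 < k := by positivity
  refine ⟨K * ENNReal.ofReal k, mul_ne_zero hK0 (by simpa using hk0), by finiteness,
    fun F hF hFm w δ hδ hw => ?_⟩
  obtain ⟨e, he, hwe⟩ := exists_unit_smul w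
  obtain ⟨b, hb⟩ := exists_onb he
  have hδ1 : δ ≤ 1 := by linarith [norm_nonneg w]
  -- With these radii the squared norm on the polydisc is at most `(1 - 3δ/4)² + δ/16 ≤ 1 - δ/2`.
  set ρ : Fin N → ℝ := fun i => if i = 0 then δ / 4 else √(δ / (16 * N)) with hρ
  set P := {v : CN N | ∀ i, ‖b.repr v i - 0‖ < ρ i} with hP
  have hPm : MeasurableSet P := by
    rw [hP]
    simp only [ofPred_forall]
    refine MeasurableSet.iInter fun i => measurableSet_lt ?_ measurable_const
    have : Continuous fun v : CN N => ‖b.repr v i - 0‖ := by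
      have := b.repr.continuous
      fun_prop
    exact this.measurable
  have hwr : ∀ i, b.repr w i = if i = 0 then (‖w‖ : ℂ) else 0 := by
    intro i
    rw [hwe, ← Complex.coe_smul, map_smul, ← hb, b.repr_self]
    by_cases hi : i = 0 <;> simp [hi, hb, ← hwe]
  have hvol : volume P = K * ENNReal.ofReal k * ENNReal.ofReal (δ ^ (N + 1)) := by
    rw [hP, h, mul_assoc]
    congr 1
    rw [Finset.prod_congr rfl (g := fun i => if i = 0 then ENNReal.ofReal ((δ / 4) ^ 2) else
      ENNReal.ofReal (δ / (16 * N))) fun i _ => by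
        simp only [hρ]
        split_ifs
        · rw [ENNReal.ofReal_pow (by positivity)]
        · rw [← ENNReal.ofReal_pow (Real.sqrt_nonneg _), Real.sq_sqrt (by positivity)],
      prod_ite_zero, ← ENNReal.ofReal_pow (by positivity), ← ENNReal.ofReal_mul (by positivity),
      ← ENNReal.ofReal_mul (by positivity)]
    congr 1
    obtain ⟨n, rfl⟩ : ∃ n, N = n + 1 := Nat.exists_eq_succ_of_ne_zero (NeZero.ne N)
    rw [hk, add_tsub_cancel_right, div_eq_mul_one_div δ (16 * _), mul_pow]
    ring
  have hgeom : ∀ v ∈ P, δ / 2 ≤ 1 - ‖w + v‖ ^ 2 ∧ 1 - ‖w + v‖ ≤ 2 * δ := by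
    intro v hv
    have h0 : ‖b.repr v 0‖ < δ / 4 := by simpa [hρ] using hv 0
    have hr : ∀ i, b.repr (w + v) i = b.repr w i + b.repr v i := fun i => by simp
    constructor
    · have hi : ∀ i, ‖b.repr (w + v) i‖ ^ 2 ≤
          (if i = 0 then (1 - 3 / 4 * δ) ^ 2 else 0) + δ / (16 * N) := by
        intro i
        rw [hr, hwr]
        split_ifs with hi
        · have h1 : ‖(‖w‖ : ℂ) + b.repr v i‖ ≤ 1 - 3 / 4 * δ := by
            refine (norm_add_le _ _).trans ?_
            rw [Complex.norm_real, norm_norm, hi, hw]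
            linarith
          have h2 : 0 ≤ δ / (16 * N) := by positivity
          have h3 := pow_le_pow_left₀ (norm_nonneg _) h1 2
          linarith
        · rw [zero_add, zero_add]
          have h1 : ‖b.repr v i‖ < √(δ / (16 * N)) := by simpa [hρ, hi] using hv i
          exact ((Real.lt_sqrt (norm_nonneg _)).1 h1).le
      have h1 := Finset.sum_le_sum (s := Finset.univ) fun i _ => hi i
      rw [← norm_sq_eq_sum_repr, Finset.sum_add_distrib, Finset.sum_ite_eq' ] at h1
      simp only [Finset.mem_univ, if_true, Finset.sum_const, Finset.card_univ, Fintype.card_fin,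
        nsmul_eq_mul] at h1
      have h2 : (N : ℝ) * (δ / (16 * N)) = δ / 16 := by field_simp
      rw [h2] at h1
      nlinarith
    · have h1 := norm_inner_le_norm (𝕜 := ℂ) e (w + v)
      rw [he, one_mul, ← hb, ← b.repr_apply_apply, hr, hwr, if_pos rfl] at h1
      have h2 := norm_sub_le_norm_add (‖w‖ : ℂ) (b.repr v 0)
      rw [Complex.norm_real, norm_norm, hw] at h2
      rw [hw] at h1
      linarith
  have hA : ∀ v ∈ P, w + v ∈ Metric.ball (0 : CN N) 1 := by
    intro v hv
    rw [mem_ball_zero_iff]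
    nlinarith [(hgeom v hv).1, norm_nonneg (w + v)]
  have hbal : ∀ v ∈ P, ∀ τ : ℂ, ‖τ‖ ≤ 1 → τ • v ∈ P := by
    intro v hv τ hτ i
    refine lt_of_le_of_lt ?_ (hv i)
    rw [map_smul, PiLp.smul_apply, sub_zero, sub_zero, norm_smul]
    exact mul_le_of_le_one_left (norm_nonneg _) hτ
  rw [← hvol]
  refine (enorm_sq_mul_volume_le hF hFm hPm hbal hA).trans ?_
  have hmp := measurePreserving_add_left (volume : Measure (CN N)) w
  rw [hmp.setLIntegral_comp_emb (measurableEmbedding_addLeft w) (fun z => ‖F z‖ₑ ^ 2)]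
  refine lintegral_mono_set ?_
  rintro _ ⟨v, hv, rfl⟩
  exact hgeom v hv

theorem exists_measurable_extension {N : ℕ} {g : Ball N → ℂ} (hg : IsHolo g) :
    ∃ F : CN N → ℂ, DifferentiableOn ℂ F (Metric.ball 0 1) ∧ Measurable F ∧
      ∀ z : Ball N, F z = g z := by
  classical
  obtain ⟨F, hF, hFg⟩ := hg
  refine ⟨(Metric.ball 0 1).indicator F, hF.congr fun z hz => indicator_of_mem hz _, ?_,
    fun z => by rw [indicator_of_mem z.2, hFg]⟩
  rw [← piecewise_eq_indicator]
  exact hF.continuousOn.measurable_piecewise continuousOn_const Metric.isOpen_ball.measurableSet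

theorem exists_enorm_sq_mul_le_bergmanSq (N : ℕ) [NeZero N] {s : ℝ} (hs : -1 < s) :
    ∃ C : ℝ≥0∞, C ≠ ∞ ∧ ∀ g : Ball N → ℂ, IsHolo g → ∀ w : Ball N,
      ‖g w‖ₑ ^ 2 * ENNReal.ofReal ((1 - ‖(w : CN N)‖) ^ (N + s + 1)) ≤ C * bergmanSq s g := by
  obtain ⟨K, hK0, hK, h⟩ := exists_enorm_sq_mul_le_lintegral N
  set V := ((volume : Measure (CN N)) (Metric.ball 0 1))⁻¹ with hV
  have hV0 : V ≠ 0 := ENNReal.inv_ne_zero.2 measure_ball_lt_top.ne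
  have hV' : V ≠ ∞ := inv_volume_ball_ne_top N
  set c : ℝ := Real.Gamma (N + s + 1) / (Real.Gamma (N + 1) * Real.Gamma (s + 1)) with hc
  have hc0 : 0 < c := by
    have h0 : (0 : ℝ) ≤ N := N.cast_nonneg
    have h1 := Real.Gamma_pos_of_pos (show 0 < N + s + 1 by linarith)
    have h2 := Real.Gamma_pos_of_pos (show (0 : ℝ) < N + 1 by linarith)
    have h3 := Real.Gamma_pos_of_pos (show 0 < s + 1 by linarith)
    positivity
  -- On the shell `δ/2 ≤ 1 - |z|² ≤ 4δ`; the lower end controls the weight from below when `s ≥ 0`,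
  -- the upper end when `s < 0`.
  set m : ℝ := min ((1 / 2) ^ s) (4 ^ s) with hm
  have hm0 : 0 < m := by positivity
  have hk0 : K * (V * ENNReal.ofReal (c * m)) ≠ 0 := by
    refine mul_ne_zero hK0 (mul_ne_zero hV0 ?_)
    simpa using mul_pos hc0 hm0
  have hk : K * (V * ENNReal.ofReal (c * m)) ≠ ∞ := by finiteness
  refine ⟨(K * (V * ENNReal.ofReal (c * m)))⁻¹, ENNReal.inv_ne_top.2 hk0, fun g hg w => ?_⟩
  obtain ⟨F, hF, hFm, hFg⟩ := exists_measurable_extension hg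
  have hδ : 0 < 1 - ‖(w : CN N)‖ := by linarith [norm_ball_lt w]
  set δ := 1 - ‖(w : CN N)‖ with hδw
  set A := {z : CN N | δ / 2 ≤ 1 - ‖z‖ ^ 2 ∧ 1 - ‖z‖ ≤ 2 * δ} with hA
  have hAm : MeasurableSet A := by
    have h1 : MeasurableSet {z : CN N | δ / 2 ≤ 1 - ‖z‖ ^ 2} :=
      measurableSet_le (by fun_prop) (by fun_prop)
    have h2 : MeasurableSet {z : CN N | 1 - ‖z‖ ≤ 2 * δ} :=
      measurableSet_le (by fun_prop) (by fun_prop)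
    exact h1.inter h2
  have hAball : A ⊆ Metric.ball 0 1 := fun z hz => by
    rw [mem_ball_zero_iff]
    nlinarith [hz.1, norm_nonneg z]
  have hw := h F hF hFm w δ hδ (by linarith)
  have hpt : ∀ z ∈ A, ENNReal.ofReal (c * m * δ ^ s) ≤
      ENNReal.ofReal (c * (1 - ‖z‖ ^ 2) ^ s) := by
    intro z hz
    refine ENNReal.ofReal_le_ofReal ?_
    rw [mul_assoc]
    refine mul_le_mul_of_nonneg_left ?_ hc0.le
    have h1 : 1 - ‖z‖ ^ 2 ≤ 4 * δ := by nlinarith [hz.2, hz.1, norm_nonneg z]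
    have h2 := hz.1
    rcases le_or_gt 0 s with hs0 | hs0
    · calc m * δ ^ s ≤ (1 / 2) ^ s * δ ^ s := by gcongr; exact min_le_left _ _
        _ = (1 / 2 * δ) ^ s := (Real.mul_rpow (by norm_num) hδ.le).symm
        _ ≤ _ := Real.rpow_le_rpow (by positivity) (by linarith) hs0
    · calc m * δ ^ s ≤ 4 ^ s * δ ^ s := by gcongr; exact min_le_right _ _
        _ = (4 * δ) ^ s := (Real.mul_rpow (by norm_num) hδ.le).symm
        _ ≤ _ := Real.rpow_le_rpow_of_nonpos (by linarith) h1 hs0.le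
  have hfin : ‖g w‖ₑ ^ 2 * ENNReal.ofReal (δ ^ (N + s + 1)) * (K * (V * ENNReal.ofReal (c * m))) ≤
      bergmanSq s g := by
    calc _ = V * (‖F w‖ₑ ^ 2 * (K * ENNReal.ofReal (δ ^ (N + 1))) *
            ENNReal.ofReal (c * m * δ ^ s)) := by
          rw [show (N : ℝ) + s + 1 = (N + 1 : ℕ) + s by push_cast; ring, Real.rpow_add hδ,
            Real.rpow_natCast, ENNReal.ofReal_mul (by positivity),
            ENNReal.ofReal_mul (p := c * m) (by positivity), hFg]
          ring
      _ ≤ V * ((∫⁻ z in A, ‖F z‖ₑ ^ 2) * ENNReal.ofReal (c * m * δ ^ s)) := by gcongr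
      _ ≤ V * ∫⁻ z in A, ‖F z‖ₑ ^ 2 * ENNReal.ofReal (c * (1 - ‖z‖ ^ 2) ^ s) := by
          gcongr
          rw [← lintegral_mul_const _ (by fun_prop)]
          exact setLIntegral_mono' hAm fun z hz => mul_le_mul_right (hpt z hz) _
      _ ≤ V * ∫⁻ z in Metric.ball 0 1, ‖F z‖ₑ ^ 2 * ENNReal.ofReal (c * (1 - ‖z‖ ^ 2) ^ s) := by
          gcongr
      _ = bergmanSq s g := by
          rw [← lintegral_ballMeasure, bergmanSq]
          refine lintegral_congr fun z => ?_
          rw [hFg]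
          rfl
  rw [← ENNReal.div_eq_inv_mul, ENNReal.le_div_iff_mul_le (.inl hk0) (.inl hk)]
  exact hfin

/-- In polar coordinates every spherical mean over the shell is at most the Hardy norm, and the
radii fill an interval of length `2δ`. This factor `δ` lowers the exponent from `N + 1` to `N`. -/
theorem exists_enorm_sq_mul_le_hardySq (N : ℕ) [NeZero N] :
    ∃ C : ℝ≥0∞, C ≠ ∞ ∧ ∀ g : Ball N → ℂ, IsHolo g → ∀ w : Ball N,
      ‖g w‖ₑ ^ 2 * ENNReal.ofReal ((1 - ‖(w : CN N)‖) ^ N) ≤ C * hardySq g := by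
  obtain ⟨K, hK0, hK, h⟩ := exists_enorm_sq_mul_le_lintegral N
  set τ := (volume : Measure (CN N)).toSphere with hτ
  have hτ1 : τ univ ≠ ∞ := measure_ne_top _ _
  have hτ0 : τ univ ≠ 0 := by
    rw [ne_eq, measure_univ_eq_zero]
    exact toSphere_ne_zero _
  refine ⟨K⁻¹ * (2 * τ univ), by finiteness, fun g hg w => ?_⟩
  obtain ⟨F, hF, hFm, hFg⟩ := exists_measurable_extension hg
  have hδ : 0 < 1 - ‖(w : CN N)‖ := by linarith [norm_ball_lt w]
  set δ := 1 - ‖(w : CN N)‖ with hδw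
  set A := {z : CN N | δ / 2 ≤ 1 - ‖z‖ ^ 2 ∧ 1 - ‖z‖ ≤ 2 * δ} with hA
  have hAm : MeasurableSet A := by
    have h1 : MeasurableSet {z : CN N | δ / 2 ≤ 1 - ‖z‖ ^ 2} :=
      measurableSet_le (by fun_prop) (by fun_prop)
    have h2 : MeasurableSet {z : CN N | 1 - ‖z‖ ≤ 2 * δ} :=
      measurableSet_le (by fun_prop) (by fun_prop)
    exact h1.inter h2
  have hw := h F hF hFm w δ hδ (by linarith)
  have hrad : ∀ r ∈ Ioi (0 : ℝ), ENNReal.ofReal (r ^ (2 * N - 1)) *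
      ∫⁻ ζ : Sph N, A.indicator (fun z => ‖F z‖ₑ ^ 2) (r • (ζ : CN N)) ∂τ ≤
        (Ico (1 - 2 * δ) 1).indicator (fun _ => τ univ * hardySq g) r := by
    intro r hr
    have hr : 0 < r := hr
    have hn : ∀ ζ : Sph N, ‖r • (ζ : CN N)‖ = r := fun ζ => by
      rw [norm_smul, norm_sph, Real.norm_of_nonneg hr.le, mul_one]
    by_cases hr1 : r ∈ Ico (1 - 2 * δ) 1
    · rw [indicator_of_mem hr1]
      calc _ ≤ 1 * ∫⁻ ζ : Sph N, ‖g (dil ⟨r, hr, hr1.2⟩ ζ)‖ₑ ^ 2 ∂τ := by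
            gcongr
            · exact ENNReal.ofReal_le_one.2 (pow_le_one₀ hr.le hr1.2.le)
            · refine (indicator_le_self' (fun _ _ => zero_le) _).trans (le_of_eq ?_)
              rw [← hFg]
              rfl
        _ = τ univ * ∫⁻ ζ : Sph N, ‖g (dil ⟨r, hr, hr1.2⟩ ζ)‖ₑ ^ 2 ∂(sphereMeasure N) := by
            rw [sphereMeasure, lintegral_smul_measure, smul_eq_mul, ← mul_assoc,
              ENNReal.mul_inv_cancel hτ0 hτ1]
        _ ≤ _ := by
            gcongr
            exact le_iSup (fun r => ∫⁻ ζ : Sph N, ‖g (dil r ζ)‖ₑ ^ 2 ∂(sphereMeasure N))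
              (⟨r, hr, hr1.2⟩ : Ioo (0 : ℝ) 1)
    · have h0 : ∀ ζ : Sph N, A.indicator (fun z => ‖F z‖ₑ ^ 2) (r • (ζ : CN N)) = 0 := by
        intro ζ
        refine indicator_of_notMem (fun hz => hr1 ?_) _
        rw [hA, mem_ofPred_eq, hn] at hz
        constructor <;> nlinarith [hz.1, hz.2]
      simp [h0]
  have hfin : ‖g w‖ₑ ^ 2 * ENNReal.ofReal (δ ^ N) * K ≤ 2 * τ univ * hardySq g := by
    have hδ' : ENNReal.ofReal δ ≠ 0 := by simpa using hδ
    rw [← ENNReal.mul_le_mul_iff_right hδ' ENNReal.ofReal_ne_top]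
    calc _ = ‖F w‖ₑ ^ 2 * (K * ENNReal.ofReal (δ ^ (N + 1))) := by
          rw [pow_succ δ, ENNReal.ofReal_mul (by positivity), hFg]
          ring
      _ ≤ ∫⁻ z in A, ‖F z‖ₑ ^ 2 := hw
      _ = ∫⁻ r in Ioi (0 : ℝ), ENNReal.ofReal (r ^ (2 * N - 1)) *
            ∫⁻ ζ : Sph N, A.indicator (fun z => ‖F z‖ₑ ^ 2) (r • (ζ : CN N)) ∂τ := by
          rw [← lintegral_indicator hAm,
            lintegral_polar ((by fun_prop : Measurable _).indicator hAm)]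
      _ ≤ ∫⁻ r in Ioi (0 : ℝ), (Ico (1 - 2 * δ) 1).indicator (fun _ => τ univ * hardySq g) r :=
          setLIntegral_mono' measurableSet_Ioi hrad
      _ ≤ ∫⁻ r, (Ico (1 - 2 * δ) 1).indicator (fun _ => τ univ * hardySq g) r :=
          setLIntegral_le_lintegral _ _
      _ = _ := by
          rw [lintegral_indicator_const measurableSet_Ico, Real.volume_Ico,
            show 1 - (1 - 2 * δ) = 2 * δ by ring, ENNReal.ofReal_mul (by norm_num),
            ENNReal.ofReal_ofNat]
          ring
  rw [mul_assoc, ← ENNReal.div_eq_inv_mul, ENNReal.le_div_iff_mul_le (.inl hK0) (.inl hK)]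
  exact hfin

end Estimates

/-! ### Testing compactness on kernel powers -/

theorem exists_enorm_sq_mul_le_normSq (N : ℕ) [NeZero N] (s : Set.Ici (-1 : ℝ)) :
    ∃ C : ℝ≥0∞, C ≠ ∞ ∧ ∀ g : Ball N → ℂ, IsHolo g → ∀ w : Ball N,
      ‖g w‖ₑ ^ 2 * ENNReal.ofReal ((1 - ‖(w : CN N)‖) ^ ((N : ℝ) + s + 1)) ≤
        C * normSq (s : ℝ) g := by
  rcases (Set.mem_Ici.1 s.2).eq_or_lt with hs | hs
  · simpa [normSq, ← hs] using exists_enorm_sq_mul_le_hardySq N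
  · simpa only [normSq, if_neg hs.ne'] using exists_enorm_sq_mul_le_bergmanSq N hs

theorem exists_normSq_kernelPow_le (N : ℕ) [NeZero N] (s : Set.Ici (-1 : ℝ)) {t : ℕ}
    (ht : (N : ℝ) + s + 1 < 2 * t) :
    ∃ C : ℝ≥0∞, C ≠ ∞ ∧ ∀ b : Ball N, normSq (s : ℝ) (kernelPow t b) ≤
      C * ENNReal.ofReal ((1 - ‖(b : CN N)‖) ^ ((N : ℝ) + s + 1 - 2 * t)) := by
  rcases (Set.mem_Ici.1 s.2).eq_or_lt with hs | hs
  · have h := exists_hardySq_kernelPow_le N (t := t) (by linarith)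
    simpa [normSq, ← hs] using h
  · simpa only [normSq, if_neg hs.ne'] using exists_bergmanSq_kernelPow_le N hs ht

theorem exists_norm_mul_le_norm (N : ℕ) [NeZero N] (s : Set.Ici (-1 : ℝ)) :
    ∃ C : ℝ, ∀ (g : A2 N s) (w : Ball N),
      ‖g w‖ * (1 - ‖(w : CN N)‖) ^ (((N : ℝ) + s + 1) / 2) ≤ C * ‖g‖ := by
  obtain ⟨C, hC, h⟩ := exists_enorm_sq_mul_le_normSq N s
  refine ⟨√C.toReal, fun g w => ?_⟩
  have hw : 0 < 1 - ‖(w : CN N)‖ := by linarith [norm_ball_lt w]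
  rw [A2.norm_def, ← Real.sqrt_mul ENNReal.toReal_nonneg]
  refine Real.le_sqrt_of_sq_le ?_
  have h1 := ENNReal.toReal_mono (ENNReal.mul_ne_top hC g.2.2.ne) (h g g.2.1 w)
  rw [ENNReal.toReal_mul, ENNReal.toReal_mul, ENNReal.toReal_pow, toReal_enorm,
    ENNReal.toReal_ofReal (by positivity)] at h1
  rwa [mul_pow, ← Real.rpow_mul_natCast hw.le, Nat.cast_ofNat, div_mul_cancel₀ _ two_ne_zero]

theorem exists_kernelPow_mem (N : ℕ) [NeZero N] (s : Set.Ici (-1 : ℝ)) {t : ℕ}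
    (ht : (N : ℝ) + s + 1 < 2 * t) :
    ∃ C : ℝ, 0 ≤ C ∧ ∀ b : Ball N, ∃ k : A2 N s, (∀ z, k z = kernelPow t b z) ∧
      ‖k‖ ≤ C * (1 - ‖(b : CN N)‖) ^ (((N : ℝ) + s + 1) / 2 - t) := by
  obtain ⟨C, hC, h⟩ := exists_normSq_kernelPow_le N s ht
  refine ⟨√C.toReal, Real.sqrt_nonneg _, fun b => ?_⟩
  have hfin : C * ENNReal.ofReal ((1 - ‖(b : CN N)‖) ^ ((N : ℝ) + s + 1 - 2 * t)) ≠ ∞ := by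
    finiteness
  refine ⟨A2.mk (kernelPow t b) ⟨isHolo_kernelPow t b, (h b).trans_lt hfin.lt_top⟩, fun z => rfl, ?_⟩
  have hb : 0 < 1 - ‖(b : CN N)‖ := by linarith [norm_ball_lt b]
  rw [A2.norm_def]
  refine Real.sqrt_le_iff.2 ⟨by positivity, ?_⟩
  have h1 := ENNReal.toReal_mono hfin (h b)
  rw [ENNReal.toReal_mul, ENNReal.toReal_ofReal (by positivity)] at h1
  rw [mul_pow, Real.sq_sqrt ENNReal.toReal_nonneg, ← Real.rpow_mul_natCast hb.le, Nat.cast_ofNat]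
  rwa [sub_mul, div_mul_cancel₀ _ two_ne_zero, mul_comm (t : ℝ) 2]

theorem continuous_eval {N : ℕ} [NeZero N] {s : Set.Ici (-1 : ℝ)} (z : Ball N) :
    Continuous fun g : A2 N s => g z := by
  obtain ⟨C, hC⟩ := exists_norm_mul_le_norm N s
  have hz : 0 < (1 - ‖(z : CN N)‖) ^ (((N : ℝ) + s + 1) / 2) :=
    Real.rpow_pos_of_pos (by linarith [norm_ball_lt z]) _
  let L : A2 N s →ₗ[ℂ] ℂ :=
    { toFun := fun g => g z
      map_add' := fun _ _ => rfl
      map_smul' := fun _ _ => rfl }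
  exact (L.mkContinuous (C / (1 - ‖(z : CN N)‖) ^ (((N : ℝ) + s + 1) / 2)) fun g => by
    rw [div_mul_eq_mul_div, le_div_iff₀ hz]
    exact hC g z).continuous

theorem sum_compOp_apply {N m : ℕ} [NeZero N] (s : Set.Ici (-1 : ℝ))
    (φ : Fin m → Ball N → Ball N) (hb : ∀ j, IsCompBounded s (φ j)) (c : Fin m → ℂ)
    (g : A2 N s) (z : Ball N) :
    (∑ j, c j • compOp s (φ j) (hb j) : A2 N s →L[ℂ] A2 N s) g z = ∑ j, c j * g (φ j z) := by
  let L : A2 N s →ₗ[ℂ] ℂ :=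
    { toFun := fun g => g z
      map_add' := fun _ _ => rfl
      map_smul' := fun _ _ => rfl }
  change L _ = _
  rw [_root_.sum_apply, map_sum]
  rfl

/-- The rescaled kernel powers are bounded and their images tend to `0` pointwise, hence in norm by
compactness; evaluation at `w i` then gives the claim. The comparison of `w` with `b` is what keeps
the rescaled functions bounded. -/
theorem tendsto_sum_kernelPow_of_isCompactOperator {N m : ℕ} [NeZero N] {s : Set.Ici (-1 : ℝ)}
    {φ : Fin m → Ball N → Ball N} {hb : ∀ j, IsCompBounded s (φ j)} {c : Fin m → ℂ}
    (hK : IsCompactOperator ⇑(∑ j, c j • compOp s (φ j) (hb j) : A2 N s →L[ℂ] A2 N s))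
    {t : ℕ} (ht : (N : ℝ) + s + 1 < 2 * t) {ι : Type*} {l : Filter ι} {w b : ι → Ball N}
    (hw : Tendsto (fun i => 1 - ‖(w i : CN N)‖) l (𝓝 0)) {M : ℝ} (hM : 0 ≤ M)
    (hwb : ∀ᶠ i in l, 1 - ‖(w i : CN N)‖ ≤ M * (1 - ‖(b i : CN N)‖)) :
    Tendsto (fun i => ((1 - ‖(w i : CN N)‖ : ℝ) : ℂ) ^ t *
      ∑ j, c j * kernelPow t (b i) (φ j (w i))) l (𝓝 0) := by
  set T : A2 N s →L[ℂ] A2 N s := ∑ j, c j • compOp s (φ j) (hb j) with hT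
  set κ : ℝ := (N : ℝ) + s + 1 with hκ
  obtain ⟨C, hC0, hC⟩ := exists_kernelPow_mem N s ht
  choose k hk hkn using hC
  have hw0 : ∀ i, 0 < 1 - ‖(w i : CN N)‖ := fun i => by linarith [norm_ball_lt (w i)]
  have hb0 : ∀ i, 0 < 1 - ‖(b i : CN N)‖ := fun i => by linarith [norm_ball_lt (b i)]
  have hexp : 0 < t - κ / 2 := by linarith
  -- Scaled so that the factor `(1 - |w|)^(κ/2)` from point evaluation completes it to `(1 -
  -- |w|)^t`. The exponent is positive, so `a` tends to `0`.
  set a : ι → ℝ := fun i => (1 - ‖(w i : CN N)‖) ^ (t - κ / 2) with ha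
  have ha0 : ∀ i, 0 ≤ a i := fun i => Real.rpow_nonneg (hw0 i).le _
  have hat : Tendsto a l (𝓝 0) := by
    have := hw.rpow_const (p := t - κ / 2) (.inr hexp.le)
    rwa [Real.zero_rpow hexp.ne'] at this
  let g : ι → A2 N s := fun i => (a i : ℂ) • k (b i)
  have hTg : ∀ i z, T (g i) z = a i * ∑ j, c j * kernelPow t (b i) (φ j z) := by
    intro i z
    rw [hT, sum_compOp_apply, Finset.mul_sum]
    refine Finset.sum_congr rfl fun j _ => ?_
    rw [← hk, mul_left_comm]
    rfl
  have hg : ∀ᶠ i in l, g i ∈ Metric.closedBall (0 : A2 N s) (C * M ^ (t - κ / 2)) := by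
    filter_upwards [hwb] with i hi
    rw [mem_closedBall_zero_iff, norm_smul, Complex.norm_real, Real.norm_of_nonneg (ha0 i)]
    calc a i * ‖k (b i)‖
        ≤ (M * (1 - ‖(b i : CN N)‖)) ^ (t - κ / 2) * (C * (1 - ‖(b i : CN N)‖) ^ (κ / 2 - t)) :=
          mul_le_mul (Real.rpow_le_rpow (hw0 i).le hi hexp.le) (hkn _) (norm_nonneg _)
            (Real.rpow_nonneg (mul_nonneg hM (hb0 i).le) _)
      _ = C * M ^ (t - κ / 2) := by
          rw [Real.mul_rpow hM (hb0 i).le, show κ / 2 - t = -(t - κ / 2) by ring,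
            Real.rpow_neg (hb0 i).le]
          have h1 := mul_inv_cancel₀ (Real.rpow_pos_of_pos (hb0 i) (t - κ / 2)).ne'
          linear_combination C * M ^ (t - κ / 2) * h1
  obtain ⟨Q, hQ, hQT⟩ := IsCompactOperator.image_closedBall_subset_compact (f := T.toLinearMap) hK
    (C * M ^ (t - κ / 2))
  have hlim : Tendsto (fun i => T (g i)) l (𝓝 0) := by
    -- The images eventually lie in a compact set, so it is enough that `0` is the only possible
    -- cluster point; continuous point evaluations decide this.
    refine hQ.tendsto_nhds_of_unique_mapClusterPt ?_ fun y _ hy => ?_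
    · filter_upwards [hg] with i hi
      exact hQT ⟨g i, hi, rfl⟩
    · refine Subtype.ext (funext fun z => ?_)
      have h1 : MapClusterPt (y z) l (fun i => T (g i) z) :=
        hy.continuousAt_comp (continuous_eval z).continuousAt
      have h2 : Tendsto (fun i => T (g i) z) l (𝓝 0) := by
        -- At a fixed `z` the kernel sum is bounded independently of the pole `b i`, so the factor
        -- `a i` forces the limit `0`.
        have h3 : Tendsto (fun i => a i * ∑ j, ‖c j‖ * (1 - ‖(φ j z : CN N)‖)⁻¹ ^ t) l (𝓝 0) := by
          simpa using hat.mul_const (∑ j, ‖c j‖ * (1 - ‖(φ j z : CN N)‖)⁻¹ ^ t)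
        refine squeeze_zero_norm (fun i => ?_) h3
        rw [hTg, norm_mul, Complex.norm_real, Real.norm_of_nonneg (ha0 i)]
        refine mul_le_mul_of_nonneg_left ((norm_sum_le _ _).trans
          (Finset.sum_le_sum fun j _ => ?_)) (ha0 i)
        rw [norm_mul, kernelPow, norm_pow, norm_inv]
        have h4 : 0 < 1 - ‖(φ j z : CN N)‖ := by linarith [norm_ball_lt (φ j z)]
        have h5 : 1 - ‖(φ j z : CN N)‖ ≤ ‖1 - inner ℂ (b i : CN N) (φ j z : CN N)‖ := by
          have h6 := one_sub_norm_le_norm_one_sub_inner (φ j z : CN N) (norm_ball_lt (b i)).le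
          rwa [← inner_conj_symm, ← map_one (starRingEnd ℂ), ← map_sub, Complex.norm_conj] at h6
        gcongr
      exact eq_of_nhds_neBot (h1.clusterPt.neBot.mono (inf_le_inf_left _ h2))
  obtain ⟨C', hC'⟩ := exists_norm_mul_le_norm N s
  have hlim' : Tendsto (fun i => C' * ‖T (g i)‖) l (𝓝 0) := by
    simpa using (hlim.norm).const_mul C'
  refine squeeze_zero_norm (fun i => ?_) hlim'
  refine le_trans (le_of_eq ?_) (hC' (T (g i)) (w i))
  rw [hTg, norm_mul, norm_mul, norm_pow, Complex.norm_real, Complex.norm_real,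
    Real.norm_of_nonneg (hw0 i).le, Real.norm_of_nonneg (ha0 i), mul_right_comm]
  congr 1
  rw [← Real.rpow_add (hw0 i), sub_add_cancel, Real.rpow_natCast]

/-! ### Schwarz-Pick inequalities in the disc, the half plane and the ball -/

theorem norm_sq_one_sub_conj_mul (a z : ℂ) :
    ‖1 - starRingEnd ℂ a * z‖ ^ 2 = ‖z - a‖ ^ 2 + (1 - ‖a‖ ^ 2) * (1 - ‖z‖ ^ 2) := by
  simp only [← Complex.normSq_eq_norm_sq, Complex.normSq_apply, Complex.sub_re, Complex.sub_im,
    Complex.mul_re, Complex.mul_im, Complex.conj_re, Complex.conj_im, Complex.one_re,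
    Complex.one_im]
  ring

theorem one_sub_conj_mul_ne_zero {a z : ℂ} (ha : ‖a‖ < 1) (hz : ‖z‖ < 1) :
    1 - starRingEnd ℂ a * z ≠ 0 := by
  intro h
  have h1 := norm_sq_one_sub_conj_mul a z
  rw [h, norm_zero] at h1
  have h2 : 0 < 1 - ‖a‖ ^ 2 := by nlinarith [norm_nonneg a]
  have h3 : 0 < 1 - ‖z‖ ^ 2 := by nlinarith [norm_nonneg z]
  nlinarith [mul_pos h2 h3, sq_nonneg ‖z - a‖]

theorem norm_moebius_lt_one {a z : ℂ} (ha : ‖a‖ < 1) (hz : ‖z‖ < 1) :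
    ‖(z - a) / (1 - starRingEnd ℂ a * z)‖ < 1 := by
  rw [norm_div, div_lt_one (norm_pos_iff.2 (one_sub_conj_mul_ne_zero ha hz))]
  refine lt_of_pow_lt_pow_left₀ 2 (norm_nonneg _) ?_
  rw [norm_sq_one_sub_conj_mul]
  have h2 : 0 < 1 - ‖a‖ ^ 2 := by nlinarith [norm_nonneg a]
  have h3 : 0 < 1 - ‖z‖ ^ 2 := by nlinarith [norm_nonneg z]
  linarith [mul_pos h2 h3]

/-- The Schwarz-Pick inequality in the unit disc. -/
theorem schwarz_pick {g : ℂ → ℂ} (hg : DifferentiableOn ℂ g (Metric.ball 0 1))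
    (hg1 : ∀ z, ‖z‖ < 1 → ‖g z‖ < 1) {z w : ℂ} (hz : ‖z‖ < 1) (hw : ‖w‖ < 1) :
    ‖g z - g w‖ ^ 2 * ((1 - ‖z‖ ^ 2) * (1 - ‖w‖ ^ 2)) ≤
      ‖z - w‖ ^ 2 * ((1 - ‖g z‖ ^ 2) * (1 - ‖g w‖ ^ 2)) := by
  set ψ : ℂ → ℂ := fun τ => (τ - -w) / (1 - starRingEnd ℂ (-w) * τ) with hψ
  have hw' : ‖-w‖ < 1 := by rwa [norm_neg]
  have hψ1 : ∀ τ, ‖τ‖ < 1 → ‖ψ τ‖ < 1 := fun τ hτ => norm_moebius_lt_one hw' hτ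
  set h : ℂ → ℂ := fun τ => (g (ψ τ) - g w) / (1 - starRingEnd ℂ (g w) * g (ψ τ)) with hh
  have hψd : DifferentiableOn ℂ ψ (Metric.ball 0 1) :=
    DifferentiableOn.div (by fun_prop) (by fun_prop) fun τ hτ =>
      one_sub_conj_mul_ne_zero hw' (mem_ball_zero_iff.1 hτ)
  have hgψ : DifferentiableOn ℂ (fun τ => g (ψ τ)) (Metric.ball 0 1) :=
    hg.comp hψd fun τ hτ => mem_ball_zero_iff.2 (hψ1 τ (mem_ball_zero_iff.1 hτ))
  have hd : DifferentiableOn ℂ h (Metric.ball 0 1) :=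
    (hgψ.sub_const _).div (hgψ.const_mul _ |>.const_sub _) fun τ hτ =>
      one_sub_conj_mul_ne_zero (hg1 w hw) (hg1 _ (hψ1 τ (mem_ball_zero_iff.1 hτ)))
  have hmaps : Set.MapsTo h (Metric.ball 0 1) (Metric.closedBall 0 1) := fun τ hτ =>
    mem_closedBall_zero_iff.2
      (norm_moebius_lt_one (hg1 w hw) (hg1 _ (hψ1 τ (mem_ball_zero_iff.1 hτ)))).le
  have h0 : h 0 = 0 := by simp [hh, hψ]
  set τ := (z - w) / (1 - starRingEnd ℂ w * z) with hτ
  have hτ1 : ‖τ‖ < 1 := norm_moebius_lt_one hw hz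
  have hψτ : ψ τ = z := by
    have h1 : τ * (1 - starRingEnd ℂ w * z) = z - w :=
      div_mul_cancel₀ _ (one_sub_conj_mul_ne_zero hw hz)
    have h3 : 1 - starRingEnd ℂ (-w) * τ ≠ 0 := one_sub_conj_mul_ne_zero hw' hτ1
    simp only [hψ]
    rw [div_eq_iff h3, map_neg]
    linear_combination h1
  have key := Complex.norm_le_norm_of_mapsTo_ball hd hmaps h0 hτ1
  have hhτ : h τ = (g z - g w) / (1 - starRingEnd ℂ (g w) * g z) := by simp only [hh, hψτ]
  rw [hhτ, hτ, norm_div, norm_div] at key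
  have p1 := norm_pos_iff.2 (one_sub_conj_mul_ne_zero hw hz)
  have p2 := norm_pos_iff.2 (one_sub_conj_mul_ne_zero (hg1 w hw) (hg1 z hz))
  rw [div_le_div_iff₀ p2 p1] at key
  have key2 := pow_le_pow_left₀ (by positivity) key 2
  rw [mul_pow, mul_pow, norm_sq_one_sub_conj_mul, norm_sq_one_sub_conj_mul] at key2
  linarith

theorem re_cayley (z : ℂ) : ((1 + z) / (1 - z)).re = (1 - ‖z‖ ^ 2) / ‖1 - z‖ ^ 2 := by
  rw [Complex.div_re, ← add_div]
  simp only [← Complex.normSq_eq_norm_sq, Complex.normSq_apply, Complex.sub_re, Complex.sub_im,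
    Complex.add_re, Complex.add_im, Complex.one_re, Complex.one_im]
  ring_nf

theorem one_sub_norm_sq_inv_cayley {A : ℂ} (hA : A + 1 ≠ 0) :
    1 - ‖(A - 1) / (A + 1)‖ ^ 2 = 4 * A.re / ‖A + 1‖ ^ 2 := by
  have h := norm_pos_iff.2 hA
  rw [norm_div, div_pow, eq_div_iff (by positivity), sub_mul, div_mul_cancel₀ _ (by positivity)]
  simp only [← Complex.normSq_eq_norm_sq, Complex.normSq_apply, Complex.sub_re, Complex.sub_im,
    Complex.add_re, Complex.add_im, Complex.one_re, Complex.one_im]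
  ring

theorem add_one_ne_zero_of_re_pos {A : ℂ} (hA : 0 < A.re) : A + 1 ≠ 0 := by
  intro h
  have := congrArg Complex.re h
  simp at this
  linarith

/-- The Schwarz-Pick inequality for functions from the unit disc to the right half plane. -/
theorem schwarz_pick_halfPlane {H : ℂ → ℂ} (hH : DifferentiableOn ℂ H (Metric.ball 0 1))
    (hre : ∀ z, ‖z‖ < 1 → 0 ≤ (H z).re) {z w : ℂ} (hz : ‖z‖ < 1) (hw : ‖w‖ < 1) :
    ‖H z - H w‖ ^ 2 * ((1 - ‖z‖ ^ 2) * (1 - ‖w‖ ^ 2)) ≤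
      ‖z - w‖ ^ 2 * (4 * (H z).re * (H w).re) := by
  -- The shift by `ε` makes the real part strictly positive, so the Cayley transform lands in the
  -- open disc; afterwards `ε → 0`.
  have hε : ∀ ε : ℝ, 0 < ε → ‖H z - H w‖ ^ 2 * ((1 - ‖z‖ ^ 2) * (1 - ‖w‖ ^ 2)) ≤
      ‖z - w‖ ^ 2 * (4 * ((H z).re + ε) * ((H w).re + ε)) := by
    intro ε hε
    have hA : ∀ z, ‖z‖ < 1 → 0 < (H z + ε).re := fun z hz => by
      have := hre z hz
      simp only [Complex.add_re, Complex.ofReal_re]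
      linarith
    have hne : ∀ z, ‖z‖ < 1 → H z + ε + 1 ≠ 0 := fun z hz => add_one_ne_zero_of_re_pos (hA z hz)
    have h1 := schwarz_pick (g := fun z => (H z + ε - 1) / (H z + ε + 1))
      (DifferentiableOn.div ((hH.add_const _).sub_const _) ((hH.add_const _).add_const _)
        fun z hz => hne z (mem_ball_zero_iff.1 hz)) (fun z hz => by
          have h2 := one_sub_norm_sq_inv_cayley (hne z hz)
          have h3 : 0 < 4 * (H z + ε).re / ‖H z + ε + 1‖ ^ 2 :=
            div_pos (by linarith [hA z hz]) (pow_pos (norm_pos_iff.2 (hne z hz)) 2)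
          refine lt_of_pow_lt_pow_left₀ 2 zero_le_one ?_
          rw [one_pow]
          linarith) hz hw
    have nz := norm_pos_iff.2 (hne z hz)
    have nw := norm_pos_iff.2 (hne w hw)
    have hdiff : (H z + ε - 1) / (H z + ε + 1) - (H w + ε - 1) / (H w + ε + 1) =
        2 * (H z - H w) / ((H z + ε + 1) * (H w + ε + 1)) := by
      rw [div_sub_div _ _ (hne z hz) (hne w hw)]
      ring
    rw [one_sub_norm_sq_inv_cayley (hne z hz), one_sub_norm_sq_inv_cayley (hne w hw), hdiff,
      norm_div, norm_mul, norm_mul, Complex.norm_ofNat] at h1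
    simp only [Complex.add_re, Complex.ofReal_re] at h1
    have hpos : 0 < (‖H z + ε + 1‖ * ‖H w + ε + 1‖) ^ 2 := by positivity
    have h2 := mul_le_mul_of_nonneg_right h1 hpos.le
    have e1 : (2 * ‖H z - H w‖ / (‖H z + ε + 1‖ * ‖H w + ε + 1‖)) ^ 2 *
        ((1 - ‖z‖ ^ 2) * (1 - ‖w‖ ^ 2)) * (‖H z + ε + 1‖ * ‖H w + ε + 1‖) ^ 2 =
        4 * (‖H z - H w‖ ^ 2 * ((1 - ‖z‖ ^ 2) * (1 - ‖w‖ ^ 2))) := by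
      field_simp
      ring
    have e2 : ‖z - w‖ ^ 2 * (4 * ((H z).re + ε) / ‖H z + ε + 1‖ ^ 2 *
        (4 * ((H w).re + ε) / ‖H w + ε + 1‖ ^ 2)) * (‖H z + ε + 1‖ * ‖H w + ε + 1‖) ^ 2 =
        4 * (‖z - w‖ ^ 2 * (4 * ((H z).re + ε) * ((H w).re + ε))) := by
      field_simp
    rw [e1, e2] at h2
    linarith
  have hlim : Tendsto (fun ε : ℝ => ‖z - w‖ ^ 2 * (4 * ((H z).re + ε) * ((H w).re + ε)))
      (𝓝[>] 0) (𝓝 (‖z - w‖ ^ 2 * (4 * ((H z).re + 0) * ((H w).re + 0)))) :=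
    (Continuous.tendsto (by fun_prop) 0).mono_left nhdsWithin_le_nhds
  simp only [add_zero] at hlim
  exact ge_of_tendsto hlim (by
    filter_upwards [self_mem_nhdsWithin] with ε h using hε ε h)

/-- The Schwarz-Pick inequality for functions from the unit ball to the unit disc. -/
theorem schwarz_pick_ball {N : ℕ} {f : CN N → ℂ} (hf : DifferentiableOn ℂ f (Metric.ball 0 1))
    (hf1 : ∀ z, ‖z‖ < 1 → ‖f z‖ < 1) {z w : CN N} (hz : ‖z‖ < 1) (hw : ‖w‖ < 1) :
    ‖1 - starRingEnd ℂ (f w) * f z‖ ^ 2 * ((1 - ‖z‖ ^ 2) * (1 - ‖w‖ ^ 2)) ≤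
      ‖1 - inner ℂ w z‖ ^ 2 * ((1 - ‖f z‖ ^ 2) * (1 - ‖f w‖ ^ 2)) := by
  rcases eq_or_ne z w with rfl | hne
  · have h1 : inner ℂ z z = ((‖z‖ ^ 2 : ℝ) : ℂ) := by
      rw [inner_self_eq_norm_sq_to_K]; push_cast; rfl
    have h2 : 0 ≤ 1 - ‖z‖ ^ 2 := by nlinarith [norm_nonneg z]
    rw [norm_sq_one_sub_conj_mul, sub_self, norm_zero, h1, ← Complex.ofReal_one,
      ← Complex.ofReal_sub, Complex.norm_real, Real.norm_of_nonneg h2]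
    linarith
  -- The complex line through `z` and `w` meets the ball in a disc with centre `c`, the point of the
  -- line nearest to the origin, and radius `R = √(1 - |c|²)`. The disc version is applied to `f` in
  -- the coordinate of that disc.
  obtain ⟨v, hv⟩ : ∃ v : ℂ, v = (‖z - w‖ : ℂ) := ⟨_, rfl⟩
  have hzw : ‖z - w‖ ≠ 0 := norm_ne_zero_iff.2 (sub_ne_zero.2 hne)
  have hv0 : v ≠ 0 := by rw [hv]; exact_mod_cast hzw
  obtain ⟨u, hu⟩ : ∃ u : CN N, u = v⁻¹ • (z - w) := ⟨_, rfl⟩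
  have hu1 : ‖u‖ = 1 := by
    rw [hu, norm_smul, norm_inv, hv, Complex.norm_real, norm_norm, inv_mul_cancel₀ hzw]
  obtain ⟨p, hp⟩ : ∃ p : ℂ, p = inner ℂ u w := ⟨_, rfl⟩
  obtain ⟨c, hc⟩ : ∃ c : CN N, c = w - p • u := ⟨_, rfl⟩
  have huu : inner ℂ u u = (1 : ℂ) := by
    rw [inner_self_eq_norm_sq_to_K, hu1]; simp
  have huc : inner ℂ u c = (0 : ℂ) := by
    rw [hc, inner_sub_right, inner_smul_right, huu, mul_one, hp, sub_self]
  have hcu : inner ℂ c u = (0 : ℂ) := by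
    rw [← inner_conj_symm, huc, map_zero]
  have hinner : ∀ a b : ℂ, inner ℂ (c + a • u) (c + b • u) =
      ((‖c‖ ^ 2 : ℝ) : ℂ) + starRingEnd ℂ a * b := by
    intro a b
    rw [inner_add_left, inner_add_right, inner_add_right, inner_smul_left, inner_smul_left,
      inner_smul_right, inner_smul_right, huc, hcu, huu, inner_self_eq_norm_sq_to_K]
    push_cast
    simp
  have hnorm : ∀ a : ℂ, ‖c + a • u‖ ^ 2 = ‖c‖ ^ 2 + ‖a‖ ^ 2 := by
    intro a
    have h1 := hinner a a
    rw [inner_self_eq_norm_sq_to_K, Complex.conj_mul'] at h1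
    apply Complex.ofReal_injective
    push_cast at h1 ⊢
    exact h1
  have hwc : w = c + p • u := by rw [hc, sub_add_cancel]
  have hzc : z = c + (p + v) • u := by
    rw [add_smul, ← add_assoc, ← hwc, hu, smul_smul, mul_inv_cancel₀ hv0, one_smul]
    abel
  have hcw : ‖c‖ ^ 2 + ‖p‖ ^ 2 = ‖w‖ ^ 2 := by rw [← hnorm, ← hwc]
  have hcz : ‖c‖ ^ 2 + ‖p + v‖ ^ 2 = ‖z‖ ^ 2 := by rw [← hnorm, ← hzc]
  have hw2 : ‖w‖ ^ 2 < 1 := by nlinarith [norm_nonneg w]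
  have hz2 : ‖z‖ ^ 2 < 1 := by nlinarith [norm_nonneg z]
  have hR2 : 0 < 1 - ‖c‖ ^ 2 := by nlinarith [sq_nonneg ‖p‖]
  set R : ℝ := √(1 - ‖c‖ ^ 2) with hR
  have hR0 : 0 < R := Real.sqrt_pos.2 hR2
  have hRsq : R ^ 2 = 1 - ‖c‖ ^ 2 := Real.sq_sqrt hR2.le
  have hRc : (R : ℂ) ≠ 0 := by exact_mod_cast hR0.ne'
  have hscale : ∀ a : ℂ, ‖c + (R * a) • u‖ ^ 2 = 1 - R ^ 2 * (1 - ‖a‖ ^ 2) := by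
    intro a
    rw [hnorm, norm_mul, Complex.norm_real, Real.norm_of_nonneg hR0.le, mul_pow]
    linarith
  have hlt : ∀ a : ℂ, ‖c + (R * a) • u‖ < 1 ↔ ‖a‖ < 1 := by
    intro a
    rw [← sq_lt_one_iff₀ (norm_nonneg _), hscale, ← sq_lt_one_iff₀ (norm_nonneg a)]
    have : 0 < R ^ 2 := by positivity
    constructor <;> intro h <;> nlinarith
  have hwR : w = c + (R * (p / R)) • u := by rw [mul_div_cancel₀ _ hRc, ← hwc]
  have hzR : z = c + (R * ((p + v) / R)) • u := by rw [mul_div_cancel₀ _ hRc, ← hzc]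
  set a : ℂ := (p + v) / R with ha
  set b : ℂ := p / R with hb
  have ha1 : ‖a‖ < 1 := (hlt a).1 (hzR ▸ hz)
  have hb1 : ‖b‖ < 1 := (hlt b).1 (hwR ▸ hw)
  have h1 := schwarz_pick (g := fun τ : ℂ => f (c + (R * τ) • u))
    (hf.comp (by fun_prop) fun τ hτ =>
      mem_ball_zero_iff.2 ((hlt τ).2 (mem_ball_zero_iff.1 hτ)))
    (fun τ hτ => hf1 _ ((hlt τ).2 hτ)) ha1 hb1
  simp only [← hzR, ← hwR] at h1
  have hza : 1 - ‖z‖ ^ 2 = R ^ 2 * (1 - ‖a‖ ^ 2) := by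
    have := hscale a
    rw [← hzR] at this
    linarith
  have hwb : 1 - ‖w‖ ^ 2 = R ^ 2 * (1 - ‖b‖ ^ 2) := by
    have := hscale b
    rw [← hwR] at this
    linarith
  have hwz : ‖1 - inner ℂ w z‖ ^ 2 = R ^ 4 * ‖1 - starRingEnd ℂ b * a‖ ^ 2 := by
    have h2 : 1 - inner ℂ w z = ((R ^ 2 : ℝ) : ℂ) * (1 - starRingEnd ℂ b * a) := by
      conv_lhs => rw [hwR, hzR]
      rw [hinner, map_mul, Complex.conj_ofReal, show ‖c‖ ^ 2 = 1 - R ^ 2 by linarith]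
      push_cast
      ring
    rw [h2, norm_mul, Complex.norm_real, Real.norm_of_nonneg (by positivity)]
    ring
  rw [hza, hwb, hwz, norm_sq_one_sub_conj_mul, norm_sq_one_sub_conj_mul]
  have hR4 : 0 ≤ R ^ 4 := by positivity
  have := mul_le_mul_of_nonneg_left h1 hR4
  nlinarith

/-- A Schwarz-Pick inequality for self-maps of the unit ball. -/
theorem IsHoloSelfMap.schwarz_pick {N : ℕ} [NeZero N] {φ : Ball N → Ball N} (hφ : IsHoloSelfMap φ)
    (z w : Ball N) :
    ‖1 - inner ℂ (φ w : CN N) (φ z : CN N)‖ ^ 2 *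
        ((1 - ‖(z : CN N)‖ ^ 2) * (1 - ‖(w : CN N)‖ ^ 2)) ≤
      ‖1 - inner ℂ (w : CN N) (z : CN N)‖ ^ 2 *
        ((1 - ‖inner ℂ (φ w : CN N) (φ z : CN N)‖ ^ 2) * (1 - ‖(φ w : CN N)‖ ^ 2)) := by
  obtain ⟨Φ, hΦ, hΦφ⟩ := hφ
  -- Composing with the functional in the direction of `φ w` reduces to a scalar function whose
  -- value at `w` is `|φ w|`.
  obtain ⟨e, he, hwe⟩ := exists_unit_smul (φ w : CN N)
  have hle : ∀ z : CN N, ‖z‖ < 1 → ‖inner ℂ e (Φ z)‖ < 1 := by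
    intro z hz
    have h1 := norm_inner_le_norm (𝕜 := ℂ) e (Φ z)
    rw [he, one_mul, hΦφ ⟨z, mem_ball_zero_iff.2 hz⟩] at h1
    rw [hΦφ ⟨z, mem_ball_zero_iff.2 hz⟩]
    exact h1.trans_lt (norm_ball_lt _)
  have h := schwarz_pick_ball (f := fun z => inner ℂ e (Φ z))
    ((innerSL ℂ e).differentiable.comp_differentiableOn hΦ) hle (norm_ball_lt z) (norm_ball_lt w)
  simp only [hΦφ] at h
  have hw1 : inner ℂ e (φ w : CN N) = ((‖(φ w : CN N)‖ : ℝ) : ℂ) := by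
    conv_lhs => rw [hwe]
    rw [← Complex.coe_smul, inner_smul_right, inner_self_eq_norm_sq_to_K, he]
    simp
  have hwz : inner ℂ (φ w : CN N) (φ z : CN N) =
      ((‖(φ w : CN N)‖ : ℝ) : ℂ) * inner ℂ e (φ z : CN N) := by
    conv_lhs => rw [hwe]
    rw [← Complex.coe_smul, inner_smul_left, Complex.conj_ofReal]
  have hnw := norm_ball_lt (φ w)
  rw [hw1, Complex.conj_ofReal, ← hwz, Complex.norm_real, norm_norm] at h
  refine h.trans (mul_le_mul_of_nonneg_left (mul_le_mul_of_nonneg_right ?_ ?_) (sq_nonneg _))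
  · rw [hwz, norm_mul, Complex.norm_real, norm_norm]
    have h2 := mul_le_of_le_one_left (norm_nonneg (inner ℂ e (φ z : CN N))) hnw.le
    have h3 := pow_le_pow_left₀ (by positivity) h2 2
    linarith
  · nlinarith [norm_nonneg (φ w : CN N)]

/-! ### Julia's inequality -/

/-- Julia's inequality for `φ` at the boundary point `ζ` with value `η` and constant `D`. -/
def JuliaIneq {N : ℕ} (φ : Ball N → Ball N) (ζ η : CN N) (D : ℝ) : Prop :=
  ∀ z : Ball N, ‖1 - inner ℂ η (φ z : CN N)‖ ^ 2 * (1 - ‖(z : CN N)‖ ^ 2) ≤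
    D * ‖1 - inner ℂ ζ (z : CN N)‖ ^ 2 * (1 - ‖inner ℂ η (φ z : CN N)‖ ^ 2)

/-- The filter of neighbourhoods of a boundary point in the ball. -/
noncomputable abbrev nhdsBall {N : ℕ} (ζ : Sph N) : Filter (Ball N) :=
  comap (Subtype.val : Ball N → CN N) (𝓝 (ζ : CN N))

/-- Points `z_n → ζ` nearly realising the liminf are chosen so that, along a subsequence, `φ(z_n)`
converges to some `η`. Since `1 - |φ(z_n)| = O(1 - |z_n|)`, `η` lies on the sphere. The inequality
is the limit of Schwarz-Pick between `x` and `z_n`, divided by `1 - |z_n|`. -/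
theorem exists_juliaIneq {N : ℕ} [NeZero N] {φ : Ball N → Ball N} (hφ : IsHoloSelfMap φ)
    {ζ : Sph N} (hd : angDeriv φ ζ ≠ ∞) :
    ∃ η : CN N, ‖η‖ = 1 ∧ JuliaIneq φ ζ η (angDeriv φ ζ).toReal := by
  set D := (angDeriv φ ζ).toReal with hD
  have hD0 : 0 ≤ D := ENNReal.toReal_nonneg
  have hex : ∀ n : ℕ, ∃ z : Ball N, ‖(z : CN N) - ζ‖ < 1 / ((n : ℝ) + 1) ∧
      1 - ‖(φ z : CN N)‖ ≤ (D + 1 / ((n : ℝ) + 1)) * (1 - ‖(z : CN N)‖) := by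
    intro n
    have hn : 0 < 1 / ((n : ℝ) + 1) := by positivity
    have h1 : angDeriv φ ζ < ENNReal.ofReal (D + 1 / ((n : ℝ) + 1)) := by
      rw [← ENNReal.ofReal_toReal hd, ENNReal.ofReal_lt_ofReal_iff (by positivity)]
      linarith
    have h2 := frequently_lt_of_liminf_lt (h := h1)
    have h3 : ∀ᶠ z : Ball N in nhdsBall ζ, ‖(z : CN N) - ζ‖ < 1 / ((n : ℝ) + 1) := by
      refine (eventually_comap.2 ?_)
      filter_upwards [Metric.ball_mem_nhds (ζ : CN N) hn] with x hx z hz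
      rwa [hz, ← dist_eq_norm]
    obtain ⟨z, hz1, hz2⟩ := (h2.and_eventually h3).exists
    refine ⟨z, hz2, ?_⟩
    have h4 := (ENNReal.ofReal_lt_ofReal_iff (by positivity)).1 hz1
    exact ((div_lt_iff₀ (by linarith [norm_ball_lt z])).1 h4).le
  choose z hz1 hz2 using hex
  have hinv : Tendsto (fun n : ℕ => 1 / ((n : ℝ) + 1)) atTop (𝓝 0) :=
    tendsto_one_div_add_atTop_nhds_zero_nat
  have hzlim : Tendsto (fun n => (z n : CN N)) atTop (𝓝 ζ) := by
    rw [tendsto_iff_norm_sub_tendsto_zero]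
    exact squeeze_zero (fun _ => norm_nonneg _) (fun n => (hz1 n).le) hinv
  obtain ⟨η, -, σ, hσ, hη⟩ := (isCompact_closedBall (0 : CN N) 1).tendsto_subseq
    (x := fun n => (φ (z n) : CN N)) fun n => mem_closedBall_zero_iff.2 (norm_ball_lt _).le
  have hzσ : Tendsto (fun n => (z (σ n) : CN N)) atTop (𝓝 ζ) := hzlim.comp hσ.tendsto_atTop
  have hησ : Tendsto (fun n => (φ (z (σ n)) : CN N)) atTop (𝓝 η) := hη
  have hcσ : Tendsto (fun n => D + 1 / ((σ n : ℝ) + 1)) atTop (𝓝 (D + 0)) :=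
    (hinv.comp hσ.tendsto_atTop).const_add D
  have hη1 : ‖η‖ = 1 := by
    have h1 : Tendsto (fun n => 1 - ‖(φ (z (σ n)) : CN N)‖) atTop (𝓝 (1 - ‖η‖)) :=
      hησ.norm.const_sub 1
    have h2 : Tendsto (fun n => (D + 1 / ((σ n : ℝ) + 1)) * (1 - ‖(z (σ n) : CN N)‖)) atTop
        (𝓝 ((D + 0) * (1 - ‖(ζ : CN N)‖))) := hcσ.mul (hzσ.norm.const_sub 1)
    have h3 := le_of_tendsto_of_tendsto' h1 h2 fun n => hz2 (σ n)
    have h4 := ge_of_tendsto' h1 (b := 0) fun n => by linarith [norm_ball_lt (φ (z (σ n)))]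
    rw [norm_sph] at h3
    linarith
  refine ⟨η, hη1, fun x => ?_⟩
  have hpt : ∀ n, ‖1 - inner ℂ (φ (z (σ n)) : CN N) (φ x : CN N)‖ ^ 2 * (1 - ‖(x : CN N)‖ ^ 2) *
      (1 + ‖(z (σ n) : CN N)‖) ≤
      ‖1 - inner ℂ (z (σ n) : CN N) (x : CN N)‖ ^ 2 *
        (1 - ‖inner ℂ (φ (z (σ n)) : CN N) (φ x : CN N)‖ ^ 2) *
        ((D + 1 / ((σ n : ℝ) + 1)) * (1 + ‖(φ (z (σ n)) : CN N)‖)) := by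
    intro n
    have h1 := hφ.schwarz_pick x (z (σ n))
    have h2 := norm_ball_lt (z (σ n))
    have h3 : 0 < 1 - ‖(z (σ n) : CN N)‖ := by linarith
    refine le_of_mul_le_mul_right ?_ h3
    calc _ = ‖1 - inner ℂ (φ (z (σ n)) : CN N) (φ x : CN N)‖ ^ 2 *
          ((1 - ‖(x : CN N)‖ ^ 2) * (1 - ‖(z (σ n) : CN N)‖ ^ 2)) := by ring
      _ ≤ _ := h1
      _ = ‖1 - inner ℂ (z (σ n) : CN N) (x : CN N)‖ ^ 2 *
          (1 - ‖inner ℂ (φ (z (σ n)) : CN N) (φ x : CN N)‖ ^ 2) *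
          (1 + ‖(φ (z (σ n)) : CN N)‖) * (1 - ‖(φ (z (σ n)) : CN N)‖) := by ring
      _ ≤ ‖1 - inner ℂ (z (σ n) : CN N) (x : CN N)‖ ^ 2 *
          (1 - ‖inner ℂ (φ (z (σ n)) : CN N) (φ x : CN N)‖ ^ 2) *
          (1 + ‖(φ (z (σ n)) : CN N)‖) *
          ((D + 1 / ((σ n : ℝ) + 1)) * (1 - ‖(z (σ n) : CN N)‖)) := by
        refine mul_le_mul_of_nonneg_left (hz2 (σ n)) ?_
        have h4 : ‖inner ℂ (φ (z (σ n)) : CN N) (φ x : CN N)‖ ≤ 1 := by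
          refine (norm_inner_le_norm _ _).trans ?_
          exact mul_le_one₀ (norm_ball_lt _).le (norm_nonneg _) (norm_ball_lt _).le
        have h5 : 0 ≤ 1 - ‖inner ℂ (φ (z (σ n)) : CN N) (φ x : CN N)‖ ^ 2 := by
          nlinarith [norm_nonneg (inner ℂ (φ (z (σ n)) : CN N) (φ x : CN N))]
        positivity
      _ = _ := by ring
  have hi1 : Tendsto (fun n => inner ℂ (φ (z (σ n)) : CN N) (φ x : CN N)) atTop
      (𝓝 (inner ℂ η (φ x : CN N))) := hησ.inner tendsto_const_nhds
  have hi2 : Tendsto (fun n => inner ℂ (z (σ n) : CN N) (x : CN N)) atTop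
      (𝓝 (inner ℂ (ζ : CN N) (x : CN N))) := hzσ.inner tendsto_const_nhds
  have hL := (((hi1.const_sub 1).norm.pow 2).mul_const (1 - ‖(x : CN N)‖ ^ 2)).mul
    (hzσ.norm.const_add 1)
  have hR := (((hi2.const_sub 1).norm.pow 2).mul ((hi1.norm.pow 2).const_sub 1)).mul
    (hcσ.mul (hησ.norm.const_add 1))
  have := le_of_tendsto_of_tendsto' hL hR hpt
  -- The remaining factors `1 + |z_n|` and `1 + |φ(z_n)|` both tend to `2` and cancel.
  rw [norm_sph, hη1, add_zero] at this
  linarith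

/-! ### The Julia-Carathéodory theorem along rays in a slice -/

/-- The point `τ ζ` of the ball, for a complex number `τ` in the unit disc. -/
noncomputable def slice {N : ℕ} (ζ : Sph N) (τ : ℂ) : Ball N :=
  if h : ‖τ‖ < 1 then ⟨τ • (ζ : CN N), by
    rwa [mem_ball_zero_iff, norm_smul, norm_sph, mul_one]⟩ else ⟨0, by simp⟩

theorem slice_coe {N : ℕ} (ζ : Sph N) {τ : ℂ} (h : ‖τ‖ < 1) : (slice ζ τ : CN N) = τ • (ζ : CN N) := by
  rw [slice, dif_pos h]

theorem norm_slice {N : ℕ} (ζ : Sph N) {τ : ℂ} (h : ‖τ‖ < 1) : ‖(slice ζ τ : CN N)‖ = ‖τ‖ := by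
  rw [slice_coe ζ h, norm_smul, norm_sph, mul_one]

theorem inner_slice {N : ℕ} (ζ : Sph N) {τ : ℂ} (h : ‖τ‖ < 1) :
    inner ℂ (ζ : CN N) (slice ζ τ : CN N) = τ := by
  rw [slice_coe ζ h, inner_smul_right, inner_self_eq_norm_sq_to_K, norm_sph]
  simp

theorem norm_inner_lt_one {N : ℕ} {η : CN N} (hη : ‖η‖ = 1) (z : Ball N) :
    ‖inner ℂ η (z : CN N)‖ < 1 := by
  have h := norm_inner_le_norm (𝕜 := ℂ) η (z : CN N)
  rw [hη, one_mul] at h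
  exact h.trans_lt (norm_ball_lt z)

theorem tendsto_slice {N : ℕ} (ζ : Sph N) {ι : Type*} {l : Filter ι} {τ : ι → ℂ}
    (hτ : Tendsto τ l (𝓝 1)) (h : ∀ᶠ i in l, ‖τ i‖ < 1) :
    Tendsto (fun i => slice ζ (τ i)) l (nhdsBall ζ) := by
  rw [tendsto_comap_iff]
  have h1 : Tendsto (fun i => τ i • (ζ : CN N)) l (𝓝 ((1 : ℂ) • (ζ : CN N))) :=
    hτ.smul_const _
  rw [one_smul] at h1
  refine h1.congr' ?_
  filter_upwards [h] with i hi
  exact (slice_coe ζ hi).symm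

/-- The non-tangential ray `1 - (1 + i M) x`, `x → 0`. -/
noncomputable def ray (M x : ℝ) : ℂ := 1 - (1 + M * Complex.I) * x

theorem norm_sq_ray (M x : ℝ) : ‖ray M x‖ ^ 2 = 1 - (2 * x - (1 + M ^ 2) * x ^ 2) := by
  rw [← Complex.normSq_eq_norm_sq, Complex.normSq_apply]
  simp [ray]
  ring

theorem tendsto_ray (M : ℝ) : Tendsto (ray M) (𝓝[>] 0) (𝓝 1) := by
  have h : Continuous (ray M) := by unfold ray; fun_prop
  have := (h.tendsto 0).mono_left (nhdsWithin_le_nhds (s := Set.Ioi 0))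
  simpa [ray] using this

theorem eventually_ray (M : ℝ) : ∀ᶠ x in 𝓝[>] (0 : ℝ), 0 < x ∧ x ≤ 1 - ‖ray M x‖ ^ 2 ∧
    ‖ray M x‖ < 1 := by
  have h1 : Tendsto (fun x : ℝ => (1 + M ^ 2) * x) (𝓝[>] 0) (𝓝 ((1 + M ^ 2) * 0)) :=
    (Continuous.tendsto (by fun_prop) 0).mono_left nhdsWithin_le_nhds
  rw [mul_zero] at h1
  filter_upwards [self_mem_nhdsWithin, h1.eventually_le_const one_pos] with x hx h2
  have hx : 0 < x := hx
  have h3 : x ≤ 1 - ‖ray M x‖ ^ 2 := by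
    rw [norm_sq_ray]
    nlinarith
  refine ⟨hx, h3, ?_⟩
  refine lt_of_pow_lt_pow_left₀ 2 zero_le_one ?_
  linarith

theorem one_sub_ray (M x : ℝ) : 1 - ray M x = (1 + M * Complex.I) * x := by
  simp [ray]

theorem one_add_mul_I_ne_zero (M : ℝ) : (1 + M * Complex.I : ℂ) ≠ 0 := by
  intro h
  have := congrArg Complex.re h
  simp at this

/-- A function from the disc to the right half plane whose real part is not bounded below by a
positive multiple of the Poisson kernel is `o(1 / |1 - z|)` in non-tangential approach to `1`. -/
theorem tendsto_one_sub_mul_of_re_nonneg {H : ℂ → ℂ}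
    (hH : DifferentiableOn ℂ H (Metric.ball 0 1)) (hre : ∀ z, ‖z‖ < 1 → 0 ≤ (H z).re)
    (hinf : ∀ ε : ℝ, 0 < ε → ∃ w, ‖w‖ < 1 ∧ (H w).re ≤ ε * ((1 - ‖w‖ ^ 2) / ‖1 - w‖ ^ 2)) (M : ℝ) :
    Tendsto (fun x => (1 - ray M x) * H (ray M x)) (𝓝[>] 0) (𝓝 0) := by
  rw [Metric.tendsto_nhds]
  intro ε₀ hε₀
  set A := ‖(1 + M * Complex.I : ℂ)‖ with hA
  have hA0 : 0 ≤ A := norm_nonneg _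
  set ε := ε₀ / (3 + 8 * A) with hε
  have hε0 : 0 < ε := by positivity
  have hεε : (2 + 8 * A) * ε < ε₀ := by
    rw [hε, ← mul_div_assoc, div_lt_iff₀ (by positivity)]
    nlinarith
  -- At this one point `H` is small against the Poisson kernel; Schwarz-Pick transports the
  -- smallness to all `z` on the ray near `1`, with `w` fixed.
  obtain ⟨w, hw, hHw⟩ := hinf ε hε0
  have hw1 : 0 < ‖1 - w‖ := norm_pos_iff.2 fun h => by
    rw [sub_eq_zero] at h
    rw [← h, norm_one] at hw
    exact lt_irrefl _ hw
  have hr := tendsto_ray M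
  have hk : Tendsto (fun x => ‖1 - ray M x‖ * ‖H w‖) (𝓝[>] 0) (𝓝 0) := by
    have := ((hr.const_sub 1).norm).mul_const ‖H w‖
    simpa using this
  have hB : Tendsto (fun x => ‖ray M x - w‖ ^ 2) (𝓝[>] 0) (𝓝 (‖1 - w‖ ^ 2)) :=
    ((hr.sub_const w).norm).pow 2
  filter_upwards [eventually_ray M, hk.eventually_le_const hε0,
    hB.eventually_le_const (show ‖1 - w‖ ^ 2 < 2 * ‖1 - w‖ ^ 2 by nlinarith [pow_pos hw1 2])]
    with x ⟨hx0, hx1, hx2⟩ hkx hBx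
  rw [dist_zero_right, norm_mul]
  set z := ray M x with hz
  set q := ‖1 - z‖ * ‖H z‖ with hq
  set k := ‖1 - z‖ * ‖H w‖ with hk'
  have hc : ‖1 - z‖ = A * x := by
    rw [hz, one_sub_ray, norm_mul, Complex.norm_real, Real.norm_of_nonneg hx0.le]
  have hSP := schwarz_pick_halfPlane hH hre hx2 hw
  have hww : 0 < 1 - ‖w‖ ^ 2 := by nlinarith [norm_nonneg w]
  have h1 : ‖H z - H w‖ ^ 2 * (1 - ‖z‖ ^ 2) ≤ 8 * ε * (H z).re := by
    have h2 : ‖z - w‖ ^ 2 * (4 * (H z).re * (H w).re) ≤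
        (2 * ‖1 - w‖ ^ 2) * (4 * (H z).re * (ε * ((1 - ‖w‖ ^ 2) / ‖1 - w‖ ^ 2))) := by
      have h3 := hre z hx2
      have h4 := hre w hw
      exact mul_le_mul hBx (mul_le_mul_of_nonneg_left hHw (by positivity)) (by positivity)
        (by positivity)
    have h5 : (2 * ‖1 - w‖ ^ 2) * (4 * (H z).re * (ε * ((1 - ‖w‖ ^ 2) / ‖1 - w‖ ^ 2))) =
        8 * ε * (H z).re * (1 - ‖w‖ ^ 2) := by
      field_simp
      ring
    refine le_of_mul_le_mul_right ?_ hww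
    linarith
  have h2 : (q - k) ^ 2 ≤ ‖1 - z‖ ^ 2 * ‖H z - H w‖ ^ 2 := by
    have h3 := abs_norm_sub_norm_le (H z) (H w)
    have h4 := sq_le_sq' (by linarith [neg_abs_le (‖H z‖ - ‖H w‖)]) ((le_abs_self _).trans h3)
    calc (q - k) ^ 2 = ‖1 - z‖ ^ 2 * (‖H z‖ - ‖H w‖) ^ 2 := by rw [hq, hk']; ring
      _ ≤ _ := by gcongr
  have hq0 : 0 ≤ q := by positivity
  have hk0 : 0 ≤ k := by positivity
  have h3 : (q - k) ^ 2 * x ≤ 8 * ε * A * q * x := by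
    calc (q - k) ^ 2 * x ≤ ‖1 - z‖ ^ 2 * ‖H z - H w‖ ^ 2 * (1 - ‖z‖ ^ 2) :=
          mul_le_mul h2 hx1 hx0.le (by positivity)
      _ = ‖1 - z‖ ^ 2 * (‖H z - H w‖ ^ 2 * (1 - ‖z‖ ^ 2)) := by ring
      _ ≤ ‖1 - z‖ ^ 2 * (8 * ε * ‖H z‖) := by
          have := Complex.re_le_norm (H z)
          exact mul_le_mul_of_nonneg_left (h1.trans (by gcongr)) (by positivity)
      _ = 8 * ε * (‖1 - z‖) * q := by rw [hq]; ring
      _ = _ := by rw [hc]; ring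
  have h4 := le_of_mul_le_mul_right h3 hx0
  -- From `(q - k)² ≤ 8εA q`: a larger `q` would give `q² > 2kq + 8εA q`, a contradiction. As `k ≤
  -- ε` near the endpoint, `q ≤ (2 + 8A)ε < ε₀`.
  have h5 : q ≤ 2 * k + 8 * ε * A := by
    by_contra! h6
    have h7 : 0 < q := by
      have : 0 ≤ 8 * ε * A := by positivity
      linarith
    nlinarith [mul_lt_mul_of_pos_right h6 h7]
  nlinarith

theorem JuliaIneq.pos {N : ℕ} {φ : Ball N → Ball N} {ζ : Sph N} {η : CN N} {D : ℝ} (hη : ‖η‖ = 1)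
    (hJ : JuliaIneq φ ζ η D) : 0 < D := by
  have h := hJ ⟨0, by simp⟩
  have h1 := norm_inner_lt_one hη (φ ⟨0, by simp⟩)
  have h2 : 0 < ‖1 - inner ℂ η (φ ⟨0, by simp⟩ : CN N)‖ := by
    have := norm_sub_norm_le (1 : ℂ) (inner ℂ η (φ ⟨0, by simp⟩ : CN N))
    rw [norm_one] at this
    linarith
  simp only [norm_zero, inner_zero_right, sub_zero, norm_one] at h
  by_contra! hD
  have h3 : 0 ≤ 1 - ‖inner ℂ η (φ ⟨0, by simp⟩ : CN N)‖ ^ 2 := by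
    nlinarith [norm_nonneg (inner ℂ η (φ ⟨0, by simp⟩ : CN N))]
  nlinarith [pow_pos h2 2]

theorem one_sub_ne_zero_of_norm_lt {z : ℂ} (hz : ‖z‖ < 1) : 1 - z ≠ 0 := fun h => by
  rw [sub_eq_zero] at h
  rw [← h, norm_one] at hz
  exact lt_irrefl _ hz

/-- This is optimality of the Julia constant. Otherwise, at distance `x` from `ζ` on the radius, `1
- |φ| < 2D'x / (2 - x)` with `D' < d_φ(ζ)`, and the liminf would be at most `D'`. -/
theorem exists_re_le_of_angDeriv {N : ℕ} {φ : Ball N → Ball N} {ζ : Sph N}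
    (hd : angDeriv φ ζ ≠ ∞) (hd0 : 0 < (angDeriv φ ζ).toReal) {η : CN N} (hη : ‖η‖ = 1) {ε : ℝ}
    (hε : 0 < ε) : ∃ τ : ℂ, ‖τ‖ < 1 ∧
      (1 - ‖inner ℂ η (φ (slice ζ τ) : CN N)‖ ^ 2) / ‖1 - inner ℂ η (φ (slice ζ τ) : CN N)‖ ^ 2 ≤
        (((angDeriv φ ζ).toReal)⁻¹ + ε) * ((1 - ‖τ‖ ^ 2) / ‖1 - τ‖ ^ 2) := by
  by_contra! hcon
  set D := (angDeriv φ ζ).toReal with hD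
  set D' := (D⁻¹ + ε)⁻¹ with hD'
  have hD'0 : 0 < D' := by positivity
  have hDD : D' < D := by
    rw [hD', inv_lt_comm₀ (by positivity) hd0]
    linarith
  -- The gap between `D'` and `E` absorbs the factor `2 / (2 - x)`, which tends to `1`.
  obtain ⟨E, hE1, hE2⟩ := exists_between hDD
  have hray := eventually_ray 0
  have hlt : ENNReal.ofReal E < angDeriv φ ζ := by
    rw [← ENNReal.ofReal_toReal hd]
    exact (ENNReal.ofReal_lt_ofReal_iff hd0).2 hE2
  have h1 := eventually_lt_of_lt_liminf hlt
  have h2 := (tendsto_slice ζ (tendsto_ray 0) (hray.mono fun x hx => hx.2.2)).eventually h1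
  have h3 : Tendsto (fun x : ℝ => D' * 2 / (2 - x)) (𝓝[>] 0) (𝓝 (D' * 2 / (2 - 0))) := by
    have : ContinuousAt (fun x : ℝ => D' * 2 / (2 - x)) 0 :=
      ContinuousAt.div (by fun_prop) (by fun_prop) (by norm_num)
    exact this.tendsto.mono_left nhdsWithin_le_nhds
  rw [sub_zero, mul_div_cancel_right₀ _ two_ne_zero] at h3
  have h4 : ∀ᶠ x in 𝓝[>] (0 : ℝ), x < 1 :=
    (tendsto_nhdsWithin_of_tendsto_nhds tendsto_id).eventually_lt_const one_pos
  obtain ⟨x, hx1, hx2, hx3, hx4⟩ :=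
    (h2.and (hray.and ((h3.eventually_lt_const hE1).and h4))).exists
  have hr : ray 0 x = ((1 - x : ℝ) : ℂ) := by simp [ray]
  obtain ⟨hx0, -, hlt1⟩ := hx2
  have hnr : ‖ray 0 x‖ = 1 - x := by
    rw [hr, Complex.norm_real, Real.norm_of_nonneg (by linarith)]
  have hn1 : ‖1 - ray 0 x‖ = x := by
    rw [one_sub_ray]
    simp [abs_of_pos hx0]
  rw [norm_slice ζ hlt1, hnr, sub_sub_cancel, ENNReal.ofReal_lt_ofReal_iff_of_nonneg (by linarith),
    lt_div_iff₀ hx0] at hx1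
  have hc := hcon _ hlt1
  rw [hn1, hnr] at hc
  set f := inner ℂ η (φ (slice ζ (ray 0 x)) : CN N) with hf
  have hf1 : ‖f‖ < 1 := norm_inner_lt_one hη _
  have hfφ : ‖f‖ ≤ ‖(φ (slice ζ (ray 0 x)) : CN N)‖ := by
    have h := norm_inner_le_norm (𝕜 := ℂ) η (φ (slice ζ (ray 0 x)) : CN N)
    rwa [hη, one_mul] at h
  have h5 : (1 - ‖f‖ ^ 2) / ‖1 - f‖ ^ 2 ≤ 2 / (1 - ‖f‖) := by
    have h6 : 1 - ‖f‖ ≤ ‖1 - f‖ := by simpa using norm_sub_norm_le (1 : ℂ) f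
    have h7 : 0 < 1 - ‖f‖ := by linarith
    rw [div_le_div_iff₀ (by nlinarith) h7]
    nlinarith [norm_nonneg f, pow_le_pow_left₀ h7.le h6 2]
  have h6 := hc.trans_le h5
  have h7 : 0 < 1 - ‖f‖ := by linarith
  have h8 : (1 - (1 - x) ^ 2) / x ^ 2 = (2 - x) / x := by
    field_simp
    ring
  have h9 : D⁻¹ + ε = D'⁻¹ := by rw [hD', inv_inv]
  rw [h8, h9, lt_div_iff₀ h7] at h6
  have h10 : (2 - x) * (1 - ‖f‖) < D' * 2 * x := by
    have := mul_lt_mul_of_pos_left h6 (mul_pos hD'0 hx0)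
    field_simp at this
    linarith
  rw [div_lt_iff₀ (by linarith)] at hx3
  nlinarith

theorem tendsto_of_tendsto_inner {N : ℕ} {η : CN N} (hη : ‖η‖ = 1) {ι : Type*} {l : Filter ι}
    {b : ι → Ball N} (h : Tendsto (fun i => inner ℂ η (b i : CN N)) l (𝓝 1)) :
    Tendsto (fun i => (b i : CN N)) l (𝓝 η) := by
  rw [tendsto_iff_norm_sub_tendsto_zero]
  have h1 : Tendsto (fun i => √(2 * (1 - (inner ℂ η (b i : CN N)).re))) l (𝓝 0) := by
    have h2 := ((((Complex.continuous_re.tendsto 1).comp h).const_sub 1).const_mul 2).sqrt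
    simpa using h2
  refine squeeze_zero (fun _ => norm_nonneg _) (fun i => Real.le_sqrt_of_sq_le ?_) h1
  rw [@norm_sub_sq ℂ, hη, ← inner_conj_symm]
  have h2 := norm_ball_lt (b i)
  simp only [RCLike.conj_re, RCLike.re_to_complex]
  nlinarith [norm_nonneg (b i : CN N)]

/-- The Julia-Carathéodory theorem along non-tangential rays in a slice of the ball. -/
theorem julia_caratheodory {N : ℕ} [NeZero N] {φ : Ball N → Ball N} (hφ : IsHoloSelfMap φ)
    {ζ : Sph N} (hd : angDeriv φ ζ ≠ ∞) :
    0 < (angDeriv φ ζ).toReal ∧ ∃ η : CN N, ‖η‖ = 1 ∧ ∀ M : ℝ,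
      Tendsto (fun x : ℝ => (1 - inner ℂ η (φ (slice ζ (ray M x)) : CN N)) / x) (𝓝[>] 0)
        (𝓝 ((angDeriv φ ζ).toReal * (1 + M * Complex.I))) ∧
      Tendsto (fun x : ℝ => (φ (slice ζ (ray M x)) : CN N)) (𝓝[>] 0) (𝓝 η) := by
  obtain ⟨η, hη, hJ⟩ := exists_juliaIneq hφ hd
  have hD := hJ.pos hη
  refine ⟨hD, η, hη, fun M => ?_⟩
  set D := (angDeriv φ ζ).toReal with hDdef
  set f : ℂ → ℂ := fun τ => inner ℂ η (φ (slice ζ τ) : CN N) with hf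
  have hf1 : ∀ τ, ‖f τ‖ < 1 := fun τ => norm_inner_lt_one hη _
  have hfd : DifferentiableOn ℂ f (Metric.ball 0 1) := by
    obtain ⟨Φ, hΦ, hΦφ⟩ := hφ
    have h1 : DifferentiableOn ℂ (fun τ : ℂ => inner ℂ η (Φ (τ • (ζ : CN N)))) (Metric.ball 0 1) :=
      (innerSL ℂ η).differentiable.comp_differentiableOn (hΦ.comp (by fun_prop) fun τ hτ => by
        rw [mem_ball_zero_iff] at hτ ⊢
        rwa [norm_smul, norm_sph, mul_one])
    refine h1.congr fun τ hτ => ?_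
    rw [hf]
    simp only
    rw [← slice_coe ζ (mem_ball_zero_iff.1 hτ), hΦφ]
  -- Julia's inequality says exactly that `Re H ≥ 0`; minimality of `D` says that no positive
  -- multiple of the Poisson kernel can still be subtracted.
  set H : ℂ → ℂ := fun τ => (1 + f τ) / (1 - f τ) - ((D⁻¹ : ℝ) : ℂ) * ((1 + τ) / (1 - τ)) with hH
  have hHd : DifferentiableOn ℂ H (Metric.ball 0 1) := by
    refine DifferentiableOn.sub ((hfd.const_add 1).div (hfd.const_sub 1) fun τ _ =>
      one_sub_ne_zero_of_norm_lt (hf1 τ)) (DifferentiableOn.const_mul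
        (DifferentiableOn.div (by fun_prop) (by fun_prop) fun τ hτ =>
          one_sub_ne_zero_of_norm_lt (mem_ball_zero_iff.1 hτ)) _)
  have hHre : ∀ τ, (H τ).re = (1 - ‖f τ‖ ^ 2) / ‖1 - f τ‖ ^ 2 -
      D⁻¹ * ((1 - ‖τ‖ ^ 2) / ‖1 - τ‖ ^ 2) := by
    intro τ
    rw [hH]
    simp only
    rw [Complex.sub_re, Complex.re_ofReal_mul, re_cayley, re_cayley]
  have hre : ∀ τ, ‖τ‖ < 1 → 0 ≤ (H τ).re := by
    intro τ hτ
    have h1 := hJ (slice ζ τ)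
    rw [inner_slice ζ hτ, norm_slice ζ hτ] at h1
    have h2 := pow_pos (norm_pos_iff.2 (one_sub_ne_zero_of_norm_lt hτ)) 2
    have h3 := pow_pos (norm_pos_iff.2 (one_sub_ne_zero_of_norm_lt (hf1 τ))) 2
    rw [hHre, sub_nonneg, ← div_eq_inv_mul, div_div, div_le_div_iff₀ (by positivity) h3]
    simp only [hf] at h1 ⊢
    linarith
  have hinf : ∀ ε : ℝ, 0 < ε → ∃ w, ‖w‖ < 1 ∧
      (H w).re ≤ ε * ((1 - ‖w‖ ^ 2) / ‖1 - w‖ ^ 2) := by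
    intro ε hε
    obtain ⟨τ, hτ, h⟩ := exists_re_le_of_angDeriv hd hD hη hε
    refine ⟨τ, hτ, ?_⟩
    rw [hHre]
    simp only [hf]
    linarith
  have hlim := tendsto_one_sub_mul_of_re_nonneg hHd hre hinf M
  have hr := tendsto_ray M
  have hDc : (D : ℂ) ≠ 0 := by exact_mod_cast hD.ne'
  -- Uses `2(1 - τ)/(1 - f) = (1 - τ)H + D⁻¹(1 + τ) + (1 - τ)`, where the first summand tends to `0`
  -- along the ray.
  have hquot : Tendsto (fun x => (1 - ray M x) / (1 - f (ray M x))) (𝓝[>] 0) (𝓝 ((D : ℂ)⁻¹)) := by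
    have h1 := ((hlim.add ((hr.const_add 1).const_mul ((D⁻¹ : ℝ) : ℂ))).add
      (hr.const_sub 1)).const_mul (1 / 2 : ℂ)
    have h2 : (1 / 2 : ℂ) * (0 + ((D⁻¹ : ℝ) : ℂ) * (1 + 1) + (1 - 1)) = (D : ℂ)⁻¹ := by
      push_cast; ring
    rw [h2] at h1
    refine h1.congr' ?_
    filter_upwards [eventually_ray M] with x ⟨_, _, hx⟩
    have h3 := one_sub_ne_zero_of_norm_lt hx
    have h4 := one_sub_ne_zero_of_norm_lt (hf1 (ray M x))
    simp only [hH]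
    field_simp
    ring
  have hmain : Tendsto (fun x : ℝ => (1 - f (ray M x)) / x) (𝓝[>] 0)
      (𝓝 (D * (1 + M * Complex.I))) := by
    have h1 := (hquot.inv₀ (inv_ne_zero hDc)).mul_const (1 + M * Complex.I)
    rw [inv_inv] at h1
    refine h1.congr' ?_
    filter_upwards [eventually_ray M] with x ⟨hx0, _, _⟩
    have h3 : (x : ℂ) ≠ 0 := by exact_mod_cast hx0.ne'
    have h4 := one_add_mul_I_ne_zero M
    rw [one_sub_ray, inv_div]
    field_simp
  refine ⟨hmain, tendsto_of_tendsto_inner hη ?_⟩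
  have h1 : Tendsto (fun x : ℝ => (x : ℂ)) (𝓝[>] 0) (𝓝 0) := by
    have := (Complex.continuous_ofReal.tendsto 0).mono_left (nhdsWithin_le_nhds (s := Set.Ioi 0))
    simpa using this
  have h2 := (hmain.mul h1).const_sub 1
  rw [mul_zero, sub_zero] at h2
  refine h2.congr' ?_
  filter_upwards [eventually_ray M] with x ⟨hx0, _, _⟩
  have h3 : (x : ℂ) ≠ 0 := by exact_mod_cast hx0.ne'
  rw [div_mul_cancel₀ _ h3, sub_sub_cancel]

/-! ### Finite angular derivatives and radial limits -/

/-- The radius is itself a restricted curve, and along it the modulus of the difference quotient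
dominates `(1 - |φ|)/(1 - |z|)`. An infinite liminf would contradict the finite limit. -/
theorem angDeriv_ne_top_of_hasFiniteAngularDeriv {N : ℕ} {φ : Ball N → Ball N} {ζ : Sph N}
    (h : HasFiniteAngularDeriv φ ζ) : angDeriv φ ζ ≠ ∞ := by
  obtain ⟨η, L, hL⟩ := h
  have hIco : Set.Ico (0 : ℝ) 1 ∈ 𝓝[<] (1 : ℝ) := Ico_mem_nhdsLT one_pos
  have hn : ∀ t ∈ Set.Ico (0 : ℝ) 1, ‖(t : ℂ)‖ = t := fun t ht => by
    rw [Complex.norm_real, Real.norm_of_nonneg ht.1]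
  have hn1 : ∀ t ∈ Set.Ico (0 : ℝ) 1, ‖(t : ℂ)‖ < 1 := fun t ht => by
    rw [hn t ht]; exact ht.2
  have hcoe : ∀ t ∈ Set.Ico (0 : ℝ) 1, (slice ζ (t : ℂ) : CN N) = (t : ℂ) • (ζ : CN N) :=
    fun t ht => slice_coe ζ (hn1 t ht)
  have hγ : ∀ t ∈ Set.Ico (0 : ℝ) 1,
      inner ℂ (ζ : CN N) (slice ζ (t : ℂ) : CN N) • (ζ : CN N) = (t : ℂ) • (ζ : CN N) :=
    fun t ht => by rw [inner_slice ζ (hn1 t ht)]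
  have hofReal : Tendsto (fun t : ℝ => (t : ℂ)) (𝓝[<] 1) (𝓝 1) := by
    have := (Complex.continuous_ofReal.tendsto 1).mono_left (nhdsWithin_le_nhds (s := Set.Iio 1))
    simpa using this
  have htend := tendsto_slice ζ hofReal (by filter_upwards [hIco] with t ht using hn1 t ht)
  have hcurve : IsRestrictedCurve ζ fun t => slice ζ (t : ℂ) := by
    refine ⟨?_, tendsto_comap_iff.1 htend, ?_, 1, ?_⟩
    · rw [Topology.IsInducing.subtypeVal.continuousOn_iff]
      refine ContinuousOn.congr (f := fun t : ℝ => (t : ℂ) • (ζ : CN N)) (by fun_prop) ?_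
      exact fun t ht => hcoe t ht
    · refine tendsto_const_nhds.congr' ?_
      filter_upwards [hIco] with t ht
      rw [hγ t ht, hcoe t ht]
      simp
    · intro t ht
      simp only
      rw [hγ t ht, norm_smul, norm_sph, hn t ht, mul_one]
      have h1 : (t : ℂ) • (ζ : CN N) - ζ = ((t - 1 : ℝ) : ℂ) • (ζ : CN N) := by
        push_cast
        rw [sub_smul, one_smul]
      have h2 : 0 < 1 - t := by linarith [ht.2]
      rw [h1, norm_smul, norm_sph, mul_one, Complex.norm_real, Real.norm_eq_abs, abs_sub_comm,
        abs_of_pos h2, div_self h2.ne']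
  have hlim := (hL _ hcurve).norm
  intro htop
  have hlt : ENNReal.ofReal (‖L‖ + 1) < angDeriv φ ζ := by rw [htop]; exact ENNReal.ofReal_lt_top
  have h1 := htend.eventually (eventually_lt_of_lt_liminf hlt)
  obtain ⟨t, ht1, ht2, ht⟩ := (h1.and ((hlim.eventually_lt_const (lt_add_one ‖L‖)).and
    (eventually_mem_set.2 hIco))).exists
  have hpos : 0 < 1 - t := by linarith [ht.2]
  rw [norm_slice ζ (hn1 t ht), hn t ht,
    ENNReal.ofReal_lt_ofReal_iff_of_nonneg (by positivity)] at ht1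
  have h2 : inner ℂ (ζ : CN N) ((ζ : CN N) - (slice ζ (t : ℂ) : CN N)) = ((1 - t : ℝ) : ℂ) := by
    rw [inner_sub_right, inner_slice ζ (hn1 t ht), inner_self_eq_norm_sq_to_K, norm_sph]
    simp
  have h3 : inner ℂ (η : CN N) ((η : CN N) - (φ (slice ζ (t : ℂ)) : CN N)) =
      1 - inner ℂ (η : CN N) (φ (slice ζ (t : ℂ)) : CN N) := by
    rw [inner_sub_right, inner_self_eq_norm_sq_to_K, norm_sph]
    simp
  beta_reduce at ht2
  rw [h2, h3, norm_div, Complex.norm_real, Real.norm_of_nonneg hpos.le] at ht2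
  have h4 : 1 - ‖(φ (slice ζ (t : ℂ)) : CN N)‖ ≤
      ‖1 - inner ℂ (η : CN N) (φ (slice ζ (t : ℂ)) : CN N)‖ := by
    have h5 := norm_inner_le_norm (𝕜 := ℂ) (η : CN N) (φ (slice ζ (t : ℂ)) : CN N)
    have h6 := norm_sub_norm_le (1 : ℂ) (inner ℂ (η : CN N) (φ (slice ζ (t : ℂ)) : CN N))
    rw [norm_sph, one_mul] at h5
    rw [norm_one] at h6
    linarith
  have h5 := div_le_div_of_nonneg_right h4 hpos.le
  linarith

theorem HasRadialLimit.of_tendsto_slice {N : ℕ} {φ : Ball N → Ball N} {ζ : Sph N} {η : CN N}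
    (h : Tendsto (fun x : ℝ => (φ (slice ζ (ray 0 x)) : CN N)) (𝓝[>] 0) (𝓝 η)) :
    HasRadialLimit φ ζ η := by
  have h1 : Tendsto (fun r : Set.Ioo (0 : ℝ) 1 => 1 - (r : ℝ))
      (comap (Subtype.val : Set.Ioo (0 : ℝ) 1 → ℝ) (𝓝 1)) (𝓝[>] 0) := by
    refine tendsto_nhdsWithin_iff.2 ⟨?_, Eventually.of_forall fun r => sub_pos.2 r.2.2⟩
    have h2 : Tendsto (fun r : ℝ => 1 - r) (𝓝 1) (𝓝 (1 - 1)) :=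
      Continuous.tendsto (by fun_prop) 1
    rw [sub_self] at h2
    exact h2.comp tendsto_comap
  refine (h.comp h1).congr fun r => ?_
  have h3 : ray 0 (1 - r) = ((r : ℝ) : ℂ) := by simp [ray]
  have h4 : slice ζ (ray 0 (1 - r)) = dil r ζ := by
    refine Subtype.ext ?_
    rw [slice_coe, h3]
    · rfl
    · rw [h3, Complex.norm_real, Real.norm_of_nonneg r.2.1.le]
      exact r.2.2
  rw [Function.comp_apply, h4]

theorem HasRadialLimit.unique {N : ℕ} {φ : Ball N → Ball N} {ζ : Sph N} {η η' : CN N}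
    (h : HasRadialLimit φ ζ η) (h' : HasRadialLimit φ ζ η') : η = η' := by
  have : NeBot (comap (Subtype.val : Set.Ioo (0 : ℝ) 1 → ℝ) (𝓝 1)) :=
    mem_closure_iff_comap_neBot.1 (by
      rw [closure_Ioo zero_ne_one]
      exact Set.right_mem_Icc.2 zero_le_one)
  exact tendsto_nhds_unique h h'

/-! ### Limits of the kernel quotients along rays -/

theorem tendsto_one_sub_norm_slice_div {N : ℕ} (ζ : Sph N) (M : ℝ) :
    Tendsto (fun x : ℝ => (1 - ‖(slice ζ (ray M x) : CN N)‖) / x) (𝓝[>] 0) (𝓝 1) := by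
  have h1 : Tendsto (fun x : ℝ => (2 - (1 + M ^ 2) * x) / (1 + ‖ray M x‖)) (𝓝[>] 0)
      (𝓝 ((2 - (1 + M ^ 2) * 0) / (1 + ‖(1 : ℂ)‖))) := by
    refine Tendsto.div ?_ ((tendsto_ray M).norm.const_add 1) (by norm_num)
    exact (Continuous.tendsto (by fun_prop) 0).mono_left nhdsWithin_le_nhds
  have h2 : (2 - (1 + M ^ 2) * 0) / (1 + ‖(1 : ℂ)‖) = 1 := by norm_num
  rw [h2] at h1
  refine h1.congr' ?_
  filter_upwards [eventually_ray M] with x ⟨hx0, _, hx⟩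
  rw [norm_slice ζ hx, div_eq_div_iff (by positivity) hx0.ne']
  linear_combination norm_sq_ray M x

theorem tendsto_slice_ray {N : ℕ} (ζ : Sph N) (M : ℝ) :
    Tendsto (fun x => slice ζ (ray M x)) (𝓝[>] 0) (nhdsBall ζ) :=
  tendsto_slice ζ (tendsto_ray M) ((eventually_ray M).mono fun _ h => h.2.2)

theorem one_sub_norm_le_norm_one_sub_conj_mul {N : ℕ} {η : CN N} (hη : ‖η‖ = 1) {b : ℂ}
    (hb : ‖b‖ ≤ 1) (z : Ball N) :
    1 - ‖(z : CN N)‖ ≤ ‖1 - starRingEnd ℂ b * inner ℂ η (z : CN N)‖ := by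
  have h5 := norm_inner_le_norm (𝕜 := ℂ) η (z : CN N)
  have h6 := norm_sub_norm_le (1 : ℂ) (starRingEnd ℂ b * inner ℂ η (z : CN N))
  rw [hη, one_mul] at h5
  rw [norm_one, norm_mul, Complex.norm_conj] at h6
  have h7 := mul_le_of_le_one_left (norm_nonneg (inner ℂ η (z : CN N))) hb
  linarith

/-- The denominator is at least `1 - |φ(z)|` in modulus, and this exceeds any multiple of `1 - |z|`
near `ζ`. -/
theorem tendsto_quotient_of_angDeriv_eq_top {N : ℕ} {φ : Ball N → Ball N} {ζ : Sph N}
    (hd : angDeriv φ ζ = ∞) {η : CN N} (hη : ‖η‖ = 1) {b : ℝ → ℂ} (hb : ∀ x, ‖b x‖ ≤ 1) (M : ℝ) :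
    Tendsto (fun x : ℝ => ((1 - ‖(slice ζ (ray M x) : CN N)‖ : ℝ) : ℂ) /
      (1 - starRingEnd ℂ (b x) * inner ℂ η (φ (slice ζ (ray M x)) : CN N))) (𝓝[>] 0) (𝓝 0) := by
  rw [Metric.tendsto_nhds]
  intro ε hε
  have hlt : ENNReal.ofReal ε⁻¹ < angDeriv φ ζ := by rw [hd]; exact ENNReal.ofReal_lt_top
  filter_upwards [(tendsto_slice_ray ζ M).eventually (eventually_lt_of_lt_liminf hlt)] with x hx
  set z := slice ζ (ray M x) with hz
  have h1 : 0 < 1 - ‖(z : CN N)‖ := by linarith [norm_ball_lt z]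
  have h2 : 0 < 1 - ‖(φ z : CN N)‖ := by linarith [norm_ball_lt (φ z)]
  have h3 := one_sub_norm_le_norm_one_sub_conj_mul hη (hb x) (φ z)
  rw [ENNReal.ofReal_lt_ofReal_iff_of_nonneg (by positivity), lt_div_iff₀ h1,
    inv_mul_lt_iff₀ hε] at hx
  rw [dist_zero_right, norm_div, Complex.norm_real, Real.norm_of_nonneg h1.le,
    div_lt_iff₀ (h2.trans_le h3)]
  nlinarith

/-- The denominator tends to `1 - ⟨η', η⟩`, nonzero by the equality case of Cauchy-Schwarz, while
the numerator tends to `0`. -/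
theorem tendsto_quotient_of_ne {N : ℕ} {φ : Ball N → Ball N} {ζ : Sph N} {η η' : CN N}
    (hη : ‖η‖ = 1) (hη' : ‖η'‖ = 1) (hne : η' ≠ η) {M : ℝ}
    (hφ : Tendsto (fun x : ℝ => (φ (slice ζ (ray M x)) : CN N)) (𝓝[>] 0) (𝓝 η'))
    {b : ℝ → ℂ} (hb : Tendsto b (𝓝[>] 0) (𝓝 1)) :
    Tendsto (fun x : ℝ => ((1 - ‖(slice ζ (ray M x) : CN N)‖ : ℝ) : ℂ) /
      (1 - starRingEnd ℂ (b x) * inner ℂ η (φ (slice ζ (ray M x)) : CN N))) (𝓝[>] 0) (𝓝 0) := by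
  have h1 : Tendsto (fun x : ℝ => ((1 - ‖(slice ζ (ray M x) : CN N)‖ : ℝ) : ℂ)) (𝓝[>] 0)
      (𝓝 ((1 - ‖(ζ : CN N)‖ : ℝ) : ℂ)) :=
    (Complex.continuous_ofReal.tendsto _).comp
      ((tendsto_comap_iff.1 (tendsto_slice_ray ζ M)).norm.const_sub 1)
  have h2 : Tendsto (fun x : ℝ => inner ℂ η (φ (slice ζ (ray M x)) : CN N)) (𝓝[>] 0)
      (𝓝 (inner ℂ η η')) := tendsto_const_nhds.inner hφ
  have h3 := (((Complex.continuous_conj.tendsto 1).comp hb).mul h2).const_sub 1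
  have h4 : 1 - starRingEnd ℂ 1 * inner ℂ η η' ≠ 0 := by
    rw [map_one, one_mul, sub_ne_zero]
    exact fun h => hne ((inner_eq_one_iff_of_norm_eq_one hη hη').1 h.symm).symm
  have h5 := h1.div h3 h4
  rw [norm_sph, sub_self, Complex.ofReal_zero, zero_div] at h5
  exact h5

/-- With `a = ⟨φ, η⟩`, expand `1 - b̄a = (1 - a) + (1 - b̄) - (1 - a)(1 - b̄)`; the last term is
`O(x²)`. Conjugation turns `D'(1 + iM)` into `D'(1 - iM)`, so the imaginary part carries `D - D'`.
This is what separates different angular derivatives. -/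
theorem tendsto_quotient_of_eq {N : ℕ} {φ : Ball N → Ball N} {ζ : Sph N} {η : CN N} {M D D' : ℝ}
    (hφ : Tendsto (fun x : ℝ => (1 - inner ℂ η (φ (slice ζ (ray M x)) : CN N)) / x) (𝓝[>] 0)
      (𝓝 (D * (1 + M * Complex.I))))
    {b : ℝ → ℂ} (hb : Tendsto (fun x : ℝ => (1 - b x) / x) (𝓝[>] 0)
      (𝓝 (D' * (1 + M * Complex.I)))) (hD : 0 < D + D') :
    Tendsto (fun x : ℝ => ((1 - ‖(slice ζ (ray M x) : CN N)‖ : ℝ) : ℂ) /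
      (1 - starRingEnd ℂ (b x) * inner ℂ η (φ (slice ζ (ray M x)) : CN N))) (𝓝[>] 0)
      (𝓝 ((D + D' + (D - D') * M * Complex.I : ℂ)⁻¹)) := by
  have hx : Tendsto (fun x : ℝ => (x : ℂ)) (𝓝[>] 0) (𝓝 0) := by
    have := (Complex.continuous_ofReal.tendsto 0).mono_left (nhdsWithin_le_nhds (s := Set.Ioi 0))
    simpa using this
  have hb' := (Complex.continuous_conj.tendsto _).comp hb
  have hden := (hφ.add hb').sub ((hφ.mul hb').mul hx)
  have hval : (D * (1 + M * Complex.I) + starRingEnd ℂ (D' * (1 + M * Complex.I)) -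
      D * (1 + M * Complex.I) * starRingEnd ℂ (D' * (1 + M * Complex.I)) * 0 : ℂ) =
      D + D' + (D - D') * M * Complex.I := by
    simp only [map_mul, map_add, map_one, Complex.conj_ofReal, Complex.conj_I]
    ring
  rw [hval] at hden
  have hne : (D + D' + (D - D') * M * Complex.I : ℂ) ≠ 0 := by
    intro h
    have := congrArg Complex.re h
    simp at this
    linarith
  have hnum : Tendsto (fun x : ℝ => (((1 - ‖(slice ζ (ray M x) : CN N)‖) / x : ℝ) : ℂ)) (𝓝[>] 0)
      (𝓝 ((1 : ℝ) : ℂ)) :=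
    (Complex.continuous_ofReal.tendsto _).comp (tendsto_one_sub_norm_slice_div ζ M)
  have hq := hnum.div hden hne
  rw [Complex.ofReal_one, one_div] at hq
  refine hq.congr' ?_
  filter_upwards [self_mem_nhdsWithin] with x hx0
  have hx1 : (x : ℂ) ≠ 0 := by exact_mod_cast (ne_of_gt hx0)
  have e : (1 - inner ℂ η (φ (slice ζ (ray M x)) : CN N)) / x +
      ((starRingEnd ℂ ∘ fun x : ℝ => (1 - b x) / x) x) -
      (1 - inner ℂ η (φ (slice ζ (ray M x)) : CN N)) / x *
      ((starRingEnd ℂ ∘ fun x : ℝ => (1 - b x) / x) x) * x =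
      (1 - starRingEnd ℂ (b x) * inner ℂ η (φ (slice ζ (ray M x)) : CN N)) / x := by
    simp only [Function.comp_apply, map_div₀, map_sub, map_one, Complex.conj_ofReal]
    field_simp
    ring
  simp only [Pi.div_apply]
  rw [e, Complex.ofReal_div, div_div_div_cancel_right₀ hx1]

theorem tendsto_inv_add_mul_I {A B : ℝ} (hB : B ≠ 0) :
    Tendsto (fun M : ℝ => ((A : ℂ) + B * M * Complex.I)⁻¹) atTop (𝓝 0) := by
  refine tendsto_inv₀_cobounded.comp (tendsto_norm_atTop_iff_cobounded.1 ?_)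
  have h1 : Tendsto (fun M : ℝ => |B| * M) atTop atTop :=
    tendsto_id.const_mul_atTop (abs_pos.2 hB)
  refine tendsto_atTop_mono (fun M => ?_) h1
  have h2 := Complex.abs_im_le_norm ((A : ℂ) + B * M * Complex.I)
  have h3 : ((A : ℂ) + B * M * Complex.I).im = B * M := by simp
  rw [h3, abs_mul] at h2
  exact (mul_le_mul_of_nonneg_left (le_abs_self M) (abs_nonneg B)).trans h2

open Classical in
/-- The asymptotic form of the linear relation along the rays `1 - (1 + i M) x`. -/
theorem sum_mul_inv_pow_eq_zero {N m : ℕ} [NeZero N] {s : Set.Ici (-1 : ℝ)}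
    {φ : Fin m → Ball N → Ball N} (hφ : ∀ j, IsHoloSelfMap (φ j))
    {hb : ∀ j, IsCompBounded s (φ j)} {c : Fin m → ℂ}
    (hK : IsCompactOperator ⇑(∑ j, c j • compOp s (φ j) (hb j) : A2 N s →L[ℂ] A2 N s))
    {ζ : Sph N} {j : Fin m} (hj : angDeriv (φ j) ζ ≠ ∞) {η : CN N}
    (hjη : HasRadialLimit (φ j) ζ η) {t : ℕ} (ht : (N : ℝ) + s + 1 < 2 * t) (ht0 : t ≠ 0) (M : ℝ) :
    ∑ l with angDeriv (φ l) ζ ≠ ∞ ∧ HasRadialLimit (φ l) ζ η,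
      c l * ((((angDeriv (φ l) ζ).toReal + (angDeriv (φ j) ζ).toReal : ℝ) : ℂ) +
        (((angDeriv (φ l) ζ).toReal - (angDeriv (φ j) ζ).toReal : ℝ) : ℂ) * M * Complex.I)⁻¹ ^ t
      = 0 := by
  obtain ⟨hD, η', hη', hJC⟩ := julia_caratheodory (hφ j) hj
  obtain rfl : η = η' := hjη.unique (.of_tendsto_slice (hJC 0).2)
  set D := fun l => (angDeriv (φ l) ζ).toReal with hDdef
  set w : ℝ → Ball N := fun x => slice ζ (ray M x) with hw
  set β : ℝ → ℂ := fun x => inner ℂ η (φ j (w x) : CN N) with hβ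
  have hβ1 : ∀ x, ‖β x‖ < 1 := fun x => norm_inner_lt_one hη' _
  have hnb : ∀ x, ‖β x • η‖ = ‖β x‖ := fun x => by rw [norm_smul, hη', mul_one]
  -- The pole is the projection of `φ j (w x)` to the line of `η`, so that only `η`-components enter
  -- the kernel and tangential components of the maps need no control.
  set b : ℝ → Ball N := fun x => ⟨β x • η, by rw [mem_ball_zero_iff, hnb]; exact hβ1 x⟩ with hbdef
  have hβlim : Tendsto β (𝓝[>] 0) (𝓝 1) := by
    have : Tendsto β (𝓝[>] 0) (𝓝 (inner ℂ η η)) := tendsto_const_nhds.inner (hJC M).2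
    rwa [inner_self_eq_norm_sq_to_K, hη', RCLike.ofReal_one, one_pow] at this
  have hw0 : Tendsto (fun x => 1 - ‖(w x : CN N)‖) (𝓝[>] 0) (𝓝 0) := by
    have := (tendsto_comap_iff.1 (tendsto_slice_ray ζ M)).norm.const_sub 1
    rwa [norm_sph, sub_self] at this
  -- Projecting does not increase the norm, so `1 - |b| ≥ 1 - |φ_j(w)|`, which exceeds `(D_j / 2)(1
  -- - |w|)` near `ζ` since the liminf is `D_j > D_j / 2`.
  have hwb : ∀ᶠ x in 𝓝[>] 0, 1 - ‖(w x : CN N)‖ ≤ (2 / D j) * (1 - ‖(b x : CN N)‖) := by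
    have hlt : ENNReal.ofReal (D j / 2) < angDeriv (φ j) ζ := by
      rw [← ENNReal.ofReal_toReal hj]
      exact (ENNReal.ofReal_lt_ofReal_iff hD).2 (half_lt_self hD)
    filter_upwards [(tendsto_slice_ray ζ M).eventually (eventually_lt_of_lt_liminf hlt)] with x hx
    have h1 : 0 < 1 - ‖(w x : CN N)‖ := by linarith [norm_ball_lt (w x)]
    have h2 : ‖β x‖ ≤ ‖(φ j (w x) : CN N)‖ := by
      have h := norm_inner_le_norm (𝕜 := ℂ) η (φ j (w x) : CN N)
      rwa [hη', one_mul] at h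
    rw [ENNReal.ofReal_lt_ofReal_iff_of_nonneg (by positivity), lt_div_iff₀ h1] at hx
    change _ ≤ (2 / D j) * (1 - ‖β x • η‖)
    rw [hnb, div_mul_eq_mul_div, le_div_iff₀ hD]
    change D j / 2 * (1 - ‖(w x : CN N)‖) < 1 - ‖(φ j (w x) : CN N)‖ at hx
    linarith
  have hzero := tendsto_sum_kernelPow_of_isCompactOperator hK ht hw0 (by positivity) hwb
  set q : Fin m → ℝ → ℂ := fun l x => ((1 - ‖(w x : CN N)‖ : ℝ) : ℂ) /
    (1 - starRingEnd ℂ (β x) * inner ℂ η (φ l (w x) : CN N)) with hq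
  have hsum : ∀ x, ((1 - ‖(w x : CN N)‖ : ℝ) : ℂ) ^ t * ∑ l, c l * kernelPow t (b x) (φ l (w x)) =
      ∑ l, c l * q l x ^ t := by
    intro x
    rw [Finset.mul_sum]
    refine Finset.sum_congr rfl fun l _ => ?_
    have h1 : inner ℂ (b x : CN N) (φ l (w x) : CN N) =
        starRingEnd ℂ (β x) * inner ℂ η (φ l (w x) : CN N) := by
      change inner ℂ (β x • η) _ = _
      rw [inner_smul_left]
    rw [kernelPow, h1, hq]
    simp only
    rw [div_eq_mul_inv, mul_pow]
    ring
  simp only [hsum] at hzero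
  have hql : ∀ l, Tendsto (q l) (𝓝[>] 0)
      (𝓝 (if angDeriv (φ l) ζ ≠ ∞ ∧ HasRadialLimit (φ l) ζ η then
        (((D l + D j : ℝ) : ℂ) + ((D l - D j : ℝ) : ℂ) * M * Complex.I)⁻¹ else 0)) := by
    intro l
    by_cases hl : angDeriv (φ l) ζ = ∞
    · rw [if_neg fun h => h.1 hl]
      exact tendsto_quotient_of_angDeriv_eq_top hl hη' (fun x => (hβ1 x).le) M
    · obtain ⟨hDl, ηl, hηl, hl'⟩ := julia_caratheodory (hφ l) hl
      have hrad : HasRadialLimit (φ l) ζ ηl := .of_tendsto_slice (hl' 0).2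
      by_cases hηη : ηl = η
      · subst hηη
        rw [if_pos ⟨hl, hrad⟩]
        push_cast
        exact tendsto_quotient_of_eq (hl' M).1 (hJC M).1 (add_pos hDl hD)
      · rw [if_neg fun h => hηη (hrad.unique h.2)]
        exact tendsto_quotient_of_ne hη' hηl hηη (hl' M).2 hβlim
  have hlim : Tendsto (fun x => ∑ l, c l * q l x ^ t) (𝓝[>] 0) _ :=
    tendsto_finsetSum _ fun l _ => ((hql l).pow t).const_mul (c l)
  have := tendsto_nhds_unique hlim hzero
  rw [Finset.sum_filter]
  refine (Finset.sum_congr rfl fun l _ => ?_).trans this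
  split_ifs
  · rfl
  · rw [zero_pow ht0, mul_zero]

end UnitBall

theorem corollary2p4 (N : ℕ) [NeZero N] (s : Set.Ici (-1 : ℝ)) (m : ℕ)
    (φ : Fin m → UnitBall.Ball N → UnitBall.Ball N)
    (hφ : ∀ j, UnitBall.IsHoloSelfMap (φ j))
    (hb : ∀ j, UnitBall.IsCompBounded s (φ j))
    (c : Fin m → ℂ)
    (hK : IsCompactOperator
      ⇑(∑ j, c j • UnitBall.compOp s (φ j) (hb j) : UnitBall.A2 N s →L[ℂ] UnitBall.A2 N s))
    (ζ : UnitBall.Sph N) (j : Fin m) (hj : UnitBall.HasFiniteAngularDeriv (φ j) ζ) :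
    ∑ l ∈ UnitBall.sameDataIndices φ ζ j, c l = 0 := by
  classical
  open UnitBall in
  have hd := angDeriv_ne_top_of_hasFiniteAngularDeriv hj
  obtain ⟨hD, η, hη, hJC⟩ := julia_caratheodory (hφ j) hd
  have hrad : HasRadialLimit (φ j) ζ η := .of_tendsto_slice (hJC 0).2
  -- Any such `t` satisfies `2t > κ`, and it is nonzero, so the vanishing quotients have vanishing
  -- `t`-th powers.
  obtain ⟨t, ht⟩ := exists_nat_gt ((N : ℝ) + s + 1)
  have hs : (-1 : ℝ) ≤ s := s.2
  have hN : (0 : ℝ) ≤ N := N.cast_nonneg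
  have ht0' : (0 : ℝ) < t := by linarith
  have ht0 : t ≠ 0 := by rintro rfl; simp at ht0'
  have hrel := sum_mul_inv_pow_eq_zero hφ hK hd hrad (t := t) (by linarith) ht0
  set D := fun l => (angDeriv (φ l) ζ).toReal with hDdef
  set E : Finset (Fin m) := {l | angDeriv (φ l) ζ ≠ ∞ ∧ HasRadialLimit (φ l) ζ η} with hE
  -- The relation holds for every slope `M`; as `M → ∞` only the terms with `D l = D j` keep a
  -- nonzero factor.
  have hlim : Tendsto (fun M : ℝ => ∑ l ∈ E, c l *
      (((D l + D j : ℝ) : ℂ) + ((D l - D j : ℝ) : ℂ) * M * Complex.I)⁻¹ ^ t) atTop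
      (𝓝 (∑ l ∈ E, c l * (if D l = D j then ((2 * D j : ℝ) : ℂ)⁻¹ else 0) ^ t)) := by
    refine tendsto_finsetSum _ fun l _ => Tendsto.const_mul _ (Tendsto.pow ?_ t)
    split_ifs with h
    · refine tendsto_const_nhds.congr fun M => ?_
      rw [h, sub_self, two_mul]
      simp
    · exact tendsto_inv_add_mul_I (sub_ne_zero.2 h)
  have h0 := tendsto_nhds_unique (hlim.congr hrel) tendsto_const_nhds
  -- Finiteness of `d_{φ_j}(ζ)` forces finiteness for every index with the same data, and on finite
  -- values equality of `toReal` is equality in `[0, ∞]`.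
  have hset : sameDataIndices φ ζ j = E.filter fun l => D l = D j := by
    ext l
    simp only [sameDataIndices, hE, Finset.mem_filter, Finset.mem_univ, true_and]
    constructor
    · rintro ⟨⟨η', h1, h2⟩, h3⟩
      obtain rfl := h2.unique hrad
      exact ⟨⟨h3 ▸ hd, h1⟩, by simp only [hDdef, h3]⟩
    · rintro ⟨⟨h1, h2⟩, h3⟩
      exact ⟨⟨η, h2, hrad⟩, (ENNReal.toReal_eq_toReal_iff' h1 hd).1 h3⟩
  have h1 : ∑ l ∈ E, c l * (if D l = D j then ((2 * D j : ℝ) : ℂ)⁻¹ else 0) ^ t =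
      (∑ l ∈ sameDataIndices φ ζ j, c l) * ((2 * D j : ℝ) : ℂ)⁻¹ ^ t := by
    rw [hset, Finset.sum_mul, Finset.sum_filter fun l => D l = D j]
    refine Finset.sum_congr rfl fun l _ => ?_
    split_ifs
    · rfl
    · rw [zero_pow ht0, mul_zero]
  rw [h1, mul_eq_zero] at h0
  refine h0.resolve_right (pow_ne_zero _ (inv_ne_zero ?_))
  exact_mod_cast (mul_pos two_pos hD).ne'
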